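/- Let $m>n$ be integers with $m>1$, let $D=D_1\times D_2\times D_3\subset\mathbb{R}^n\times\mathbb{R}^{m-n}\times\mathbb{R}$ with $D_1,D_2,D_3$ open, let $g:D_1\times D_2\to D_3$ and $X_0^\pm:D\to\mathbb{R}^{m+1}$ be of class $C^2$, and let $X_1^\pm:D\to\mathbb{R}^{m+1}$ and $R^\pm:D\times(-\varepsilon_0,\varepsilon_0)\to\mathbb{R}^{m+1}$ be of class $C^1$ ($\varepsilon_0>0$). Consider the piecewise smooth system $$(\dot x,\dot y,\dot z)=X_\varepsilon^{\pm}(x,y,z):=X_0^\pm(x,y,z)+\varepsilon X_1^\pm(x,y,z)+\varepsilon^2R^\pm(x,y,z,\varepsilon)\qquad(\ast)_\varepsilon$$ with the sign $+$ where $z>g(x,y)$ and $-$ where $z<g(x,y)$. Put $h(x,y,z)=z-g(x,y)$, $\Sigma=\{p\in D: h(p)=0\}$, $Xh=\nabla h\cdot X$, and let $\varphi_0^\pm(t,p)$ be the flow of $X_0^\pm$ in $D$. A \emph{crossing periodic solution} of $(\ast)_\varepsilon$ is a periodic function $\varphi:\mathbb{R}\to D$ of period $t_2-t_0$, for some $t_0<t_1<t_2$,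 that solves $\dot p=X^+_\varepsilon(p)$ on $[t_0,t_1]$ and $\dot p=X^-_\varepsilon(p)$ on $[t_1,t_2]$, with $h(\varphi)=0$ at $t_0,t_1$, $h(\varphi)>0$ on $(t_0,t_1)$, $h(\varphi)<0$ on $(t_1,t_2)$, $X_\varepsilon^\pm h(\varphi(t_0))>0$ and $X_\varepsilon^\pm h(\varphi(t_1))<0$ (each for both signs). Let $\mathcal V\subset\mathbb{R}^n$ be open and bounded and $v:\overline{\mathcal V}\to\mathbb{R}^{m-n}$ of class $C^2$ with $(u,v(u))\in D_1\times D_2$ for $u\in\overline{\mathcal V}$; write $p_u=(u,v(u),g(u,v(u)))$. Assume (H1) for each $u\in\mathcal V$ there are $\tau^-(u)<0<\tau^+(u)$ such that the solutions below exist in $D$ on the closed time intervals and: (a) $\varphi_0^-(\tau^-(u),p_u)=\varphi_0^+(\tau^+(u),p_u)$; (b) $h(\varphi_0^-(t,p_u))<0$ for $t\in(\tau^-(u),0)$; (c) $h(\varphi_0^+(t,p_u))>0$ for $t\in(0,\tau^+(u))$; (d) $X_0^\pm h(p_u)>0$; (e) $X_0^\pm h(\varphi_0^-(\tau^-(u),p_u))<0$.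 Let $\Pi_1,\Pi_2$ be the matrices of the projections $(x,y,z)\mapsto x$ and $(x,y,z)\mapsto y$, let $q_u=\varphi_0^\pm(\tau^\pm(u),p_u)$, and put $\alpha=\alpha^+-\alpha^-$, $\beta=\beta^+-\beta^-$, where $$\alpha^\pm(u)=\Big(\mathrm{Id}-\frac{X_0^\pm(q_u)\,\nabla h(q_u)}{X_0^\pm h(q_u)}\Big)\,\omega^\pm(\tau^\pm(u),p_u),\qquad \beta^\pm(u)=\Big(\mathrm{Id}-\frac{X_0^\pm(q_u)\,\nabla h(q_u)}{X_0^\pm h(q_u)}\Big)\,Y^\pm(\tau^\pm(u),p_u),$$ $$\omega^\pm(t,p)=D_p\varphi_0^\pm(t,p)\int_0^t\big(D_p\varphi_0^\pm(s,p)\big)^{-1}X_1^\pm(\varphi_0^\pm(s,p))\,ds,$$ $$Y^\pm(t,x,y,z)=\frac{\partial\varphi_0^\pm}{\partial y}(t,x,y,z)+\frac{\partial\varphi_0^\pm}{\partial z}(t,x,y,z)\,\frac{\partial g}{\partial y}(x,y).$$ Assume $\det(\Pi_2\beta(u))\neq0$ for every $u\in\mathcal V$, and define $\mathcal M:\mathcal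 V\to\mathbb{R}^n$ by $$\mathcal M(u)=\Pi_1\big(\mathrm{Id}-\beta(u)(\Pi_2\beta(u))^{-1}\Pi_2\big)\alpha(u).$$ Then for each $u^*\in\mathcal V$ with $\mathcal M(u^*)=0$ and $\det D\mathcal M(u^*)\neq0$ there are $\varepsilon_1\in(0,\varepsilon_0]$ and $\delta>0$ such that for every $\varepsilon$ with $0<|\varepsilon|<\varepsilon_1$ the system $(\ast)_\varepsilon$ has a crossing periodic solution $\varphi_\varepsilon$ with $\varphi_\varepsilon(0)\in\Sigma$ and $|\varphi_\varepsilon(0)-p_{u^*}|<\delta$; it is unique, in the sense that every crossing periodic solution $\psi$ of $(\ast)_\varepsilon$ with $|\psi(0)-p_{u^*}|<\delta$ is a time translate of $\varphi_\varepsilon$, and equals $\varphi_\varepsilon$ if $\psi(0)\in\Sigma$. Moreover $\varphi_\varepsilon(0)\to p_{u^*}$ as $\varepsilon\to0$. -/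

import Mathlib

open Set Filter Topology

noncomputable section

/-- The phase space `ℝⁿ × ℝᵏ × ℝ ≅ ℝ^(m+1)`, with `m = n + k`; a point is `(x, y, z)`. -/
abbrev State (n k : ℕ) : Type :=
  EuclideanSpace ℝ (Fin n) × EuclideanSpace ℝ (Fin k) × ℝ

/-- The two zones: `plus` is `z > g(x,y)`, `minus` is `z < g(x,y)`. -/
inductive Side : Type
  | plus
  | minus

/-- The data of a two-zone piecewise smooth system
`X₀ + ε X₁ + ε² R` on `D = D₁ × D₂ × D₃`, with switching manifold `z = g(x,y)`. -/
structure PWSystem (n k : ℕ) where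
  D₁ : Set (EuclideanSpace ℝ (Fin n))
  D₂ : Set (EuclideanSpace ℝ (Fin k))
  D₃ : Set ℝ
  g : EuclideanSpace ℝ (Fin n) × EuclideanSpace ℝ (Fin k) → ℝ
  X₀ : Side → State n k → State n k
  X₁ : Side → State n k → State n k
  R : Side → State n k × ℝ → State n k

/-- `γ` is a solution of `ṗ = X(p)` on the time set `I` that stays in `D`
(one-sided derivatives at end points of `I`). -/
def IsSolutionOn {n k : ℕ} (X : State n k → State n k) (D : Set (State n k))
    (γ : ℝ → State n k) (I : Set ℝ) : Prop :=
  IsIntegralCurveOn γ (fun _ => X) I ∧ ∀ t ∈ I, γ t ∈ D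

/-- The solution of `ṗ = X(p)` in `D` with initial condition `p` at time `0` exists up to
the (positive or negative) time `t`. -/
def FlowDefined {n k : ℕ} (X : State n k → State n k) (D : Set (State n k))
    (t : ℝ) (p : State n k) : Prop :=
  ∃ γ : ℝ → State n k, γ 0 = p ∧ IsSolutionOn X D γ (uIcc 0 t)

open Classical in
/-- The local flow: the value at time `t` of the solution of `ṗ = X(p)` in `D` with initial
condition `p` at time `0` (and `p` where that solution does not reach time `t`). -/
def flow {n k : ℕ} (X : State n k → State n k) (D : Set (State n k))
    (t : ℝ) (p : State n k) : State n k :=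
  if H : FlowDefined X D t p then H.choose t else p

namespace PWSystem

variable {n k : ℕ} (S : PWSystem n k)

/-- The domain `D = D₁ × D₂ × D₃`. -/
def D : Set (State n k) := S.D₁ ×ˢ (S.D₂ ×ˢ S.D₃)

/-- `h(x,y,z) = z - g(x,y)`. -/
def h (p : State n k) : ℝ := p.2.2 - S.g (p.1, p.2.1)

/-- The switching manifold. -/
def switching : Set (State n k) := {p | p ∈ S.D ∧ S.h p = 0}

/-- Lie derivative of `h` at `p` in the direction of the vector field `X`. -/
def lie (X : State n k → State n k) (p : State n k) : ℝ := fderiv ℝ S.h p (X p)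

/-- The perturbed vector field of one zone. -/
def field (ε : ℝ) (σ : Side) (p : State n k) : State n k :=
  S.X₀ σ p + ε • S.X₁ σ p + ε ^ 2 • S.R σ (p, ε)

/-- Standing regularity assumptions. -/
structure Regular (ε₀ : ℝ) : Prop where
  isOpen_D₁ : IsOpen S.D₁
  isOpen_D₂ : IsOpen S.D₂
  isOpen_D₃ : IsOpen S.D₃
  mapsTo_g : MapsTo S.g (S.D₁ ×ˢ S.D₂) S.D₃
  contDiffOn_g : ContDiffOn ℝ 2 S.g (S.D₁ ×ˢ S.D₂)
  contDiffOn_X₀ : ∀ σ, ContDiffOn ℝ 2 (S.X₀ σ) S.D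
  contDiffOn_X₁ : ∀ σ, ContDiffOn ℝ 1 (S.X₁ σ) S.D
  contDiffOn_R : ∀ σ, ContDiffOn ℝ 1 (S.R σ) (S.D ×ˢ Ioo (-ε₀) ε₀)

/-- The unperturbed flow `φ₀^±` of one zone. -/
def flow₀ (σ : Side) (t : ℝ) (p : State n k) : State n k := flow (S.X₀ σ) S.D t p

/-- The derivative `D_{(x,y,z)} φ₀^±(t, p)`. -/
def dflow₀ (σ : Side) (t : ℝ) (p : State n k) : State n k →L[ℝ] State n k :=
  fderiv ℝ (S.flow₀ σ t) p

/-- The point `(u, v(u), g(u, v(u)))`. -/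
def basePoint (v : EuclideanSpace ℝ (Fin n) → EuclideanSpace ℝ (Fin k))
    (u : EuclideanSpace ℝ (Fin n)) : State n k :=
  (u, v u, S.g (u, v u))

/-- The family of crossing periodic orbits of the unperturbed system:
for `u ∈ V` the orbit through `(u, v(u), g(u, v(u)))` closes up, after time `τ plus u` in
`z > g` and time `τ minus u` (backwards) in `z < g`, and is transversal to the switching
manifold at both crossings. -/
structure CrossingFamily (V : Set (EuclideanSpace ℝ (Fin n)))
    (v : EuclideanSpace ℝ (Fin n) → EuclideanSpace ℝ (Fin k))
    (τ : Side → EuclideanSpace ℝ (Fin n) → ℝ) : Prop where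
  tau_neg : ∀ u ∈ V, τ .minus u < 0
  tau_pos : ∀ u ∈ V, 0 < τ .plus u
  defined : ∀ u ∈ V, ∀ σ, FlowDefined (S.X₀ σ) S.D (τ σ u) (S.basePoint v u)
  closes : ∀ u ∈ V, S.flow₀ .minus (τ .minus u) (S.basePoint v u) =
    S.flow₀ .plus (τ .plus u) (S.basePoint v u)
  below : ∀ u ∈ V, ∀ t ∈ Ioo (τ .minus u) 0, S.h (S.flow₀ .minus t (S.basePoint v u)) < 0
  above : ∀ u ∈ V, ∀ t ∈ Ioo 0 (τ .plus u), 0 < S.h (S.flow₀ .plus t (S.basePoint v u))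
  transversal_start : ∀ u ∈ V, ∀ σ, 0 < S.lie (S.X₀ σ) (S.flow₀ .plus 0 (S.basePoint v u))
  transversal_end : ∀ u ∈ V, ∀ σ,
    S.lie (S.X₀ σ) (S.flow₀ .minus (τ .minus u) (S.basePoint v u)) < 0

/-- `ω^±(t,p) = D φ₀^±(t,p) ∫₀ᵗ (D φ₀^±(s,p))⁻¹ X₁^±(φ₀^±(s,p)) ds`. -/
def omega (σ : Side) (t : ℝ) (p : State n k) : State n k :=
  S.dflow₀ σ t p (∫ s in (0 : ℝ)..t, (S.dflow₀ σ s p).inverse (S.X₁ σ (S.flow₀ σ s p)))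

/-- The tangent map `η ↦ (0, η, ∂g/∂y(x,y) η)`. -/
def liftY (p : State n k) : EuclideanSpace ℝ (Fin k) →L[ℝ] State n k :=
  (0 : EuclideanSpace ℝ (Fin k) →L[ℝ] EuclideanSpace ℝ (Fin n)).prod
    ((ContinuousLinearMap.id ℝ (EuclideanSpace ℝ (Fin k))).prod
      (fderiv ℝ (fun y => S.g (p.1, y)) p.2.1))

/-- `Y^± = ∂φ₀^±/∂y + ∂φ₀^±/∂z · ∂g/∂y`. -/
def matY (σ : Side) (t : ℝ) (p : State n k) : EuclideanSpace ℝ (Fin k) →L[ℝ] State n k :=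
  (S.dflow₀ σ t p).comp (S.liftY p)

/-- `Id - X₀^±(q) ∇h(q) / X₀^±h(q)`. -/
def proj (σ : Side) (q : State n k) : State n k →L[ℝ] State n k :=
  ContinuousLinearMap.id ℝ (State n k) -
    (S.lie (S.X₀ σ) q)⁻¹ • (fderiv ℝ S.h q).smulRight (S.X₀ σ q)

section Melnikov

variable (v : EuclideanSpace ℝ (Fin n) → EuclideanSpace ℝ (Fin k))
  (τ : Side → EuclideanSpace ℝ (Fin n) → ℝ) (u : EuclideanSpace ℝ (Fin n))

/-- `α^±(u)`. -/
def alphaSide (σ : Side) : State n k :=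
  S.proj σ (S.flow₀ σ (τ σ u) (S.basePoint v u)) (S.omega σ (τ σ u) (S.basePoint v u))

/-- `β^±(u)`, an `(m+1) × (m-n)` matrix. -/
def betaSide (σ : Side) : EuclideanSpace ℝ (Fin k) →L[ℝ] State n k :=
  (S.proj σ (S.flow₀ σ (τ σ u) (S.basePoint v u))).comp
    (S.matY σ (τ σ u) (S.basePoint v u))

/-- `α = α⁺ - α⁻`. -/
def alpha : State n k := S.alphaSide v τ u .plus - S.alphaSide v τ u .minus

/-- `β = β⁺ - β⁻`. -/
def beta : EuclideanSpace ℝ (Fin k) →L[ℝ] State n k :=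
  S.betaSide v τ u .plus - S.betaSide v τ u .minus

/-- The square block `Π₂ β(u)`. -/
def beta₂ : EuclideanSpace ℝ (Fin k) →L[ℝ] EuclideanSpace ℝ (Fin k) :=
  ((ContinuousLinearMap.fst ℝ (EuclideanSpace ℝ (Fin k)) ℝ).comp
    (ContinuousLinearMap.snd ℝ (EuclideanSpace ℝ (Fin n))
      (EuclideanSpace ℝ (Fin k) × ℝ))).comp (S.beta v τ u)

/-- The Melnikov function `M(u) = Π₁ (Id - β (Π₂ β)⁻¹ Π₂) α`. -/
def melnikov : EuclideanSpace ℝ (Fin n) :=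
  (S.alpha v τ u - S.beta v τ u ((S.beta₂ v τ u).inverse (S.alpha v τ u).2.1)).1

end Melnikov

/-- `φ` is a crossing periodic solution of the system with parameter `ε`: over one period it
consists of one solution arc in `z > g` and one solution arc in `z < g`, both reaching the
switching manifold at their end points, where both vector fields cross it in the same
direction. The time origin is arbitrary. -/
def IsCrossingPeriodicSolution (ε : ℝ) (φ : ℝ → State n k) : Prop :=
  ∃ t₀ t₁ t₂ : ℝ, t₀ < t₁ ∧ t₁ < t₂ ∧ Function.Periodic φ (t₂ - t₀) ∧
    IsSolutionOn (S.field ε .plus) S.D φ (Icc t₀ t₁) ∧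
    IsSolutionOn (S.field ε .minus) S.D φ (Icc t₁ t₂) ∧
    S.h (φ t₀) = 0 ∧ S.h (φ t₁) = 0 ∧
    (∀ t ∈ Ioo t₀ t₁, 0 < S.h (φ t)) ∧ (∀ t ∈ Ioo t₁ t₂, S.h (φ t) < 0) ∧
    (∀ σ, 0 < S.lie (S.field ε σ) (φ t₀)) ∧ (∀ σ, S.lie (S.field ε σ) (φ t₁) < 0)

end PWSystem

end

/-! A crossing periodic solution is determined by its upward crossing point over `(u, y)` and by two
times `t₊ > 0 > t₋`: the arc of the upper field followed forwards and the arc of the lower field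
followed backwards must arrive at the same point of the switching manifold. These are `n + k + 2`
equations: `k + 2` of them form `closing`, the other `n` compare the first coordinates of the
arrival points. For `ε = 0` every `u` in `V` gives a solution with `y = v u` and `t = τ u`, so the
full system is degenerate. Only `closing` can be solved by the implicit function theorem, for `(y,
t₊, t₋)`; what remains vanishes at `ε = 0` and has to be divided by `ε` before a simple zero can be
continued (Lyapunov–Schmidt).

The division must leave a C¹ function, and C¹ dependence of the flow on `ε` alone would make the
quotient merely continuous. Therefore the perturbed solution is written as `q + ε ξ`, with `q` an
unperturbed solution. By Hadamard's lemma `(X₀(q + ε ξ) - X₀(q)) / ε` extends to a C¹ function up to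
`ε = 0`, because `X₀` is C². So `ξ` obeys an equation with C¹ right-hand side, `blowupField`, and
the quotient is a component of its flow. At `ε = 0` the equation for `ξ` is linear, and variation of
constants produces the term `ω`.

In the coordinates `y = v u + ε y'`, `t = τ u + ε s` all equations become divisible by `ε`. At `ε =
0` they are affine in `(y', s₊, s₋)`. Tangency to the switching manifold eliminates `s₊`, `s₋` and
replaces the deviations by `α + β y'` (`proj_add_smul`); invertibility of `Π₂ β` eliminates `y'`;
the first coordinate left over is the Melnikov function (`eq_melnikov`). The abstract reduction is
`exists_branch_of_simple_zero`.

Blown-up coordinates see only a neighbourhood of size `ε`, which is too small for uniqueness. But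
`closing` itself has the same invertible derivative `closingDeriv`, so its zeros are unique in a
neighbourhood independent of `ε` and coincide with the blown-up ones. To apply this to an arbitrary
crossing periodic solution starting near `p_{u*}`, transversality is used twice: the solution has an
upward crossing near `p_{u*}` (`exists_crossing_near`), and its crossing times are near `τ u*`
(`TransversalArc.exists_nhds`).

The C¹ theory of the flow is derived from the implicit function theorem in `C([0,1], E)`. -/

/-! ### Superposition operators on spaces of continuous functions. -/

section Superposition

variable {K E F : Type*} [TopologicalSpace K] [NormedAddCommGroup E] [NormedAddCommGroup F]

open Classical in
/-- The superposition operator `γ ↦ f ∘ γ` between spaces of continuous functions, with value `0`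
where `f ∘ γ` is not continuous. -/
noncomputable def superposition (f : E → F) (γ : C(K, E)) : C(K, F) :=
  if h : Continuous (f ∘ γ) then ⟨f ∘ γ, h⟩ else 0

theorem superposition_apply {f : E → F} {U : Set E} (hf : ContinuousOn f U) {γ : C(K, E)}
    (hγ : ∀ t, γ t ∈ U) (t : K) : superposition f γ t = f (γ t) := by
  have h : Continuous (f ∘ γ) := hf.comp_continuous γ.continuous hγ
  simp [superposition, h]

variable [CompactSpace K]

theorem eventually_forall_apply_mem {U : Set E} (hU : IsOpen U) {γ : C(K, E)}
    (hγ : ∀ t, γ t ∈ U) : ∀ᶠ η in 𝓝 γ, ∀ t, η t ∈ U := by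
  have := (ContinuousMap.isOpen_setOfPred_mapsTo (X := K) isCompact_univ hU).mem_nhds
    (show γ ∈ {f : C(K, E) | MapsTo f univ U} from fun t _ => hγ t)
  filter_upwards [this] with η hη t using hη (mem_univ t)

/-- The range of `γ` is compact, so one radius serves all `t`. This turns continuity of `f` into
estimates in the supremum norm. -/
theorem exists_uniform_nhds {f : E → F} {U : Set E} (hU : IsOpen U) (hf : ContinuousOn f U)
    {γ : C(K, E)} (hγ : ∀ t, γ t ∈ U) {c : ℝ} (hc : 0 < c) :
    ∃ δ > 0, ∀ t x, dist x (γ t) < δ → x ∈ U ∧ dist (f x) (f (γ t)) < c := by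
  have hK : IsCompact (range γ) := isCompact_range γ.continuous
  have hsub : range γ ⊆ U := by rintro _ ⟨t, rfl⟩; exact hγ t
  obtain ⟨δ₁, h₁, h₁'⟩ := hK.exists_thickening_subset_open hU hsub
  have := hK.uniformContinuousAt_of_continuousAt f
    (fun a ha => hf.continuousAt (hU.mem_nhds (hsub ha))) (Metric.dist_mem_uniformity hc)
  obtain ⟨δ₂, h₂, h₂'⟩ := Metric.mem_uniformity_dist.1 this
  refine ⟨min δ₁ δ₂, lt_min h₁ h₂, fun t x hx => ⟨h₁' ?_, ?_⟩⟩
  · exact Metric.mem_thickening_iff.2 ⟨γ t, ⟨t, rfl⟩, hx.trans_le (min_le_left _ _)⟩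
  · have := h₂' (a := γ t) (b := x) (by rw [dist_comm]; exact hx.trans_le (min_le_right _ _))
    rw [dist_comm]
    exact this ⟨t, rfl⟩

theorem continuousAt_superposition {f : E → F} {U : Set E} (hU : IsOpen U)
    (hf : ContinuousOn f U) {γ : C(K, E)} (hγ : ∀ t, γ t ∈ U) :
    ContinuousAt (superposition f) γ := by
  rw [Metric.continuousAt_iff']
  intro c hc
  obtain ⟨δ, hδ, h⟩ := exists_uniform_nhds hU hf hγ hc
  filter_upwards [Metric.ball_mem_nhds γ hδ] with η hη
  rw [Metric.mem_ball] at hη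
  have hmem : ∀ t, dist (η t) (γ t) < δ := fun t =>
    (ContinuousMap.dist_apply_le_dist t).trans_lt hη
  rw [ContinuousMap.dist_lt_iff hc]
  intro t
  rw [superposition_apply hf (fun t => (h t _ (hmem t)).1), superposition_apply hf hγ]
  exact (h t _ (hmem t)).2

variable [NormedSpace ℝ E] [NormedSpace ℝ F]

/-- Pointwise application of a continuous family of operators to a continuous function. -/
noncomputable def pointwiseApply : C(K, E →L[ℝ] F) →L[ℝ] C(K, E) →L[ℝ] C(K, F) :=
  LinearMap.mkContinuous₂
    (LinearMap.mk₂ ℝ (fun (A : C(K, E →L[ℝ] F)) (η : C(K, E)) =>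
        (⟨fun t => A t (η t), A.continuous.clm_apply η.continuous⟩ : C(K, F)))
      (fun _ _ _ => by ext; simp) (fun _ _ _ => by ext; simp)
      (fun _ _ _ => by ext; simp) (fun _ _ _ => by ext; simp)) 1 (fun A η => by
      rw [one_mul, ContinuousMap.norm_le _ (by positivity)]
      intro t
      refine ((A t).le_opNorm _).trans ?_
      gcongr
      · exact A.norm_coe_le_norm t
      · exact η.norm_coe_le_norm t)

theorem pointwiseApply_apply (A : C(K, E →L[ℝ] F)) (η : C(K, E)) (t : K) :
    pointwiseApply A η t = A t (η t) := rfl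

/-- The mean value inequality is applied on the ball around each `γ t`; the oscillation of `fderiv ℝ
f` there is at most `c` with a radius independent of `t`, so the pointwise remainders give a
remainder in the supremum norm. -/
theorem hasFDerivAt_superposition {f : E → F} {U : Set E} (hU : IsOpen U)
    (hf : ContDiffOn ℝ 1 f U) {γ : C(K, E)} (hγ : ∀ t, γ t ∈ U) :
    HasFDerivAt (superposition f) (pointwiseApply (superposition (fderiv ℝ f) γ)) γ := by
  have hf' : ContinuousOn (fderiv ℝ f) U := hf.continuousOn_fderiv_of_isOpen hU le_rfl
  rw [hasFDerivAt_iff_isLittleO_nhds_zero, Asymptotics.isLittleO_iff]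
  intro c hc
  obtain ⟨δ, hδ, h⟩ := exists_uniform_nhds hU hf' hγ hc
  filter_upwards [Metric.ball_mem_nhds (0 : C(K, E)) hδ] with η hη
  rw [mem_ball_zero_iff] at hη
  rw [ContinuousMap.norm_le _ (by positivity)]
  intro t
  have hmem : ∀ t, dist ((γ + η) t) (γ t) < δ := fun t => by
    simpa [dist_eq_norm] using (η.norm_coe_le_norm t).trans_lt hη
  have key := (convex_ball (γ t) δ).norm_image_sub_le_of_norm_hasFDerivWithin_le' (f := f)
    (f' := fderiv ℝ f) (φ := fderiv ℝ f (γ t)) (C := c) (𝕜 := ℝ)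
    (fun x hx => ((hf.differentiableOn one_ne_zero).differentiableAt
      (hU.mem_nhds (h t x hx).1)).hasFDerivAt.hasFDerivWithinAt)
    (fun x hx => by rw [← dist_eq_norm]; exact (h t x hx).2.le)
    (Metric.mem_ball_self hδ) (hmem t)
  have e1 := superposition_apply hf.continuousOn (fun t => (h t _ (hmem t)).1) t
  have e2 := superposition_apply hf.continuousOn hγ t
  have e3 := superposition_apply hf' hγ t
  simp only [ContinuousMap.sub_apply, pointwiseApply_apply, e1, e2, e3]
  simp only [ContinuousMap.add_apply, add_sub_cancel_left] at key ⊢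
  exact key.trans (by gcongr; exact η.norm_coe_le_norm t)

theorem contDiffAt_superposition {f : E → F} {U : Set E} (hU : IsOpen U)
    (hf : ContDiffOn ℝ 1 f U) {γ : C(K, E)} (hγ : ∀ t, γ t ∈ U) :
    ContDiffAt ℝ 1 (superposition f) γ := by
  rw [contDiffAt_one_iff]
  have hf' : ContinuousOn (fderiv ℝ f) U := hf.continuousOn_fderiv_of_isOpen hU le_rfl
  refine ⟨fun η => pointwiseApply (superposition (fderiv ℝ f) η), {η | ∀ t, η t ∈ U},
    eventually_forall_apply_mem hU hγ, fun η hη => ?_,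
    fun η hη => hasFDerivAt_superposition hU hf hη⟩
  exact (pointwiseApply.continuous.continuousAt.comp
    (continuousAt_superposition hU hf' hη)).continuousWithinAt

end Superposition

/-! ### The Volterra operator and integrals along segments. -/

section Volterra

variable {E F : Type*} [NormedAddCommGroup E] [NormedSpace ℝ E]
  [NormedAddCommGroup F] [NormedSpace ℝ F]

/-- Integration from `0`, as an operator on continuous functions on the unit interval. -/
noncomputable def volterra : C(unitInterval, E) →L[ℝ] C(unitInterval, E) :=
  LinearMap.mkContinuous
    { toFun := fun η => ⟨fun t => ∫ s in (0 : ℝ)..t, IccExtend zero_le_one η s,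
        (intervalIntegral.continuous_primitive
          (fun a b => (η.continuous.Icc_extend' (h := zero_le_one)).intervalIntegrable a b) 0).comp
          continuous_subtype_val⟩
      map_add' := fun η θ => by
        ext t
        simp only [ContinuousMap.coe_mk, ContinuousMap.add_apply]
        rw [← intervalIntegral.integral_add
          ((η.continuous.Icc_extend' (h := zero_le_one)).intervalIntegrable _ _)
          ((θ.continuous.Icc_extend' (h := zero_le_one)).intervalIntegrable _ _)]
        rfl
      map_smul' := fun c η => by
        ext t
        simp only [ContinuousMap.coe_mk, ContinuousMap.smul_apply, RingHom.id_apply]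
        rw [← intervalIntegral.integral_smul]
        rfl } 1 (fun η => by
      rw [one_mul, ContinuousMap.norm_le _ (norm_nonneg _)]
      intro t
      have := intervalIntegral.norm_integral_le_of_norm_le_const (a := 0) (b := (t : ℝ))
        (f := IccExtend zero_le_one η) (C := ‖η‖) (fun s _ => η.norm_coe_le_norm _)
      refine this.trans ?_
      rw [sub_zero, abs_of_nonneg t.2.1]
      exact mul_le_of_le_one_right (norm_nonneg _) t.2.2)

theorem volterra_apply (η : C(unitInterval, E)) (t : unitInterval) :
    volterra η t = ∫ s in (0 : ℝ)..t, IccExtend zero_le_one η s := rfl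

/-- Each further application integrates the previous bound from `0` to `t`, which creates the
factorial. Some power is thus a contraction however large `‖A‖` is. -/
theorem norm_pow_volterra_comp_le (A : C(unitInterval, E →L[ℝ] E)) (n : ℕ)
    (η : C(unitInterval, E)) (t : unitInterval) :
    ‖((volterra ∘L pointwiseApply A) ^ n) η t‖ ≤ (‖A‖ * t) ^ n / n.factorial * ‖η‖ := by
  induction n generalizing t with
  | zero => simpa using η.norm_coe_le_norm t
  | succ n ih =>
    rw [pow_succ', mul_apply_eq_comp, ContinuousLinearMap.comp_apply, volterra_apply]
    set θ := ((volterra ∘L pointwiseApply A) ^ n) η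
    have hint : ∫ s in (0 : ℝ)..t, ‖A‖ * ((‖A‖ * s) ^ n / n.factorial * ‖η‖) =
        (‖A‖ * t) ^ (n + 1) / (n + 1).factorial * ‖η‖ := by
      have : ∀ s : ℝ, ‖A‖ * ((‖A‖ * s) ^ n / n.factorial * ‖η‖) =
          (‖A‖ ^ (n + 1) / n.factorial * ‖η‖) * s ^ n := fun s => by
        rw [mul_pow, pow_succ]; ring
      simp_rw [this]
      rw [intervalIntegral.integral_const_mul, integral_pow, Nat.factorial_succ]
      push_cast
      have := Nat.factorial_ne_zero n
      field_simp
      ring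
    rw [← hint]
    refine intervalIntegral.norm_integral_le_of_norm_le t.2.1 ?_
      (Continuous.intervalIntegrable (by fun_prop) _ _)
    refine Eventually.of_forall fun s hs => ?_
    have hs' : s ∈ Icc (0 : ℝ) 1 := ⟨hs.1.le, hs.2.trans t.2.2⟩
    rw [IccExtend_of_mem _ _ hs', pointwiseApply_apply]
    refine ((A _).le_opNorm _).trans ?_
    gcongr
    · exact A.norm_coe_le_norm _
    · exact ih ⟨s, hs'⟩

/-- For large `n` the Neumann series inverts `1 - k ^ n`, which is the product of `1 - k` and the
geometric sum; these commute, so both are units. This is why the implicit function theorem works on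
the whole unit interval without a smallness condition. -/
theorem isUnit_one_sub_volterra_comp [CompleteSpace E] (A : C(unitInterval, E →L[ℝ] E)) :
    IsUnit (1 - volterra ∘L pointwiseApply A : C(unitInterval, E) →L[ℝ] C(unitInterval, E)) := by
  set k : C(unitInterval, E) →L[ℝ] C(unitInterval, E) := volterra ∘L pointwiseApply A with hk
  obtain ⟨n, hn⟩ := ((FloorSemiring.tendsto_pow_div_factorial_atTop ‖A‖).eventually
    (gt_mem_nhds one_half_pos)).exists
  have hkn : ‖k ^ n‖ < 1 := by
    refine (ContinuousLinearMap.opNorm_le_bound _ (by positivity) fun η => ?_).trans_lt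
      (hn.trans one_half_lt_one)
    rw [ContinuousMap.norm_le _ (by positivity)]
    intro t
    refine (norm_pow_volterra_comp_le A n η t).trans ?_
    gcongr
    · exact mul_nonneg (norm_nonneg A) t.2.1
    · exact mul_le_of_le_one_right (norm_nonneg A) t.2.2
  have h1 : IsUnit (1 - k ^ n) :=
    isUnit_one_sub_of_norm_lt_one (R := C(unitInterval, E) →L[ℝ] C(unitInterval, E)) hkn
  rw [← mul_neg_geom_sum k n] at h1
  refine ((Commute.isUnit_mul_iff ?_).1 h1).1
  rw [commute_iff_eq, mul_neg_geom_sum, geom_sum_mul_neg]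

/-- The affine path `r ↦ a + r b`. -/
noncomputable def affinePath : E × E →L[ℝ] C(unitInterval, E) :=
  LinearMap.mkContinuous
    { toFun := fun p => ⟨fun r => p.1 + (r : ℝ) • p.2, by fun_prop⟩
      map_add' := fun p q => by ext r; simp; abel
      map_smul' := fun c p => by ext r; simp [smul_comm c (r : ℝ) p.2] } 2 (fun p => by
      rw [ContinuousMap.norm_le _ (by positivity)]
      intro r
      refine (norm_add_le _ _).trans ?_
      rw [norm_smul, Real.norm_of_nonneg r.2.1]
      have h1 := norm_fst_le p
      have h2 := norm_snd_le p
      have := mul_le_mul r.2.2 h2 (norm_nonneg _) zero_le_one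
      linarith)

theorem affinePath_apply (p : E × E) (r : unitInterval) :
    affinePath p r = p.1 + (r : ℝ) • p.2 := rfl

/-- The integral of `f` along the segment from `a` to `a + b`. -/
noncomputable def segmentIntegral (f : E → F) (p : E × E) : F :=
  ∫ r in (0 : ℝ)..1, f (p.1 + r • p.2)

/-- Differentiation under the integral sign becomes a composition: the path depends linearly on `p`,
superposition with `f` is C¹, and integration over the unit interval is a continuous linear map. -/
theorem contDiffAt_segmentIntegral {f : E → F} {U : Set E} (hU : IsOpen U)
    (hf : ContDiffOn ℝ 1 f U) {p : E × E} (hp : ∀ r ∈ Icc (0 : ℝ) 1, p.1 + r • p.2 ∈ U) :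
    ContDiffAt ℝ 1 (segmentIntegral f) p := by
  have hp' : ∀ t, affinePath p t ∈ U := fun t => hp t t.2
  let L : C(unitInterval, F) →L[ℝ] F :=
    (ContinuousMap.evalCLM ℝ (1 : unitInterval)).comp (volterra (E := F))
  have h1 : ContDiffAt ℝ 1 (fun q => L (superposition f (affinePath q))) p :=
    L.contDiff.contDiffAt.comp p
      ((contDiffAt_superposition hU hf hp').comp p (affinePath (E := E)).contDiff.contDiffAt)
  refine h1.congr_of_eventuallyEq ?_
  filter_upwards [affinePath.continuous.continuousAt.eventually
    (eventually_forall_apply_mem hU hp')] with q hq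
  change _ = volterra (superposition f (affinePath q)) 1
  rw [volterra_apply]
  refine intervalIntegral.integral_congr fun r hr => ?_
  simp only [uIcc_of_le (zero_le_one (α := ℝ))] at hr
  rw [IccExtend_of_mem _ _ hr, superposition_apply hf.continuousOn hq, affinePath_apply]

theorem segmentIntegral_zero_right [CompleteSpace F] (f : E → F) (a : E) :
    segmentIntegral f (a, 0) = f a := by
  simp [segmentIntegral]

end Volterra

/-! ### Integral curves: uniqueness and dependence on the initial point. -/

section IntegralCurves

variable {E : Type*} [NormedAddCommGroup E] [NormedSpace ℝ E]

theorem ContDiffOn.locallyLipschitzOn_of_isOpen {X : E → E} {U : Set E} (hU : IsOpen U)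
    (hX : ContDiffOn ℝ 1 X U) : LocallyLipschitzOn U X := by
  intro x hx
  obtain ⟨K, t, ht, h⟩ := (hX.contDiffAt (hU.mem_nhds hx)).exists_lipschitzOnWith
  exact ⟨K, t, mem_nhdsWithin_of_mem_nhds ht, h⟩

/-- A C¹ field is Lipschitz on the compact union of the two trajectories, so Grönwall's inequality
applies on both sides of `c`. The point `c` is arbitrary because flows are followed forwards and
backwards. -/
theorem IsIntegralCurveOn.eqOn_Icc {X : E → E} {U : Set E} (hU : IsOpen U)
    (hX : ContDiffOn ℝ 1 X U) {γ η : ℝ → E} {a b c : ℝ}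
    (hγ : IsIntegralCurveOn γ (fun _ => X) (Icc a b)) (hγU : ∀ t ∈ Icc a b, γ t ∈ U)
    (hη : IsIntegralCurveOn η (fun _ => X) (Icc a b)) (hηU : ∀ t ∈ Icc a b, η t ∈ U)
    (hc : c ∈ Icc a b) (h : γ c = η c) : EqOn γ η (Icc a b) := by
  have hcγ : ContinuousOn γ (Icc a b) := hγ.continuousOn
  have hcη : ContinuousOn η (Icc a b) := hη.continuousOn
  have hK : IsCompact (γ '' Icc a b ∪ η '' Icc a b) :=
    (isCompact_Icc.image_of_continuousOn hcγ).union (isCompact_Icc.image_of_continuousOn hcη)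
  have hsub : γ '' Icc a b ∪ η '' Icc a b ⊆ U := by
    rintro _ (⟨t, ht, rfl⟩ | ⟨t, ht, rfl⟩)
    exacts [hγU t ht, hηU t ht]
  obtain ⟨L, hL⟩ := ((hX.locallyLipschitzOn_of_isOpen hU).mono
    hsub).exists_lipschitzOnWith_of_compact hK
  have mγ : ∀ t ∈ Icc a b, γ t ∈ γ '' Icc a b ∪ η '' Icc a b := fun t ht => Or.inl ⟨t, ht, rfl⟩
  have mη : ∀ t ∈ Icc a b, η t ∈ γ '' Icc a b ∪ η '' Icc a b := fun t ht => Or.inr ⟨t, ht, rfl⟩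
  have hr : ∀ {ζ : ℝ → E}, IsIntegralCurveOn ζ (fun _ => X) (Icc a b) → ∀ t ∈ Ico a b,
      HasDerivWithinAt ζ (X (ζ t)) (Ici t) t := fun hζ t ht =>
    (hζ t ⟨ht.1, ht.2.le⟩).mono_of_mem_nhdsWithin (Icc_mem_nhdsGE_of_mem ht)
  have hl : ∀ {ζ : ℝ → E}, IsIntegralCurveOn ζ (fun _ => X) (Icc a b) → ∀ t ∈ Ioc a b,
      HasDerivWithinAt ζ (X (ζ t)) (Iic t) t := fun hζ t ht =>
    (hζ t ⟨ht.1.le, ht.2⟩).mono_of_mem_nhdsWithin (Icc_mem_nhdsLE_of_mem ht)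
  have s1 : Icc a c ⊆ Icc a b := Icc_subset_Icc_right hc.2
  have s2 : Icc c b ⊆ Icc a b := Icc_subset_Icc_left hc.1
  rw [← Icc_union_Icc_eq_Icc hc.1 hc.2]
  refine EqOn.union ?_ ?_
  · exact ODE_solution_unique_of_mem_Icc_left (v := fun _ => X)
      (s := fun _ => γ '' Icc a b ∪ η '' Icc a b)
      (fun _ _ => hL) (hcγ.mono s1) (fun t ht => hl hγ t ⟨ht.1, ht.2.trans hc.2⟩)
      (fun t ht => mγ t (s1 (Ioc_subset_Icc_self ht))) (hcη.mono s1)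
      (fun t ht => hl hη t ⟨ht.1, ht.2.trans hc.2⟩)
      (fun t ht => mη t (s1 (Ioc_subset_Icc_self ht))) h
  · exact ODE_solution_unique_of_mem_Icc_right (v := fun _ => X)
      (s := fun _ => γ '' Icc a b ∪ η '' Icc a b)
      (fun _ _ => hL) (hcγ.mono s2) (fun t ht => hr hγ t ⟨hc.1.trans ht.1, ht.2⟩)
      (fun t ht => mγ t (s2 (Ico_subset_Icc_self ht))) (hcη.mono s2)
      (fun t ht => hr hη t ⟨hc.1.trans ht.1, ht.2⟩)
      (fun t ht => mη t (s2 (Ico_subset_Icc_self ht))) h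

theorem ContinuousLinearMap.isInvertible_of_isUnit {A : E →L[ℝ] E} (hA : IsUnit A) :
    A.IsInvertible := by
  obtain ⟨u, rfl⟩ := hA
  exact ⟨ContinuousLinearEquiv.unitsEquiv ℝ E u, rfl⟩

/-- With its converse below, this turns the differential equation into the zero set of a C¹ map on a
Banach space of paths. -/
theorem eq_const_add_volterra_of_isIntegralCurveOn [CompleteSpace E] {X : E → E} {U : Set E}
    (hX : ContinuousOn X U) {γ : ℝ → E}
    (hγ : IsIntegralCurveOn γ (fun _ => X) (Icc 0 1)) (hγU : ∀ t ∈ Icc (0 : ℝ) 1, γ t ∈ U)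
    (η : C(unitInterval, E)) (hη : ∀ t : unitInterval, η t = γ t) :
    η = affinePath (γ 0, 0) + volterra (superposition X η) := by
  ext t
  have hηU : ∀ t, η t ∈ U := fun t => hη t ▸ hγU t t.2
  have hcont : Continuous (IccExtend zero_le_one (superposition X η)) :=
    (superposition X η).continuous.Icc_extend' (h := zero_le_one)
  have key := intervalIntegral.integral_eq_sub_of_hasDerivAt_of_le (f := γ)
    (f' := IccExtend zero_le_one (superposition X η)) t.2.1
    (hγ.continuousOn.mono (Icc_subset_Icc_right t.2.2))
    (fun s hs => by
      have hs' : s ∈ Ioo (0 : ℝ) 1 := ⟨hs.1, hs.2.trans_le t.2.2⟩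
      rw [IccExtend_of_mem _ _ (Ioo_subset_Icc_self hs'), superposition_apply hX hηU, hη]
      exact (hγ s (Ioo_subset_Icc_self hs')).hasDerivAt (Icc_mem_nhds hs'.1 hs'.2))
    (hcont.intervalIntegrable _ _)
  rw [ContinuousMap.add_apply, volterra_apply, key, affinePath_apply, hη]
  simp

theorem isIntegralCurveOn_of_eq_const_add_volterra [CompleteSpace E] {X : E → E} {U : Set E}
    (hX : ContinuousOn X U) {p : E} {η : C(unitInterval, E)} (hηU : ∀ t, η t ∈ U)
    (hη : η = affinePath (p, 0) + volterra (superposition X η)) :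
    η 0 = p ∧ IsIntegralCurveOn (IccExtend zero_le_one η) (fun _ => X) (Icc 0 1) := by
  have hcont : Continuous (IccExtend zero_le_one (superposition X η)) :=
    (superposition X η).continuous.Icc_extend' (h := zero_le_one)
  have hηt : ∀ t : unitInterval,
      η t = p + ∫ s in (0 : ℝ)..t, IccExtend zero_le_one (superposition X η) s := fun t => by
    conv_lhs => rw [hη]
    simp [volterra_apply, affinePath_apply]
  refine ⟨by simpa using hηt 0, fun t ht => ?_⟩
  have h1 : HasDerivAt
      (fun t => p + ∫ s in (0 : ℝ)..t, IccExtend zero_le_one (superposition X η) s)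
      (IccExtend zero_le_one (superposition X η) t) t :=
    (hcont.integral_hasStrictDerivAt 0 t).hasDerivAt.const_add p
  have h2 : IccExtend zero_le_one (superposition X η) t = X (IccExtend zero_le_one η t) := by
    rw [IccExtend_of_mem _ _ ht, IccExtend_of_mem _ _ ht, superposition_apply hX hηU]
  change HasDerivWithinAt _ (X (IccExtend zero_le_one η t)) _ t
  rw [← h2]
  refine h1.hasDerivWithinAt.congr (fun s hs => ?_) ?_
  · rw [IccExtend_of_mem _ _ hs, hηt]
  · rw [IccExtend_of_mem _ _ ht, hηt]

/-- Solutions on the unit interval depend continuously differentiably on the initial point, and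
the derivative satisfies the variational equation in integrated form. -/
theorem exists_contDiffAt_solution [CompleteSpace E] {X : E → E} {U : Set E} (hU : IsOpen U)
    (hX : ContDiffOn ℝ 1 X U) {γ : ℝ → E}
    (hγ : IsIntegralCurveOn γ (fun _ => X) (Icc 0 1)) (hγU : ∀ t ∈ Icc (0 : ℝ) 1, γ t ∈ U) :
    ∃ Γ : E → C(unitInterval, E), ContDiffAt ℝ 1 Γ (γ 0) ∧
      (∀ t : unitInterval, Γ (γ 0) t = γ t) ∧
      (∀ᶠ p in 𝓝 (γ 0), (∀ t, Γ p t ∈ U) ∧ Γ p 0 = p ∧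
        IsIntegralCurveOn (IccExtend zero_le_one (Γ p)) (fun _ => X) (Icc 0 1)) ∧
      ∀ (h : E) (t : unitInterval), fderiv ℝ Γ (γ 0) h t =
        h + ∫ s in (0 : ℝ)..t, fderiv ℝ X (γ s)
          (IccExtend zero_le_one (fderiv ℝ Γ (γ 0) h) s) := by
  let η₀ : C(unitInterval, E) :=
    ⟨fun t => γ t, hγ.continuousOn.comp_continuous continuous_subtype_val fun t => t.2⟩
  have hη₀ : ∀ t : unitInterval, η₀ t = γ t := fun t => rfl
  have hη₀U : ∀ t, η₀ t ∈ U := fun t => hγU t t.2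
  have hX' : ContinuousOn (fderiv ℝ X) U := hX.continuousOn_fderiv_of_isOpen hU le_rfl
  set A := superposition (fderiv ℝ X) η₀ with hA
  let c : E →L[ℝ] C(unitInterval, E) := affinePath ∘L ContinuousLinearMap.inl ℝ E E
  -- The zeros of `F` are the pairs of an initial point and its solution. Its partial derivative in
  -- the path is `1 - volterra ∘L pointwiseApply A`, which is invertible.
  let F : E × C(unitInterval, E) → C(unitInterval, E) := fun z =>
    z.2 - c z.1 - volterra (superposition X z.2)
  have hF : ContDiffAt ℝ 1 F (γ 0, η₀) := by
    refine ((contDiffAt_snd).sub (c.contDiff.contDiffAt.comp _ contDiffAt_fst)).sub ?_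
    exact (volterra (E := E)).contDiff.contDiffAt.comp _
      ((contDiffAt_superposition (γ := ((γ 0, η₀) : E × C(unitInterval, E)).2) hU hX hη₀U).comp
        (γ 0, η₀) contDiffAt_snd)
  have hF' : fderiv ℝ F (γ 0, η₀) =
      (ContinuousLinearMap.snd ℝ E C(unitInterval, E) - c ∘L ContinuousLinearMap.fst ℝ E _) -
        (volterra ∘L pointwiseApply A) ∘L ContinuousLinearMap.snd ℝ E _ := by
    refine HasFDerivAt.fderiv ?_
    refine (hasFDerivAt_snd.sub (c.hasFDerivAt.comp _ hasFDerivAt_fst)).sub ?_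
    exact HasFDerivAt.comp (f := Prod.snd) (g := fun η => volterra (superposition X η)) (γ 0, η₀)
      ((volterra (E := E)).hasFDerivAt.comp η₀ (hasFDerivAt_superposition hU hX hη₀U))
      hasFDerivAt_snd
  have hinr : fderiv ℝ F (γ 0, η₀) ∘L .inr ℝ E C(unitInterval, E) =
      1 - volterra ∘L pointwiseApply A := by
    rw [hF']
    ext η t
    simp
  have hinl : fderiv ℝ F (γ 0, η₀) ∘L .inl ℝ E C(unitInterval, E) = - c := by
    rw [hF']
    ext h t
    simp
  have hinv : (fderiv ℝ F (γ 0, η₀) ∘L .inr ℝ E C(unitInterval, E)).IsInvertible := by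
    rw [hinr]
    exact ContinuousLinearMap.isInvertible_of_isUnit (isUnit_one_sub_volterra_comp A)
  have hzero : F (γ 0, η₀) = 0 := by
    have := eq_const_add_volterra_of_isIntegralCurveOn hX.continuousOn hγ hγU η₀ hη₀
    change η₀ - affinePath (γ 0, 0) - volterra (superposition X η₀) = 0
    rw [sub_sub, ← this, sub_self]
  set Γ := hF.implicitFunction one_ne_zero hinv with hΓ
  have hΓ₀ : Γ (γ 0) = η₀ := hF.implicitFunction_apply_self one_ne_zero hinv
  have hΓd : ContDiffAt ℝ 1 Γ (γ 0) := hF.contDiffAt_implicitFunction one_ne_zero hinv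
  have hΓs := hF.hasStrictFDerivAt_implicitFunction one_ne_zero hinv
  refine ⟨Γ, hΓd, fun t => by rw [hΓ₀, hη₀], ?_, ?_⟩
  · have h1 := hF.eventually_apply_implicitFunction one_ne_zero hinv
    have h2 := hΓd.continuousAt.eventually
      (eventually_forall_apply_mem (γ := Γ (γ 0)) hU (by rw [hΓ₀]; exact hη₀U))
    filter_upwards [h1, h2] with p hp hpU
    refine ⟨hpU, ?_⟩
    refine isIntegralCurveOn_of_eq_const_add_volterra hX.continuousOn hpU ?_
    rw [hzero] at hp
    have hp' : Γ p - affinePath (p, 0) - volterra (superposition X (Γ p)) = 0 := hp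
    rw [sub_sub, sub_eq_zero] at hp'
    exact hp'
  · intro h t
    set D := fderiv ℝ Γ (γ 0) with hD
    have hDeq : D = -(fderiv ℝ F (γ 0, η₀) ∘L .inr ℝ E C(unitInterval, E)).inverse ∘L
        (fderiv ℝ F (γ 0, η₀) ∘L .inl ℝ E C(unitInterval, E)) := hΓs.hasFDerivAt.fderiv
    -- This is the identity `F(p, Γ p) = 0` differentiated in `p`: the variational equation in
    -- integrated form.
    have h1 : (fderiv ℝ F (γ 0, η₀) ∘L .inr ℝ E C(unitInterval, E)) (D h) = c h := by
      rw [hDeq, hinl]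
      simp only [ContinuousLinearMap.comp_neg, neg_neg]
      rw [ContinuousLinearMap.comp_apply (g := ContinuousLinearMap.inverse _)]
      exact hinv.self_apply_inverse _
    rw [hinr] at h1
    have h2 : D h t - volterra (pointwiseApply A (D h)) t = h := by
      have := congrArg (fun η : C(unitInterval, E) => η t) h1
      simpa [c, affinePath_apply] using this
    rw [sub_eq_iff_eq_add] at h2
    rw [h2, volterra_apply]
    congr 1
    refine intervalIntegral.integral_congr fun s hs => ?_
    rw [uIcc_of_le t.2.1] at hs
    have hs' : s ∈ Icc (0 : ℝ) 1 := ⟨hs.1, hs.2.trans t.2.2⟩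
    simp only [IccExtend_of_mem _ _ hs', pointwiseApply_apply]
    rw [hA, superposition_apply hX' hη₀U, hη₀]

end IntegralCurves

/-! ### The local flow and the variational equation. -/

section LocalFlow

variable {E : Type*} [NormedAddCommGroup E] [NormedSpace ℝ E]

/-- The solution of `ṗ = X(p)` in `U` starting at `p` reaches time `t`. -/
def HasSolutionTo (X : E → E) (U : Set E) (t : ℝ) (p : E) : Prop :=
  ∃ γ : ℝ → E, γ 0 = p ∧ IsIntegralCurveOn γ (fun _ => X) (uIcc 0 t) ∧ ∀ s ∈ uIcc 0 t, γ s ∈ U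

open Classical in
/-- The local flow of `X` in `U`. -/
noncomputable def localFlow (X : E → E) (U : Set E) (t : ℝ) (p : E) : E :=
  if H : HasSolutionTo X U t p then H.choose t else p

/-- The domain of the local flow, a set of pairs (time, initial point). -/
def flowDomain (X : E → E) (U : Set E) : Set (ℝ × E) := {z | HasSolutionTo X U z.1 z.2}

variable {X : E → E} {U : Set E} {s t : ℝ} {p : E}

theorem HasSolutionTo.mono (h : HasSolutionTo X U t p) (hs : s ∈ uIcc 0 t) :
    HasSolutionTo X U s p := by
  obtain ⟨γ, h0, h1, h2⟩ := h
  have hsub : uIcc 0 s ⊆ uIcc 0 t := uIcc_subset_uIcc_left hs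
  exact ⟨γ, h0, h1.mono hsub, fun r hr => h2 r (hsub hr)⟩

theorem hasSolutionTo_zero (hp : p ∈ U) : HasSolutionTo X U 0 p := by
  refine ⟨fun _ => p, rfl, fun s hs => ?_, fun _ _ => hp⟩
  rw [uIcc_self, mem_singleton_iff] at hs
  subst hs
  rw [uIcc_self]
  exact HasFDerivWithinAt.of_subsingleton subsingleton_singleton

theorem HasSolutionTo.mem (h : HasSolutionTo X U t p) : p ∈ U := by
  obtain ⟨γ, h0, -, h2⟩ := h
  exact h0 ▸ h2 0 left_mem_uIcc

theorem localFlow_eq (hU : IsOpen U) (hX : ContDiffOn ℝ 1 X U) {γ : ℝ → E} (h0 : γ 0 = p)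
    (hγ : IsIntegralCurveOn γ (fun _ => X) (uIcc 0 t)) (hγU : ∀ s ∈ uIcc 0 t, γ s ∈ U)
    (hs : s ∈ uIcc 0 t) : localFlow X U s p = γ s := by
  have H : HasSolutionTo X U s p := HasSolutionTo.mono ⟨γ, h0, hγ, hγU⟩ hs
  have hsub : uIcc 0 s ⊆ uIcc 0 t := uIcc_subset_uIcc_left hs
  rw [localFlow, dif_pos H]
  obtain ⟨g0, g1, g2⟩ := H.choose_spec
  exact IsIntegralCurveOn.eqOn_Icc hU hX g1 g2 (hγ.mono hsub) (fun r hr => hγU r (hsub hr))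
    (left_mem_uIcc : (0 : ℝ) ∈ uIcc 0 s) (g0.trans h0.symm) (right_mem_uIcc : s ∈ uIcc 0 s)

theorem localFlow_zero (p : E) : localFlow X U 0 p = p := by
  rw [localFlow]
  split_ifs with H
  · exact H.choose_spec.1
  · rfl

theorem HasSolutionTo.isIntegralCurveOn (hU : IsOpen U) (hX : ContDiffOn ℝ 1 X U)
    (h : HasSolutionTo X U t p) :
    IsIntegralCurveOn (fun s => localFlow X U s p) (fun _ => X) (uIcc 0 t) ∧
      ∀ s ∈ uIcc 0 t, localFlow X U s p ∈ U := by
  obtain ⟨γ, h0, h1, h2⟩ := h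
  have h3 : ∀ s ∈ uIcc 0 t, localFlow X U s p = γ s := fun s hs => localFlow_eq hU hX h0 h1 h2 hs
  refine ⟨fun s hs => ?_, fun s hs => h3 s hs ▸ h2 s hs⟩
  have := (h1 s hs).congr h3 (h3 s hs)
  simpa only [h3 s hs] using this

theorem HasSolutionTo.localFlow_mem (hU : IsOpen U) (hX : ContDiffOn ℝ 1 X U)
    (h : HasSolutionTo X U t p) : localFlow X U t p ∈ U :=
  (h.isIntegralCurveOn hU hX).2 t right_mem_uIcc

theorem eqOn_const_of_hasDerivWithinAt_zero {f : ℝ → E} {a b : ℝ}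
    (hf : ∀ s ∈ Icc a b, HasDerivWithinAt f 0 (Icc a b) s) : ∀ s ∈ Icc a b, f s = f a :=
  constant_of_has_deriv_right_zero (HasDerivWithinAt.continuousOn hf) fun s hs =>
    (hf s (Ico_subset_Icc_self hs)).mono_of_mem_nhdsWithin (Icc_mem_nhdsGE_of_mem hs)

theorem div_mem_Icc_of_mem_uIcc {r : ℝ} (hr : r ∈ uIcc 0 t) (ht : t ≠ 0) :
    r / t ∈ Icc (0 : ℝ) 1 := by
  rcases lt_or_gt_of_ne ht with h | h
  · rw [uIcc_of_ge h.le] at hr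
    exact ⟨div_nonneg_of_nonpos hr.2 h.le, (div_le_one_of_neg h).2 hr.1⟩
  · rw [uIcc_of_le h.le] at hr
    exact ⟨div_nonneg hr.1 h.le, (div_le_one h).2 hr.2⟩

theorem mul_mem_uIcc (hs : s ∈ Icc (0 : ℝ) 1) : s * t ∈ uIcc 0 t := by
  rcases le_total t 0 with h | h
  · rw [uIcc_of_ge h]
    exact ⟨by nlinarith [hs.1, hs.2], by nlinarith [hs.1, hs.2]⟩
  · rw [uIcc_of_le h]
    exact ⟨by nlinarith [hs.1, hs.2], by nlinarith [hs.1, hs.2]⟩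

/-- Rescaling time puts every solution on the unit interval and makes the final time `t`, of either
sign, a parameter of the field. For `t = 0` the scaled solution is constant. -/
theorem localFlow_eq_of_scaled (hU : IsOpen U) (hX : ContDiffOn ℝ 1 X U) {η : ℝ → E}
    (h0 : η 0 = p) (hη : IsIntegralCurveOn η (fun _ q => t • X q) (Icc 0 1))
    (hηU : ∀ s ∈ Icc (0 : ℝ) 1, η s ∈ U) :
    HasSolutionTo X U t p ∧ ∀ s ∈ Icc (0 : ℝ) 1, localFlow X U (s * t) p = η s := by
  rcases eq_or_ne t 0 with rfl | ht
  · have hc := eqOn_const_of_hasDerivWithinAt_zero (f := η) (fun s hs => by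
      simpa using hη s hs)
    refine ⟨hasSolutionTo_zero (h0 ▸ hηU 0 (by simp)), fun s hs => ?_⟩
    rw [mul_zero, localFlow_zero, hc s hs, h0]
  · let β : ℝ → E := fun r => η (r / t)
    have hβ0 : β 0 = p := by simp [β, h0]
    have hβ : IsIntegralCurveOn β (fun _ => X) (uIcc 0 t) := fun r hr => by
      have h1 := hη (r / t) (div_mem_Icc_of_mem_uIcc hr ht)
      have h2 := HasDerivWithinAt.scomp (s := uIcc 0 t) r h1
        ((hasDerivAt_id r).div_const t).hasDerivWithinAt
        (fun r' hr' => div_mem_Icc_of_mem_uIcc hr' ht)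
      refine h2.congr_deriv ?_
      simp [β, smul_smul, ht]
    have hβU : ∀ r ∈ uIcc 0 t, β r ∈ U := fun r hr => hηU _ (div_mem_Icc_of_mem_uIcc hr ht)
    refine ⟨⟨β, hβ0, hβ, hβU⟩, fun s hs => ?_⟩
    rw [localFlow_eq hU hX hβ0 hβ hβU (mul_mem_uIcc hs)]
    simp [β, ht]

theorem HasSolutionTo.isIntegralCurveOn_scaled (hU : IsOpen U) (hX : ContDiffOn ℝ 1 X U)
    (h : HasSolutionTo X U t p) :
    IsIntegralCurveOn (fun s => localFlow X U (s * t) p) (fun _ q => t • X q) (Icc 0 1) :=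
  fun s hs => HasDerivWithinAt.scomp (g₁ := fun r => localFlow X U r p) (h := (· * t)) s
    ((h.isIntegralCurveOn hU hX).1 (s * t) (mul_mem_uIcc hs))
    (hasDerivAt_mul_const t).hasDerivWithinAt fun _ hr => mul_mem_uIcc hr

theorem HasSolutionTo.exists_contDiffAt [CompleteSpace E] (hU : IsOpen U)
    (hX : ContDiffOn ℝ 1 X U) (h : HasSolutionTo X U t p) :
    ∃ G : ℝ × E → E, ContDiffAt ℝ 1 G (t, p) ∧
      ∀ᶠ z in 𝓝 (t, p), HasSolutionTo X U z.1 z.2 ∧ localFlow X U z.1 z.2 = G z := by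
  -- The time `t` becomes a constant component of the state, so that joint dependence on `(t, p)` is
  -- dependence on the initial point.
  let Xs : E × ℝ → E × ℝ := fun w => (w.2 • X w.1, 0)
  have hUs : IsOpen (U ×ˢ (univ : Set ℝ)) := hU.prod isOpen_univ
  have hXs : ContDiffOn ℝ 1 Xs (U ×ˢ univ) :=
    (contDiffOn_snd.smul (hX.comp contDiffOn_fst fun z hz => hz.1)).prodMk contDiffOn_const
  let γ : ℝ → E × ℝ := fun s => (localFlow X U (s * t) p, t)
  have hγ : IsIntegralCurveOn γ (fun _ => Xs) (Icc 0 1) := fun s hs =>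
    ((h.isIntegralCurveOn_scaled hU hX) s hs).prodMk (hasDerivWithinAt_const _ _ _)
  have hγU : ∀ s ∈ Icc (0 : ℝ) 1, γ s ∈ U ×ˢ (univ : Set ℝ) := fun s hs =>
    ⟨(h.isIntegralCurveOn hU hX).2 _ (mul_mem_uIcc hs), mem_univ _⟩
  have hγ0 : γ 0 = (p, t) := by simp [γ, localFlow_zero]
  obtain ⟨Γ, hΓ, -, hΓs, -⟩ := exists_contDiffAt_solution hUs hXs hγ hγU
  rw [hγ0] at hΓ hΓs
  have hswap : ContDiffAt ℝ 1 (Prod.swap : ℝ × E → E × ℝ) (t, p) :=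
    contDiffAt_snd.prodMk contDiffAt_fst
  let L : C(unitInterval, E × ℝ) →L[ℝ] E :=
    (ContinuousLinearMap.fst ℝ E ℝ).comp (ContinuousMap.evalCLM ℝ (1 : unitInterval))
  refine ⟨fun z => L (Γ z.swap), ?_, ?_⟩
  · exact L.contDiff.contDiffAt.comp (t, p)
      (ContDiffAt.comp (g := Γ) (f := Prod.swap) (t, p) hΓ hswap)
  · have hc : Tendsto (Prod.swap : ℝ × E → E × ℝ) (𝓝 (t, p)) (𝓝 (p, t)) :=
      hswap.continuousAt
    filter_upwards [hc.eventually hΓs] with z hz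
    obtain ⟨z1, z2, z3⟩ := hz
    set η : ℝ → E × ℝ := IccExtend zero_le_one (Γ z.swap) with hη
    have hη0 : η 0 = z.swap := by
      rw [hη, IccExtend_of_mem _ _ (show (0 : ℝ) ∈ Icc 0 1 by simp)]
      exact z2
    have hηU : ∀ s ∈ Icc (0 : ℝ) 1, (η s).1 ∈ U := fun s hs => by
      rw [hη, IccExtend_of_mem _ _ hs]
      exact (z1 _).1
    have hη2 : ∀ s ∈ Icc (0 : ℝ) 1, (η s).2 = z.1 := fun s hs => by
      have := eqOn_const_of_hasDerivWithinAt_zero (f := fun s => (η s).2)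
        (fun s hs => (hasDerivWithinAt_iff_hasFDerivWithinAt.1 (z3 s
          hs)).snd.hasDerivWithinAt.congr_deriv (by simp [Xs])) s hs
      rw [this, hη0]
      rfl
    have hη1 : IsIntegralCurveOn (fun s => (η s).1) (fun _ q => z.1 • X q) (Icc 0 1) :=
      fun s hs => by
        have := (hasDerivWithinAt_iff_hasFDerivWithinAt.1 (z3 s hs)).fst.hasDerivWithinAt
        refine this.congr_deriv ?_
        simp [Xs, hη2 s hs]
    obtain ⟨k1, k2⟩ := localFlow_eq_of_scaled (p := z.2) hU hX (by rw [hη0]; rfl) hη1 hηU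
    refine ⟨k1, ?_⟩
    have := k2 1 (by simp)
    rw [one_mul] at this
    rw [this, hη, IccExtend_of_mem _ _ (show (1 : ℝ) ∈ Icc 0 1 by simp)]
    rfl

theorem isOpen_flowDomain [CompleteSpace E] (hU : IsOpen U) (hX : ContDiffOn ℝ 1 X U) :
    IsOpen (flowDomain X U) := by
  rw [isOpen_iff_mem_nhds]
  rintro ⟨t, p⟩ h
  obtain ⟨G, -, hG⟩ := HasSolutionTo.exists_contDiffAt hU hX h
  filter_upwards [hG] with z hz using hz.1

theorem HasSolutionTo.contDiffAt [CompleteSpace E] (hU : IsOpen U) (hX : ContDiffOn ℝ 1 X U)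
    (h : HasSolutionTo X U t p) :
    ContDiffAt ℝ 1 (fun z : ℝ × E => localFlow X U z.1 z.2) (t, p) := by
  obtain ⟨G, hG, hG'⟩ := HasSolutionTo.exists_contDiffAt hU hX h
  refine hG.congr_of_eventuallyEq ?_
  filter_upwards [hG'] with z hz using hz.2

theorem contDiffOn_localFlow [CompleteSpace E] (hU : IsOpen U) (hX : ContDiffOn ℝ 1 X U) :
    ContDiffOn ℝ 1 (fun z : ℝ × E => localFlow X U z.1 z.2) (flowDomain X U) :=
  fun _ hz => (HasSolutionTo.contDiffAt hU hX hz).contDiffWithinAt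

theorem isOpen_setOf_hasSolutionTo [CompleteSpace E] (hU : IsOpen U) (hX : ContDiffOn ℝ 1 X U)
    (p : E) : IsOpen {t | HasSolutionTo X U t p} :=
  (isOpen_flowDomain hU hX).preimage (by fun_prop : Continuous fun t : ℝ => (t, p))

/-- The set of times reached is open, so the solution continues beyond `t` and the one-sided
derivative at the end of an interval becomes two-sided. At `t = 0` the forward and the backward
solution are glued. -/
theorem HasSolutionTo.hasDerivAt [CompleteSpace E] (hU : IsOpen U) (hX : ContDiffOn ℝ 1 X U)
    (h : HasSolutionTo X U t p) :
    HasDerivAt (fun s => localFlow X U s p) (X (localFlow X U t p)) t := by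
  obtain ⟨δ, hδ, hball⟩ := Metric.isOpen_iff.1 (isOpen_setOf_hasSolutionTo hU hX p) t h
  have h1 : HasSolutionTo X U (t + δ / 2) p := hball (by
    rw [Metric.mem_ball, Real.dist_eq, add_sub_cancel_left, abs_of_pos (by positivity)]
    linarith)
  have h2 : HasSolutionTo X U (t - δ / 2) p := hball (by
    rw [Metric.mem_ball, Real.dist_eq, sub_sub_cancel_left, abs_neg, abs_of_pos (by positivity)]
    linarith)
  rcases lt_trichotomy t 0 with ht | ht | ht
  · have hs : uIcc 0 (t - δ / 2) ∈ 𝓝 t := by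
      rw [uIcc_of_ge (by linarith)]
      exact Icc_mem_nhds (by linarith) ht
    exact ((h2.isIntegralCurveOn hU hX).1 t (mem_of_mem_nhds hs)).hasDerivAt hs
  · have k1 := (h1.isIntegralCurveOn hU hX).1 t (by rw [ht]; exact left_mem_uIcc)
    have k2 := (h2.isIntegralCurveOn hU hX).1 t (by rw [ht]; exact left_mem_uIcc)
    refine (k1.union k2).hasDerivAt ?_
    rw [ht, zero_add, zero_sub, uIcc_of_le (by linarith : (0 : ℝ) ≤ δ / 2),
      uIcc_of_ge (by linarith : -(δ / 2) ≤ (0 : ℝ)), union_comm,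
      Icc_union_Icc_eq_Icc (by linarith) (by linarith)]
    exact Icc_mem_nhds (by linarith) (by linarith)
  · have hs : uIcc 0 (t + δ / 2) ∈ 𝓝 t := by
      rw [uIcc_of_le (by linarith)]
      exact Icc_mem_nhds ht (by linarith)
    exact ((h1.isIntegralCurveOn hU hX).1 t (mem_of_mem_nhds hs)).hasDerivAt hs

theorem HasSolutionTo.neg [CompleteSpace E] (hU : IsOpen U) (hX : ContDiffOn ℝ 1 X U)
    (h : HasSolutionTo X U t p) :
    HasSolutionTo X U (-t) (localFlow X U t p) ∧
      localFlow X U (-t) (localFlow X U t p) = p := by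
  have hm : ∀ s ∈ uIcc 0 (-t), s + t ∈ uIcc 0 t := fun s hs => by
    rw [mem_uIcc] at hs ⊢
    rcases hs with hs | hs
    · right; constructor <;> linarith
    · left; constructor <;> linarith
  have hγ : IsIntegralCurveOn (fun s => localFlow X U (s + t) p) (fun _ => X) (uIcc 0 (-t)) :=
    fun s hs => (((h.mono (hm s hs)).hasDerivAt hU hX).comp_add_const s t).hasDerivWithinAt
  have hγU : ∀ s ∈ uIcc 0 (-t), localFlow X U (s + t) p ∈ U := fun s hs =>
    (h.mono (hm s hs)).localFlow_mem hU hX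
  have h0 : (fun s => localFlow X U (s + t) p) 0 = localFlow X U t p := by simp
  refine ⟨⟨_, h0, hγ, hγU⟩, ?_⟩
  rw [localFlow_eq hU hX h0 hγ hγU right_mem_uIcc]
  simp [localFlow_zero]

theorem HasSolutionTo.contDiffAt_right [CompleteSpace E] (hU : IsOpen U)
    (hX : ContDiffOn ℝ 1 X U) (h : HasSolutionTo X U t p) :
    ContDiffAt ℝ 1 (localFlow X U t) p :=
  ContDiffAt.comp (g := fun z : ℝ × E => localFlow X U z.1 z.2) (f := fun q => (t, q)) p
    (h.contDiffAt hU hX) (by fun_prop)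

theorem HasSolutionTo.fderiv_eq_comp_inr [CompleteSpace E] (hU : IsOpen U)
    (hX : ContDiffOn ℝ 1 X U) (h : HasSolutionTo X U t p) :
    fderiv ℝ (localFlow X U t) p =
      fderiv ℝ (fun z : ℝ × E => localFlow X U z.1 z.2) (t, p) ∘L .inr ℝ ℝ E := by
  refine HasFDerivAt.fderiv ?_
  exact HasFDerivAt.comp (g := fun z : ℝ × E => localFlow X U z.1 z.2) (f := fun q => (t, q)) p
    ((h.contDiffAt hU hX).differentiableAt one_ne_zero).hasFDerivAt (hasFDerivAt_prodMk_right t p)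

theorem HasSolutionTo.eventually_right [CompleteSpace E] (hU : IsOpen U)
    (hX : ContDiffOn ℝ 1 X U) (h : HasSolutionTo X U t p) :
    ∀ᶠ q in 𝓝 p, HasSolutionTo X U t q :=
  (by fun_prop : Continuous fun q : E => (t, q)).continuousAt.eventually
    ((isOpen_flowDomain hU hX).mem_nhds h)

theorem continuousOn_fderiv_localFlow [CompleteSpace E] (hU : IsOpen U)
    (hX : ContDiffOn ℝ 1 X U) (p : E) :
    ContinuousOn (fun s => fderiv ℝ (localFlow X U s) p) {t | HasSolutionTo X U t p} := by
  have h1 := (contDiffOn_localFlow hU hX).continuousOn_fderiv_of_isOpen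
    (isOpen_flowDomain hU hX) le_rfl
  have h2 : ContinuousOn (fun s => fderiv ℝ (fun z : ℝ × E => localFlow X U z.1 z.2) (s, p) ∘L
      .inr ℝ ℝ E) {t | HasSolutionTo X U t p} :=
    (h1.comp (by fun_prop : Continuous fun t : ℝ => (t, p)).continuousOn
      fun t ht => ht).clm_comp continuousOn_const
  exact h2.congr fun t ht => HasSolutionTo.fderiv_eq_comp_inr hU hX ht

/-- The flows for the times `t` and `-t` are inverse to each other near `p` and near its image; the
chain rule at both points gives a left and a right inverse. -/
theorem HasSolutionTo.isInvertible_fderiv [CompleteSpace E] (hU : IsOpen U)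
    (hX : ContDiffOn ℝ 1 X U) (h : HasSolutionTo X U t p) :
    (fderiv ℝ (localFlow X U t) p).IsInvertible := by
  obtain ⟨h1, h2⟩ := h.neg hU hX
  have key : ∀ {t : ℝ} {p : E}, HasSolutionTo X U t p →
      fderiv ℝ (localFlow X U (-t)) (localFlow X U t p) ∘L fderiv ℝ (localFlow X U t) p =
        .id ℝ E := by
    intro t p h
    have d1 := ((h.contDiffAt_right hU hX).differentiableAt one_ne_zero).hasFDerivAt
    have d2 := (((h.neg hU hX).1.contDiffAt_right hU hX).differentiableAt
      one_ne_zero).hasFDerivAt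
    have d3 : HasFDerivAt (fun q => localFlow X U (-t) (localFlow X U t q)) (.id ℝ E) p := by
      refine (hasFDerivAt_id p).congr_of_eventuallyEq ?_
      filter_upwards [h.eventually_right hU hX] with q hq using (hq.neg hU hX).2
    exact (d2.comp p d1).unique d3
  have k2 := key h1
  rw [neg_neg, h2] at k2
  exact ContinuousLinearMap.IsInvertible.of_inverse k2 (key h)

/-- The integrated variational equation for the scaled field `t • X`, after the substitution `r = s
* t`. The derivative of the path-valued solution map, evaluated at `s`, is the derivative of the
flow for the time `s * t`. -/
theorem HasSolutionTo.fderiv_apply_eq [CompleteSpace E] (hU : IsOpen U)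
    (hX : ContDiffOn ℝ 1 X U) (h : HasSolutionTo X U t p) (v : E) :
    fderiv ℝ (localFlow X U t) p v = v + ∫ r in (0 : ℝ)..t,
      fderiv ℝ X (localFlow X U r p) (fderiv ℝ (localFlow X U r) p v) := by
  have hXt : ContDiffOn ℝ 1 (fun q => t • X q) U := contDiffOn_const.smul hX
  have hγU : ∀ s ∈ Icc (0 : ℝ) 1, localFlow X U (s * t) p ∈ U := fun s hs =>
    (h.isIntegralCurveOn hU hX).2 _ (mul_mem_uIcc hs)
  obtain ⟨Γ, hΓ, -, hΓs, hΓv⟩ :=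
    exists_contDiffAt_solution hU hXt (h.isIntegralCurveOn_scaled hU hX) hγU
  have h0 : localFlow X U (0 * t) p = p := by rw [zero_mul, localFlow_zero]
  simp only [h0] at hΓ hΓs hΓv
  have hW : ∀ s (hs : s ∈ Icc (0 : ℝ) 1),
      fderiv ℝ (localFlow X U (s * t)) p v = fderiv ℝ Γ p v ⟨s, hs⟩ := by
    intro s hs
    have d : HasFDerivAt (localFlow X U (s * t))
        ((ContinuousMap.evalCLM ℝ (⟨s, hs⟩ : unitInterval)) ∘L fderiv ℝ Γ p) p := by
      refine ((ContinuousMap.evalCLM ℝ (⟨s, hs⟩ : unitInterval)).hasFDerivAt.comp p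
        (hΓ.differentiableAt one_ne_zero).hasFDerivAt).congr_of_eventuallyEq ?_
      filter_upwards [hΓs] with q hq
      obtain ⟨q1, q2, q3⟩ := hq
      have := (localFlow_eq_of_scaled (p := q) hU hX
        (by rw [IccExtend_of_mem _ _ (show (0 : ℝ) ∈ Icc 0 1 by simp)]; exact q2) q3
        (fun s hs => by rw [IccExtend_of_mem _ _ hs]; exact q1 _)).2 s hs
      rw [this, IccExtend_of_mem _ _ hs]
      rfl
    rw [d.fderiv]
    rfl
  have h1 := hW 1 (by simp)
  rw [one_mul] at h1
  rw [h1]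
  refine (hΓv v 1).trans ?_
  congr 1
  have h2 := intervalIntegral.smul_integral_comp_mul_right (a := 0) (b := 1)
    (fun r => fderiv ℝ X (localFlow X U r p) (fderiv ℝ (localFlow X U r) p v)) t
  rw [zero_mul, one_mul] at h2
  rw [← h2, ← intervalIntegral.integral_smul]
  refine intervalIntegral.integral_congr fun s hs => ?_
  rw [Icc.coe_one, uIcc_of_le zero_le_one] at hs
  rw [IccExtend_of_mem _ _ hs, hW s hs, fderiv_fun_const_smul]
  · rfl
  · exact (hX.differentiableOn one_ne_zero).differentiableAt (hU.mem_nhds (hγU s hs))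

theorem HasSolutionTo.uIcc_subset (h : HasSolutionTo X U t p) :
    uIcc 0 t ⊆ {t | HasSolutionTo X U t p} := fun _ hs => h.mono hs

theorem hasDerivAt_integral_of_continuousOn [CompleteSpace E] {f : ℝ → E} {J : Set ℝ} {a t : ℝ}
    (hJ : IsOpen J) (hf : ContinuousOn f J) (ht : uIcc a t ⊆ J) :
    HasDerivAt (fun s => ∫ r in a..s, f r) (f t) t :=
  have htJ : t ∈ J := ht right_mem_uIcc
  intervalIntegral.integral_hasDerivAt_right ((hf.mono ht).intervalIntegrable)
    (hf.stronglyMeasurableAtFilter hJ t htJ) (hf.continuousAt (hJ.mem_nhds htJ))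

theorem continuousOn_localFlow_left [CompleteSpace E] (hU : IsOpen U) (hX : ContDiffOn ℝ 1 X U)
    (p : E) : ContinuousOn (fun s => localFlow X U s p) {t | HasSolutionTo X U t p} :=
  fun _ hs => (HasSolutionTo.hasDerivAt hU hX hs).continuousAt.continuousWithinAt

/-- The derivative of the flow solves the variational equation. -/
theorem HasSolutionTo.hasDerivAt_fderiv [CompleteSpace E] (hU : IsOpen U)
    (hX : ContDiffOn ℝ 1 X U) (h : HasSolutionTo X U t p) :
    HasDerivAt (fun s => fderiv ℝ (localFlow X U s) p)
      (fderiv ℝ X (localFlow X U t p) ∘L fderiv ℝ (localFlow X U t) p) t := by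
  set J := {t | HasSolutionTo X U t p} with hJ
  have hJo : IsOpen J := isOpen_setOf_hasSolutionTo hU hX p
  have hX' : ContinuousOn (fderiv ℝ X) U := hX.continuousOn_fderiv_of_isOpen hU le_rfl
  have hc : ContinuousOn (fun r => fderiv ℝ X (localFlow X U r p) ∘L
      fderiv ℝ (localFlow X U r) p) J :=
    (hX'.comp (continuousOn_localFlow_left hU hX p) fun s hs =>
      HasSolutionTo.localFlow_mem hU hX hs).clm_comp (continuousOn_fderiv_localFlow hU hX p)
  have h1 := (hasDerivAt_integral_of_continuousOn hJo hc h.uIcc_subset).const_add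
    (ContinuousLinearMap.id ℝ E)
  refine h1.congr_of_eventuallyEq ?_
  filter_upwards [hJo.mem_nhds h] with s hs
  ext v
  rw [HasSolutionTo.fderiv_apply_eq hU hX hs v, add_apply,
    ContinuousLinearMap.intervalIntegral_apply
      ((hc.mono (HasSolutionTo.uIcc_subset hs)).intervalIntegrable)]
  rfl

/-- Variation of constants. -/
theorem HasSolutionTo.hasDerivAt_variation_of_constants [CompleteSpace E] (hU : IsOpen U)
    (hX : ContDiffOn ℝ 1 X U) {b : E → E} (hb : ContinuousOn b U) (h : HasSolutionTo X U t p) :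
    HasDerivAt (fun t => fderiv ℝ (localFlow X U t) p
      (∫ s in (0 : ℝ)..t, (fderiv ℝ (localFlow X U s) p).inverse (b (localFlow X U s p))))
      (fderiv ℝ X (localFlow X U t p) (fderiv ℝ (localFlow X U t) p
        (∫ s in (0 : ℝ)..t, (fderiv ℝ (localFlow X U s) p).inverse (b (localFlow X U s p)))) +
        b (localFlow X U t p)) t := by
  set J := {t | HasSolutionTo X U t p} with hJ
  have hJo : IsOpen J := isOpen_setOf_hasSolutionTo hU hX p
  have hinv : ContinuousOn (fun s => (fderiv ℝ (localFlow X U s) p).inverse) J := fun s hs =>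
    ContinuousAt.comp_continuousWithinAt
      (f := fun s => fderiv ℝ (localFlow X U s) p) (g := ContinuousLinearMap.inverse)
      (HasSolutionTo.isInvertible_fderiv hU hX hs |>.contDiffAt_map_inverse (𝕜 := ℝ)
        (n := 0)).continuousAt (continuousOn_fderiv_localFlow hU hX p s hs)
  have hc : ContinuousOn
      (fun s => (fderiv ℝ (localFlow X U s) p).inverse (b (localFlow X U s p))) J :=
    hinv.clm_apply (hb.comp (continuousOn_localFlow_left hU hX p) fun s hs =>
      HasSolutionTo.localFlow_mem hU hX hs)
  have h1 := hasDerivAt_integral_of_continuousOn hJo hc h.uIcc_subset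
  refine ((h.hasDerivAt_fderiv hU hX).clm_apply h1).congr_deriv ?_
  rw [(h.isInvertible_fderiv hU hX).self_apply_inverse]
  rfl

end LocalFlow

/-! ### Hadamard's lemma: difference quotients that stay C¹ at `ε = 0`. -/

section Hadamard

variable {E F : Type*} [NormedAddCommGroup E] [NormedSpace ℝ E]
  [NormedAddCommGroup F] [NormedSpace ℝ F]

/-- The difference quotient `(f(q + ε ξ) - f(q)) / ε`, extended to `ε = 0`. -/
noncomputable def quotientAlong (f : E → F) (z : E × E × ℝ) : F :=
  segmentIntegral (fun w : E × E => fderiv ℝ f w.1 w.2) ((z.1, z.2.1), (z.2.2 • z.2.1, 0))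

theorem quotientAlong_zero [CompleteSpace F] (f : E → F) (q ξ : E) :
    quotientAlong f (q, ξ, 0) = fderiv ℝ f q ξ := by
  simp only [quotientAlong, zero_smul]
  exact segmentIntegral_zero_right _ _

variable {f : E → F} {D : Set E}

/-- The quotient is the mean of the C¹ function `(w, ξ) ↦ fderiv ℝ f w ξ` over a segment, so exactly
one derivative is lost. This is where `X₀`, `g` and `h` have to be C². -/
theorem contDiffAt_quotientAlong (hD : IsOpen D) (hf : ContDiffOn ℝ 2 f D) {z : E × E × ℝ}
    (hz : ∀ r ∈ Icc (0 : ℝ) 1, z.1 + r • (z.2.2 • z.2.1) ∈ D) :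
    ContDiffAt ℝ 1 (quotientAlong f) z := by
  have h1 : ContDiffOn ℝ 1 (fun w : E × E => fderiv ℝ f w.1 w.2) (D ×ˢ univ) :=
    ((hf.fderiv_of_isOpen hD le_rfl).comp contDiffOn_fst fun w hw => hw.1).clm_apply
      contDiffOn_snd
  have h2 : ContDiffAt ℝ 1 (fun z : E × E × ℝ => (((z.1, z.2.1), (z.2.2 • z.2.1, 0)) :
      (E × E) × (E × E))) z := by fun_prop
  exact (contDiffAt_segmentIntegral (p := ((z.1, z.2.1), (z.2.2 • z.2.1, 0)))
    (hD.prod isOpen_univ) h1 fun r hr => ⟨hz r hr, mem_univ _⟩).comp z h2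

theorem apply_add_smul_eq [CompleteSpace F] (hD : IsOpen D) (hf : ContDiffOn ℝ 1 f D)
    {z : E × E × ℝ} (hz : ∀ r ∈ Icc (0 : ℝ) 1, z.1 + r • (z.2.2 • z.2.1) ∈ D) :
    f (z.1 + z.2.2 • z.2.1) = f z.1 + z.2.2 • quotientAlong f z := by
  obtain ⟨q, ξ, ε⟩ := z
  simp only at hz ⊢
  have hc : ContinuousOn (fun r : ℝ => fderiv ℝ f (q + r • (ε • ξ)) (ε • ξ)) (Icc 0 1) := by
    refine ContinuousOn.clm_apply ?_ continuousOn_const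
    exact (hf.continuousOn_fderiv_of_isOpen hD le_rfl).comp
      (by fun_prop : Continuous fun r : ℝ => q + r • (ε • ξ)).continuousOn hz
  have hint := intervalIntegral.integral_eq_sub_of_hasDerivAt (a := 0) (b := 1)
    (f := fun r : ℝ => f (q + r • (ε • ξ)))
    (f' := fun r : ℝ => fderiv ℝ f (q + r • (ε • ξ)) (ε • ξ)) (fun r hr => by
      rw [uIcc_of_le zero_le_one] at hr
      have hd := ((hf.differentiableOn one_ne_zero).differentiableAt
        (hD.mem_nhds (hz r hr))).hasFDerivAt
      have hl : HasDerivAt (fun r : ℝ => q + r • (ε • ξ)) (ε • ξ) r := by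
        simpa using ((hasDerivAt_id r).smul_const (ε • ξ)).const_add q
      exact hd.comp_hasDerivAt r hl)
    (by rw [← uIcc_of_le (zero_le_one (α := ℝ))] at hc; exact hc.intervalIntegrable)
  simp only [one_smul, zero_smul, add_zero, map_smul] at hint
  rw [intervalIntegral.integral_smul] at hint
  rw [eq_sub_iff_add_eq] at hint
  rw [← hint, add_comm]
  simp [quotientAlong, segmentIntegral]

end Hadamard

/-! ### The perturbed flow and its blow-up at `ε = 0`. -/

section Perturbation

variable {E : Type*} [NormedAddCommGroup E] [NormedSpace ℝ E]

/-- The perturbed vector field, with the parameter as an additional state. -/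
def extendedField (X₀ X₁ : E → E) (R : E × ℝ → E) (z : E × ℝ) : E × ℝ :=
  (X₀ z.1 + z.2 • X₁ z.1 + z.2 ^ 2 • R z, 0)

/-- The vector field governing `(q, ξ, ε)`, where `q` solves the unperturbed equation and
`q + ε ξ` solves the perturbed one. -/
noncomputable def blowupField (X₀ X₁ : E → E) (R : E × ℝ → E) (z : E × E × ℝ) : E × E × ℝ :=
  (X₀ z.1, quotientAlong X₀ z + X₁ (z.1 + z.2.2 • z.2.1) +
    z.2.2 • R (z.1 + z.2.2 • z.2.1, z.2.2), 0)

/-- The domain of `blowupField`. -/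
def blowupDomain (D : Set E) (ε₀ : ℝ) : Set (E × E × ℝ) :=
  {z | z.2.2 ∈ Ioo (-ε₀) ε₀ ∧ ∀ r ∈ Icc (0 : ℝ) 1, z.1 + r • (z.2.2 • z.2.1) ∈ D}

/-- Regularity of a perturbation `X₀ + ε X₁ + ε² R`. -/
structure IsRegularPerturbation (X₀ X₁ : E → E) (R : E × ℝ → E) (D : Set E) (ε₀ : ℝ) :
    Prop where
  pos : 0 < ε₀
  isOpen : IsOpen D
  contDiffOn_zero : ContDiffOn ℝ 2 X₀ D
  contDiffOn_one : ContDiffOn ℝ 1 X₁ D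
  contDiffOn_rem : ContDiffOn ℝ 1 R (D ×ˢ Ioo (-ε₀) ε₀)

/-- `quotientAlong` integrates over the whole segment from `q` to `q + ε ξ`, so the domain contains
a condition for every `r`; it is open because `[0, 1]` is compact. -/
theorem isOpen_blowupDomain {D : Set E} (hD : IsOpen D) (ε₀ : ℝ) :
    IsOpen (blowupDomain D ε₀) := by
  suffices h1 : IsOpen {z : E × E × ℝ | ∀ r ∈ Icc (0 : ℝ) 1, z.1 + r • (z.2.2 • z.2.1) ∈ D} by
    exact (isOpen_Ioo.preimage (by fun_prop : Continuous fun z : E × E × ℝ => z.2.2)).inter h1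
  rw [isOpen_iff_mem_nhds]
  intro z hz
  refine isCompact_Icc.eventually_forall_of_forall_eventually fun r hr => ?_
  exact (by fun_prop : Continuous fun w : (E × E × ℝ) × ℝ =>
    w.1.1 + w.2 • (w.1.2.2 • w.1.2.1)).continuousAt.eventually (hD.mem_nhds (hz r hr))

namespace IsRegularPerturbation

variable {X₀ X₁ : E → E} {R : E × ℝ → E} {D : Set E} {ε₀ : ℝ}

theorem contDiffOn_zero' (H : IsRegularPerturbation X₀ X₁ R D ε₀) : ContDiffOn ℝ 1 X₀ D :=
  H.contDiffOn_zero.of_le (by norm_num)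

theorem zero_mem (H : IsRegularPerturbation X₀ X₁ R D ε₀) : (0 : ℝ) ∈ Ioo (-ε₀) ε₀ :=
  ⟨by linarith [H.pos], H.pos⟩

theorem isOpen_prod (H : IsRegularPerturbation X₀ X₁ R D ε₀) :
    IsOpen (D ×ˢ Ioo (-ε₀) ε₀) := H.isOpen.prod isOpen_Ioo

theorem contDiffOn_extendedField (H : IsRegularPerturbation X₀ X₁ R D ε₀) :
    ContDiffOn ℝ 1 (extendedField X₀ X₁ R) (D ×ˢ Ioo (-ε₀) ε₀) := by
  have m : MapsTo Prod.fst (D ×ˢ Ioo (-ε₀) ε₀) D := fun z hz => hz.1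
  exact (((H.contDiffOn_zero'.comp contDiffOn_fst m).add
    (contDiffOn_snd.smul (H.contDiffOn_one.comp contDiffOn_fst m))).add
    ((contDiffOn_snd.pow 2).smul H.contDiffOn_rem)).prodMk contDiffOn_const

theorem mem_of_mem_blowupDomain {z : E × E × ℝ} (hz : z ∈ blowupDomain D ε₀) :
    z.1 ∈ D ∧ z.1 + z.2.2 • z.2.1 ∈ D :=
  ⟨by simpa using hz.2 0 (by simp), by simpa using hz.2 1 (by simp)⟩

theorem contDiffOn_blowupField (H : IsRegularPerturbation X₀ X₁ R D ε₀) :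
    ContDiffOn ℝ 1 (blowupField X₀ X₁ R) (blowupDomain D ε₀) := by
  have m1 : MapsTo Prod.fst (blowupDomain D ε₀) D := fun z hz => (mem_of_mem_blowupDomain hz).1
  have m2 : MapsTo (fun z : E × E × ℝ => z.1 + z.2.2 • z.2.1) (blowupDomain D ε₀) D :=
    fun z hz => (mem_of_mem_blowupDomain hz).2
  have c2 : ContDiffOn ℝ 1 (fun z : E × E × ℝ => z.1 + z.2.2 • z.2.1) (blowupDomain D ε₀) := by
    fun_prop
  have c3 : ContDiffOn ℝ 1 (fun z : E × E × ℝ => z.2.2) (blowupDomain D ε₀) := by fun_prop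
  refine (H.contDiffOn_zero'.comp contDiffOn_fst m1).prodMk (ContDiffOn.prodMk ?_ contDiffOn_const)
  refine ContDiffOn.add (ContDiffOn.add ?_ (H.contDiffOn_one.comp c2 m2)) (c3.smul ?_)
  · exact fun z hz => (contDiffAt_quotientAlong H.isOpen H.contDiffOn_zero hz.2).contDiffWithinAt
  · exact H.contDiffOn_rem.comp (c2.prodMk c3) fun z hz => ⟨m2 hz, hz.1⟩

end IsRegularPerturbation

/-- The vector field `X₀ + ε X₁ + ε² R`. -/
def perturbedField (X₀ X₁ : E → E) (R : E × ℝ → E) (ε : ℝ) (p : E) : E :=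
  X₀ p + ε • X₁ p + ε ^ 2 • R (p, ε)

namespace IsRegularPerturbation

variable {X₀ X₁ : E → E} {R : E × ℝ → E} {D : Set E} {ε₀ : ℝ}

theorem contDiffOn_perturbedField (H : IsRegularPerturbation X₀ X₁ R D ε₀) {ε : ℝ}
    (hε : ε ∈ Ioo (-ε₀) ε₀) : ContDiffOn ℝ 1 (perturbedField X₀ X₁ R ε) D :=
  (contDiff_fst.comp_contDiffOn H.contDiffOn_extendedField).comp (f := fun p => (p, ε))
    (contDiff_prodMk_left ε).contDiffOn fun _ hp => ⟨hp, hε⟩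

theorem perturbedField_zero : perturbedField X₀ X₁ R 0 = X₀ := by
  ext p
  simp [perturbedField]

/-- The parameter stays constant along solutions of the extended equation. -/
theorem eq_of_isIntegralCurveOn_zero {η : ℝ → ℝ} {t : ℝ}
    (hη : ∀ s ∈ uIcc 0 t, HasDerivWithinAt η 0 (uIcc 0 t) s) :
    ∀ s ∈ uIcc 0 t, η s = η 0 := fun s hs =>
  (eqOn_const_of_hasDerivWithinAt_zero hη s hs).trans
    (eqOn_const_of_hasDerivWithinAt_zero hη 0 left_mem_uIcc).symm

/-- With the parameter as a state of zero velocity, regularity of the perturbed flow in `(t, p, ε)`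
reduces to regularity of a single flow in its initial point. -/
theorem localFlow_extendedField (H : IsRegularPerturbation X₀ X₁ R D ε₀) {ε t : ℝ} {p : E}
    (h : HasSolutionTo (extendedField X₀ X₁ R) (D ×ˢ Ioo (-ε₀) ε₀) t (p, ε)) :
    HasSolutionTo (perturbedField X₀ X₁ R ε) D t p ∧
      (localFlow (extendedField X₀ X₁ R) (D ×ˢ Ioo (-ε₀) ε₀) t (p, ε)).1 =
        localFlow (perturbedField X₀ X₁ R ε) D t p := by
  obtain ⟨h1, h2⟩ := h.isIntegralCurveOn H.isOpen_prod H.contDiffOn_extendedField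
  set η := fun s => localFlow (extendedField X₀ X₁ R) (D ×ˢ Ioo (-ε₀) ε₀) s (p, ε) with hη
  have hη0 : η 0 = (p, ε) := localFlow_zero _
  have hε : ε ∈ Ioo (-ε₀) ε₀ := h.mem.2
  have hc : ∀ s ∈ uIcc 0 t, (η s).2 = ε := fun s hs => by
    rw [eq_of_isIntegralCurveOn_zero (η := fun s => (η s).2) (fun s hs =>
      (hasDerivWithinAt_iff_hasFDerivWithinAt.1 (h1 s hs)).snd.hasDerivWithinAt.congr_deriv
        (by simp [extendedField])) s hs, hη0]
  have hc1 : IsIntegralCurveOn (fun s => (η s).1) (fun _ => perturbedField X₀ X₁ R ε)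
      (uIcc 0 t) := fun s hs => by
    refine (hasDerivWithinAt_iff_hasFDerivWithinAt.1
      (h1 s hs)).fst.hasDerivWithinAt.congr_deriv ?_
    have e : η s = ((η s).1, ε) := Prod.ext rfl (hc s hs)
    simp only [ContinuousLinearMap.comp_apply, ContinuousLinearMap.toSpanSingleton_apply, one_smul,
      ContinuousLinearMap.coe_fst', extendedField, perturbedField, hc s hs]
    rw [← e]
  have hm : ∀ s ∈ uIcc 0 t, (η s).1 ∈ D := fun s hs => (h2 s hs).1
  have h0 : (fun s => (η s).1) 0 = p := by simp [hη0]
  exact ⟨⟨_, h0, hc1, hm⟩, (localFlow_eq H.isOpen (H.contDiffOn_perturbedField hε) h0 hc1 hm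
    right_mem_uIcc).symm⟩

theorem hasSolutionTo_extendedField {ε t : ℝ} (hε : ε ∈ Ioo (-ε₀) ε₀) {p : E}
    (h : HasSolutionTo (perturbedField X₀ X₁ R ε) D t p) :
    HasSolutionTo (extendedField X₀ X₁ R) (D ×ˢ Ioo (-ε₀) ε₀) t (p, ε) := by
  obtain ⟨γ, h0, h1, h2⟩ := h
  exact ⟨fun s => (γ s, ε), by simp [h0], fun s hs => (h1 s hs).prodMk
    (hasDerivWithinAt_const _ _ _), fun s hs => ⟨h2 s hs, hε⟩⟩

theorem eventually_hasSolutionTo [CompleteSpace E] (H : IsRegularPerturbation X₀ X₁ R D ε₀)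
    {ε t : ℝ} (hε : ε ∈ Ioo (-ε₀) ε₀) {p : E}
    (h : HasSolutionTo (perturbedField X₀ X₁ R ε) D t p) :
    ∀ᶠ z in 𝓝 ((t, p, ε) : ℝ × E × ℝ), z.2.2 ∈ Ioo (-ε₀) ε₀ ∧
      HasSolutionTo (perturbedField X₀ X₁ R z.2.2) D z.1 z.2.1 := by
  filter_upwards [(isOpen_flowDomain H.isOpen_prod H.contDiffOn_extendedField).mem_nhds
    (hasSolutionTo_extendedField hε h : (t, (p, ε)) ∈ flowDomain _ _)] with z hz
  exact ⟨(HasSolutionTo.mem hz).2, (H.localFlow_extendedField hz).1⟩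

theorem contDiffAt_localFlow [CompleteSpace E] (H : IsRegularPerturbation X₀ X₁ R D ε₀)
    {ε t : ℝ} (hε : ε ∈ Ioo (-ε₀) ε₀) {p : E}
    (h : HasSolutionTo (perturbedField X₀ X₁ R ε) D t p) :
    ContDiffAt ℝ 1 (fun z : ℝ × E × ℝ => localFlow (perturbedField X₀ X₁ R z.2.2) D z.1 z.2.1)
      (t, p, ε) := by
  have h' := hasSolutionTo_extendedField hε h
  refine (contDiffAt_fst.comp _ (h'.contDiffAt H.isOpen_prod
    H.contDiffOn_extendedField)).congr_of_eventuallyEq ?_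
  filter_upwards [(isOpen_flowDomain H.isOpen_prod H.contDiffOn_extendedField).mem_nhds
    (h' : (t, (p, ε)) ∈ flowDomain _ _)] with z hz
  exact (H.localFlow_extendedField hz).2.symm

/-- The `ξ`-component of the flow of `blowupField`, as a function of `(t, q, ξ, ε)`. -/
noncomputable def _root_.blowupFlow (X₀ X₁ : E → E) (R : E × ℝ → E) (D : Set E) (ε₀ : ℝ)
    (z : ℝ × E × E × ℝ) : E :=
  (localFlow (blowupField X₀ X₁ R) (blowupDomain D ε₀) z.1 z.2).2.1

/-- Along the blown-up flow the velocity of `q + ε ξ` contains `X₀(q) + ε · quotientAlong X₀`, which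
equals `X₀(q + ε ξ)`. The identity is exact, so the difference of the perturbed and the unperturbed
flow, divided by `ε`, is a component of a C¹ flow. -/
theorem localFlow_blowupField [CompleteSpace E] (H : IsRegularPerturbation X₀ X₁ R D ε₀)
    {ε t : ℝ} {q ξ : E}
    (h : HasSolutionTo (blowupField X₀ X₁ R) (blowupDomain D ε₀) t (q, ξ, ε)) :
    HasSolutionTo X₀ D t q ∧ HasSolutionTo (perturbedField X₀ X₁ R ε) D t (q + ε • ξ) ∧
      localFlow (perturbedField X₀ X₁ R ε) D t (q + ε • ξ) =
        localFlow X₀ D t q + ε • blowupFlow X₀ X₁ R D ε₀ (t, q, ξ, ε) := by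
  obtain ⟨h1, h2⟩ := h.isIntegralCurveOn (isOpen_blowupDomain H.isOpen ε₀)
    H.contDiffOn_blowupField
  set η := fun s => localFlow (blowupField X₀ X₁ R) (blowupDomain D ε₀) s (q, ξ, ε) with hη
  have hη0 : η 0 = (q, ξ, ε) := localFlow_zero _
  have hε : ε ∈ Ioo (-ε₀) ε₀ := h.mem.1
  have hc : ∀ s ∈ uIcc 0 t, (η s).2.2 = ε := fun s hs => by
    rw [eq_of_isIntegralCurveOn_zero (η := fun s => (η s).2.2) (fun s hs =>
      (hasDerivWithinAt_iff_hasFDerivWithinAt.1 (h1 s hs)).snd.snd.hasDerivWithinAt.congr_deriv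
        (by simp [blowupField])) s hs, hη0]
  have d1 : IsIntegralCurveOn (fun s => (η s).1) (fun _ => X₀) (uIcc 0 t) := fun s hs =>
    (hasDerivWithinAt_iff_hasFDerivWithinAt.1
      (h1 s hs)).fst.hasDerivWithinAt.congr_deriv (by simp [blowupField])
  have m1 : ∀ s ∈ uIcc 0 t, (η s).1 ∈ D := fun s hs => (mem_of_mem_blowupDomain (h2 s hs)).1
  have z1 : (fun s => (η s).1) 0 = q := by simp [hη0]
  have d2 : ∀ s ∈ uIcc 0 t, HasDerivWithinAt (fun s => (η s).2.1)
      (blowupField X₀ X₁ R (η s)).2.1 (uIcc 0 t) s := fun s hs =>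
    (hasDerivWithinAt_iff_hasFDerivWithinAt.1
      (h1 s hs)).snd.fst.hasDerivWithinAt.congr_deriv (by simp)
  have d3 : IsIntegralCurveOn (fun s => (η s).1 + ε • (η s).2.1)
      (fun _ => perturbedField X₀ X₁ R ε) (uIcc 0 t) := fun s hs => by
    refine ((d1 s hs).add ((d2 s hs).const_smul ε)).congr_deriv ?_
    have e : X₀ ((η s).1 + (η s).2.2 • (η s).2.1) = X₀ (η s).1 + (η s).2.2 •
        quotientAlong X₀ (η s) := apply_add_smul_eq H.isOpen H.contDiffOn_zero' (h2 s hs).2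
    rw [hc s hs] at e
    simp only [perturbedField, blowupField, e, hc s hs, smul_add, smul_smul, pow_two]
    abel
  have m3 : ∀ s ∈ uIcc 0 t, (η s).1 + ε • (η s).2.1 ∈ D := fun s hs => by
    have := (mem_of_mem_blowupDomain (h2 s hs)).2
    rwa [hc s hs] at this
  have z3 : (fun s => (η s).1 + ε • (η s).2.1) 0 = q + ε • ξ := by simp [hη0]
  refine ⟨⟨_, z1, d1, m1⟩, ⟨_, z3, d3, m3⟩, ?_⟩
  rw [localFlow_eq H.isOpen (H.contDiffOn_perturbedField hε) z3 d3 m3 right_mem_uIcc,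
    localFlow_eq H.isOpen H.contDiffOn_zero' z1 d1 m1 right_mem_uIcc]
  rfl

/-- At `ε = 0` the equation is `ξ' = DX₀(q) ξ + X₁(q)`. Its solution is explicit by variation of
constants and lives as long as `q` does; the integral term is the `ω` of the Melnikov function. -/
theorem hasSolutionTo_blowupField [CompleteSpace E] (H : IsRegularPerturbation X₀ X₁ R D ε₀)
    {t : ℝ} {q : E} (h : HasSolutionTo X₀ D t q) (ξ : E) :
    HasSolutionTo (blowupField X₀ X₁ R) (blowupDomain D ε₀) t (q, ξ, 0) ∧
      blowupFlow X₀ X₁ R D ε₀ (t, q, ξ, 0) = fderiv ℝ (localFlow X₀ D t) q ξ +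
        fderiv ℝ (localFlow X₀ D t) q (∫ s in (0 : ℝ)..t,
          (fderiv ℝ (localFlow X₀ D s) q).inverse (X₁ (localFlow X₀ D s q))) := by
  let ω : ℝ → E := fun t => fderiv ℝ (localFlow X₀ D t) q (∫ s in (0 : ℝ)..t,
          (fderiv ℝ (localFlow X₀ D s) q).inverse (X₁ (localFlow X₀ D s q)))
  let η : ℝ → E × E × ℝ := fun s =>
    (localFlow X₀ D s q, fderiv ℝ (localFlow X₀ D s) q ξ + ω s, 0)
  have hid : localFlow X₀ D 0 = id := funext fun p => localFlow_zero p
  have h0 : η 0 = (q, ξ, 0) := by simp [η, ω, hid]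
  have hm : ∀ s ∈ uIcc 0 t, η s ∈ blowupDomain D ε₀ := fun s hs =>
    ⟨H.zero_mem, fun r _ => by simpa [η] using (h.mono hs).localFlow_mem H.isOpen H.contDiffOn_zero'⟩
  have hd : IsIntegralCurveOn η (fun _ => blowupField X₀ X₁ R) (uIcc 0 t) := fun s hs => by
    have hs' := h.mono hs
    refine HasDerivAt.hasDerivWithinAt ?_
    refine (hs'.hasDerivAt H.isOpen H.contDiffOn_zero').prodMk (HasDerivAt.prodMk ?_
      (hasDerivAt_const _ _))
    refine (((hs'.hasDerivAt_fderiv H.isOpen H.contDiffOn_zero').clm_apply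
      (hasDerivAt_const s ξ)).add (hs'.hasDerivAt_variation_of_constants H.isOpen
        H.contDiffOn_zero' H.contDiffOn_one.continuousOn)).congr_deriv ?_
    simp only [η, quotientAlong_zero]
    simp [ω, add_assoc]
  refine ⟨⟨η, h0, hd, hm⟩, ?_⟩
  rw [blowupFlow, localFlow_eq (isOpen_blowupDomain H.isOpen ε₀) H.contDiffOn_blowupField h0 hd hm
    right_mem_uIcc]

end IsRegularPerturbation

end Perturbation

/-! ### The rescaled flow, with the arrival time varied as well. -/

section RescaledFlow

variable {E : Type*} [NormedAddCommGroup E] [NormedSpace ℝ E]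
  {X₀ X₁ : E → E} {R : E × ℝ → E} {D : Set E} {ε₀ : ℝ}

/-- The function of `(t, s, q, ξ, ε)` that extends
`(φ_ε(t + ε s, q + ε ξ) - φ_0(t, q)) / ε` to `ε = 0`. -/
noncomputable def rescaledFlow (X₀ X₁ : E → E) (R : E × ℝ → E) (D : Set E) (ε₀ : ℝ)
    (z : ℝ × ℝ × E × E × ℝ) : E :=
  blowupFlow X₀ X₁ R D ε₀ (z.1 + z.2.2.2.2 * z.2.1, z.2.2.1, z.2.2.2.1, z.2.2.2.2) +
    z.2.1 • segmentIntegral (fun w : ℝ × E => X₀ (localFlow X₀ D w.1 w.2))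
      ((z.1, z.2.2.1), (z.2.2.2.2 * z.2.1, 0))

namespace IsRegularPerturbation

variable [CompleteSpace E]

theorem rescaledFlow_zero (H : IsRegularPerturbation X₀ X₁ R D ε₀) {t : ℝ} {q : E}
    (h : HasSolutionTo X₀ D t q) (s : ℝ) (ξ : E) :
    rescaledFlow X₀ X₁ R D ε₀ (t, s, q, ξ, 0) = fderiv ℝ (localFlow X₀ D t) q ξ +
        fderiv ℝ (localFlow X₀ D t) q (∫ s in (0 : ℝ)..t,
          (fderiv ℝ (localFlow X₀ D s) q).inverse (X₁ (localFlow X₀ D s q))) +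
        s • X₀ (localFlow X₀ D t q) := by
  simp only [rescaledFlow, zero_mul, add_zero]
  rw [(H.hasSolutionTo_blowupField h ξ).2]
  congr 2
  exact segmentIntegral_zero_right (fun w : ℝ × E => X₀ (localFlow X₀ D w.1 w.2)) (t, q)

theorem contDiffAt_rescaledFlow (H : IsRegularPerturbation X₀ X₁ R D ε₀) {t : ℝ} {q : E}
    (h : HasSolutionTo X₀ D t q) (s : ℝ) (ξ : E) :
    ContDiffAt ℝ 1 (rescaledFlow X₀ X₁ R D ε₀) (t, s, q, ξ, 0) := by
  have h1 : ContDiffAt ℝ 1 (blowupFlow X₀ X₁ R D ε₀) (t + 0 * s, q, ξ, 0) := by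
    rw [zero_mul, add_zero]
    exact contDiffAt_fst.comp _ (contDiffAt_snd.comp _ ((H.hasSolutionTo_blowupField h
      ξ).1.contDiffAt (isOpen_blowupDomain H.isOpen ε₀) H.contDiffOn_blowupField))
  have h2 : ContDiffOn ℝ 1 (fun w : ℝ × E => X₀ (localFlow X₀ D w.1 w.2)) (flowDomain X₀ D) :=
    H.contDiffOn_zero'.comp (contDiffOn_localFlow H.isOpen H.contDiffOn_zero') fun w hw =>
      HasSolutionTo.localFlow_mem H.isOpen H.contDiffOn_zero' hw
  have h3 : ContDiffAt ℝ 1 (segmentIntegral fun w : ℝ × E => X₀ (localFlow X₀ D w.1 w.2))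
      (((t, q), (0 * s, 0)) : (ℝ × E) × (ℝ × E)) :=
    contDiffAt_segmentIntegral (isOpen_flowDomain H.isOpen H.contDiffOn_zero') h2
      fun r _ => by simpa [flowDomain] using h
  refine ContDiffAt.add ?_ (ContDiffAt.smul (by fun_prop) ?_)
  · exact h1.comp (f := fun z : ℝ × ℝ × E × E × ℝ =>
      (z.1 + z.2.2.2.2 * z.2.1, z.2.2.1, z.2.2.2.1, z.2.2.2.2)) (t, s, q, ξ, 0) (by fun_prop)
  · exact h3.comp (f := fun z : ℝ × ℝ × E × E × ℝ =>
      ((z.1, z.2.2.1), (z.2.2.2.2 * z.2.1, (0 : E)))) (t, s, q, ξ, 0) (by fun_prop)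

/-- The increment is split at the point `φ₀(t + ε s, q)`. The change from there to the perturbed
solution is `ε` times the blown-up flow; the change of time contributes the integral of the velocity
`X₀` over a time interval of length `ε s`. -/
theorem eventually_localFlow_eq_add_rescaledFlow (H : IsRegularPerturbation X₀ X₁ R D ε₀)
    {t : ℝ} {q : E} (h : HasSolutionTo X₀ D t q) (s : ℝ) (ξ : E) :
    ∀ᶠ z in 𝓝 ((t, s, q, ξ, 0) : ℝ × ℝ × E × E × ℝ),
      localFlow (perturbedField X₀ X₁ R z.2.2.2.2) D (z.1 + z.2.2.2.2 * z.2.1)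
          (z.2.2.1 + z.2.2.2.2 • z.2.2.2.1) =
        localFlow X₀ D z.1 z.2.2.1 + z.2.2.2.2 • rescaledFlow X₀ X₁ R D ε₀ z := by
  have o1 := (isOpen_flowDomain (isOpen_blowupDomain H.isOpen ε₀)
    H.contDiffOn_blowupField).mem_nhds
    (x := ((t, (q, ξ, (0 : ℝ))) : ℝ × E × E × ℝ)) (H.hasSolutionTo_blowupField h ξ).1
  have c1 : Tendsto (fun z : ℝ × ℝ × E × E × ℝ =>
      (z.1 + z.2.2.2.2 * z.2.1, z.2.2.1, z.2.2.2.1, z.2.2.2.2)) (𝓝 (t, s, q, ξ, 0))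
      (𝓝 (t, q, ξ, 0)) :=
    Continuous.tendsto' (by fun_prop) _ _ (by simp)
  -- The velocity is integrated over all times between `t` and `t + ε s`, so the unperturbed
  -- solution is needed at each of them.
  have o2 : ∀ᶠ z in 𝓝 ((t, s, q, ξ, 0) : ℝ × ℝ × E × E × ℝ), ∀ r ∈ Icc (0 : ℝ) 1,
      HasSolutionTo X₀ D (z.1 + r * (z.2.2.2.2 * z.2.1)) z.2.2.1 := by
    refine isCompact_Icc.eventually_forall_of_forall_eventually fun r hr => ?_
    have c2 : Tendsto (fun w : (ℝ × ℝ × E × E × ℝ) × ℝ =>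
        (w.1.1 + w.2 * (w.1.2.2.2.2 * w.1.2.1), w.1.2.2.1)) (𝓝 ((t, s, q, ξ, 0), r))
        (𝓝 (t, q)) :=
      Continuous.tendsto' (by fun_prop) _ _ (by simp)
    exact c2.eventually ((isOpen_flowDomain H.isOpen H.contDiffOn_zero').mem_nhds h)
  filter_upwards [c1.eventually o1, o2] with z z1 z2
  rw [(H.localFlow_blowupField z1).2.2]
  have hd : ∀ r ∈ Icc (0 : ℝ) 1, HasDerivAt (fun t => localFlow X₀ D t z.2.2.1)
      ((fun t => X₀ (localFlow X₀ D t z.2.2.1)) (z.1 + r • (z.2.2.2.2 * z.2.1)))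
      (z.1 + r • (z.2.2.2.2 * z.2.1)) := fun r hr => by
    rw [smul_eq_mul]
    exact (z2 r hr).hasDerivAt H.isOpen H.contDiffOn_zero'
  have hcont : ContinuousOn (fun r : ℝ => (fun t => X₀ (localFlow X₀ D t z.2.2.1))
      (z.1 + r • (z.2.2.2.2 * z.2.1))) (Icc 0 1) := by
    refine (H.contDiffOn_zero'.continuousOn.comp (continuousOn_localFlow_left H.isOpen
      H.contDiffOn_zero' z.2.2.1) fun t ht => HasSolutionTo.localFlow_mem H.isOpen
        H.contDiffOn_zero' ht).comp (by fun_prop : Continuous fun r : ℝ =>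
        z.1 + r • (z.2.2.2.2 * z.2.1)).continuousOn fun r hr => ?_
    simpa using z2 r hr
  have key := intervalIntegral.integral_unitInterval_deriv_eq_sub
    (f' := fun t => X₀ (localFlow X₀ D t z.2.2.1)) (z₀ := z.1) (z₁ := z.2.2.2.2 * z.2.1) hcont hd
  rw [eq_sub_iff_add_eq] at key
  rw [← key, rescaledFlow, smul_add, segmentIntegral]
  simp only [Prod.smul_mk, Prod.mk_add_mk, smul_zero, add_zero, smul_smul, smul_eq_mul]
  abel

end IsRegularPerturbation

end RescaledFlow

/-! ### Stability of the first return. -/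

section FirstReturn

variable {Λ : Type*} [TopologicalSpace Λ]

theorem exists_pos_eventually_forall {P : ℝ × Λ → Prop} {T : ℝ} {l₀ : Λ}
    (h : ∀ᶠ z in 𝓝 (T, l₀), P z) :
    ∃ a > 0, ∀ᶠ l in 𝓝 l₀, ∀ t, |t - T| < a → P (t, l) := by
  rw [nhds_prod_eq, eventually_prod_iff] at h
  obtain ⟨p, hp, q, hq, hpq⟩ := h
  obtain ⟨a, ha, hball⟩ := Metric.eventually_nhds_iff.1 hp
  refine ⟨a, ha, hq.mono fun l hl t ht => hpq (hball ?_) hl⟩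
  rwa [Real.dist_eq]

/-- Stability of the first return to zero of a family of functions, under transversality at both
ends. -/
theorem exists_first_return {f f' : ℝ × Λ → ℝ} {l₀ : Λ} {T : ℝ} (hT : 0 < T)
    (hf : ∀ t ∈ Icc 0 T, ∀ᶠ z in 𝓝 (t, l₀), ContinuousAt f z ∧
      HasDerivAt (fun s => f (s, z.2)) (f' z) z.1)
    (hf' : ∀ t ∈ Icc 0 T, ContinuousAt f' (t, l₀))
    (hd0 : 0 < f' (0, l₀)) (hdT : f' (T, l₀) < 0) (hfT : f (T, l₀) = 0)
    (hpos : ∀ t ∈ Ioo 0 T, 0 < f (t, l₀)) {η : ℝ} (hη : 0 < η) :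
    ∃ r > 0, r < η ∧ r < T ∧ ∀ᶠ l in 𝓝 l₀, f (0, l) = 0 →
      (∀ t ∈ Ioc 0 (T - r), 0 < f (t, l)) ∧
      StrictAntiOn (fun t => f (t, l)) (Icc (T - r) (T + r)) ∧ f (T + r, l) < 0 := by
  have m0 : (0 : ℝ) ∈ Icc 0 T := ⟨le_rfl, hT.le⟩
  have mT : T ∈ Icc 0 T := ⟨hT.le, le_rfl⟩
  -- Near both ends the derivative keeps its sign, on time intervals whose lengths do not depend on
  -- the parameter. In between, `f` is bounded away from zero by compactness.
  obtain ⟨a, ha, hA⟩ := exists_pos_eventually_forall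
    ((hf 0 m0).and ((hf' 0 m0).eventually (lt_mem_nhds hd0)))
  obtain ⟨b, hb, hB⟩ := exists_pos_eventually_forall
    ((hf T mT).and ((hf' T mT).eventually (gt_mem_nhds hdT)))
  set r := min (min (η / 2) (T / 2)) (b / 2) with hr
  have hr0 : 0 < r := by positivity
  have hrη : r < η := by
    have : r ≤ η / 2 := (min_le_left _ _).trans (min_le_left _ _)
    linarith
  have hrT : r < T := by
    have : r ≤ T / 2 := (min_le_left _ _).trans (min_le_right _ _)
    linarith
  have hrb : r < b := by
    have : r ≤ b / 2 := min_le_right _ _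
    linarith
  have hanti : ∀ l, (∀ t, |t - T| < b → (ContinuousAt f (t, l) ∧
      HasDerivAt (fun s => f (s, l)) (f' (t, l)) t) ∧ f' (t, l) < 0) →
      StrictAntiOn (fun t => f (t, l)) (Icc (T - r) (T + r)) := by
    intro l hl
    have hm : ∀ t ∈ Icc (T - r) (T + r), |t - T| < b := fun t ht => by
      rw [abs_lt]; constructor <;> linarith [ht.1, ht.2]
    refine strictAntiOn_of_deriv_neg (convex_Icc _ _)
      (fun t ht => (hl t (hm t ht)).1.2.continuousAt.continuousWithinAt) fun t ht => ?_
    rw [interior_Icc] at ht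
    rw [(hl t (hm t (Ioo_subset_Icc_self ht))).1.2.deriv]
    exact (hl t (hm t (Ioo_subset_Icc_self ht))).2
  have hB0 := hB.self_of_nhds
  have hend : f (T + r, l₀) < 0 := by
    have := hanti l₀ hB0 ⟨by linarith, by linarith⟩ ⟨by linarith, le_rfl⟩
      (by linarith : T < T + r)
    simpa [hfT] using this
  have hcr : ContinuousAt f (T + r, l₀) := (hB0 (T + r) (by
    rw [add_sub_cancel_left, abs_of_pos hr0]; exact hrb)).1.1
  have hend' : ∀ᶠ l in 𝓝 l₀, f (T + r, l) < 0 :=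
    (hcr.tendsto.comp ((by fun_prop : Continuous fun l : Λ => (T + r, l)).tendsto l₀)).eventually
      (gt_mem_nhds hend)
  have hmid : ∀ᶠ l in 𝓝 l₀, ∀ t ∈ Icc (a / 2) (T - r), 0 < f (t, l) := by
    refine isCompact_Icc.eventually_forall_of_forall_eventually fun t ht => ?_
    have ht' : t ∈ Ioo 0 T := ⟨by linarith [ht.1], by linarith [ht.2]⟩
    have hc : ContinuousAt f (t, l₀) := (hf t (Ioo_subset_Icc_self ht')).self_of_nhds.1
    have hsw : Tendsto (Prod.swap : Λ × ℝ → ℝ × Λ) (𝓝 (l₀, t)) (𝓝 (t, l₀)) :=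
      continuous_swap.tendsto _
    exact (hc.tendsto.comp hsw).eventually (lt_mem_nhds (hpos t ht'))
  refine ⟨r, hr0, hrη, hrT, ?_⟩
  filter_upwards [hA, hB, hend', hmid] with l hl1 hl2 hl3 hl4 h0
  refine ⟨fun t ht => ?_, hanti l hl2, hl3⟩
  rcases le_total (a / 2) t with hta | hta
  · exact hl4 t ⟨hta, ht.2⟩
  -- Compactness is of no use here, as `f` vanishes at time `0`; positivity comes from strict growth
  -- starting at `f (0, l) = 0`.
  · have hm : ∀ t ∈ Icc 0 (a / 2), |t - 0| < a := fun t ht => by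
      rw [abs_lt]; constructor <;> linarith [ht.1, ht.2]
    have hmono : StrictMonoOn (fun t => f (t, l)) (Icc 0 (a / 2)) := by
      refine strictMonoOn_of_deriv_pos (convex_Icc _ _)
        (fun t ht => (hl1 t (hm t ht)).1.2.continuousAt.continuousWithinAt) fun t ht => ?_
      rw [interior_Icc] at ht
      rw [(hl1 t (hm t (Ioo_subset_Icc_self ht))).1.2.deriv]
      exact (hl1 t (hm t (Ioo_subset_Icc_self ht))).2
    have := hmono ⟨le_rfl, by positivity⟩ ⟨ht.1.le, hta⟩ ht.1
    simpa [h0] using this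

end FirstReturn

/-! ### Arcs and crossings of the piecewise smooth system. -/

namespace PWSystem

variable {n k : ℕ} {S : PWSystem n k} {ε₀ : ℝ}

theorem Regular.isRegularPerturbation (hS : S.Regular ε₀) (hε₀ : 0 < ε₀) (σ : Side) :
    IsRegularPerturbation (S.X₀ σ) (S.X₁ σ) (S.R σ) S.D ε₀ where
  pos := hε₀
  isOpen := hS.isOpen_D₁.prod (hS.isOpen_D₂.prod hS.isOpen_D₃)
  contDiffOn_zero := hS.contDiffOn_X₀ σ
  contDiffOn_one := hS.contDiffOn_X₁ σ
  contDiffOn_rem := hS.contDiffOn_R σ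

theorem Regular.isOpen_D (hS : S.Regular ε₀) : IsOpen S.D :=
  hS.isOpen_D₁.prod (hS.isOpen_D₂.prod hS.isOpen_D₃)

theorem Regular.contDiffOn_h (hS : S.Regular ε₀) : ContDiffOn ℝ 2 S.h S.D := by
  have h1 : ContDiffOn ℝ 2 (fun p : State n k => S.g (p.1, p.2.1)) S.D :=
    hS.contDiffOn_g.comp (f := fun p : State n k => (p.1, p.2.1)) (by fun_prop)
      fun p hp => ⟨hp.1, hp.2.1⟩
  exact (by fun_prop : ContDiff ℝ 2 fun p : State n k => p.2.2).contDiffOn.sub h1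

/-- The flow of the field with parameter `ε`, as a function of `(t, p, ε)`. -/
noncomputable def flowAt (S : PWSystem n k) (σ : Side) (z : ℝ × State n k × ℝ) : State n k :=
  localFlow (S.field z.2.2 σ) S.D z.1 z.2.1

theorem field_zero (σ : Side) : S.field 0 σ = S.X₀ σ :=
  IsRegularPerturbation.perturbedField_zero

theorem flowAt_zero (σ : Side) (t : ℝ) (p : State n k) : S.flowAt σ (t, p, 0) = S.flow₀ σ t p := by
  change localFlow (S.field 0 σ) S.D t p = _
  rw [field_zero]
  rfl

theorem flowAt_start (σ : Side) (p : State n k) (ε : ℝ) : S.flowAt σ (0, p, ε) = p :=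
  localFlow_zero p

theorem Regular.contDiffOn_field (hS : S.Regular ε₀) (hε₀ : 0 < ε₀) {ε : ℝ}
    (hε : ε ∈ Ioo (-ε₀) ε₀) (σ : Side) : ContDiffOn ℝ 1 (S.field ε σ) S.D :=
  (hS.isRegularPerturbation hε₀ σ).contDiffOn_perturbedField hε

theorem Regular.continuousAt_lie (hS : S.Regular ε₀) (hε₀ : 0 < ε₀) (σ : Side) {p : State n k}
    (hp : p ∈ S.D) {ε : ℝ} (hε : ε ∈ Ioo (-ε₀) ε₀) :
    ContinuousAt (fun l : State n k × ℝ => S.lie (S.field l.2 σ) l.1) (p, ε) := by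
  have H := hS.isRegularPerturbation hε₀ σ
  have h1 : ContinuousAt (fun l : State n k × ℝ => S.field l.2 σ l.1) (p, ε) :=
    (contDiff_fst.comp_contDiffOn H.contDiffOn_extendedField).continuousOn.continuousAt
      (H.isOpen_prod.mem_nhds (x := (p, ε)) ⟨hp, hε⟩)
  have h2 : ContinuousAt (fun l : State n k × ℝ => fderiv ℝ S.h l.1) (p, ε) :=
    ContinuousAt.comp (g := fderiv ℝ S.h) (f := Prod.fst)
      (((hS.contDiffOn_h.fderiv_of_isOpen hS.isOpen_D
        (m := 1) le_rfl).continuousOn).continuousAt (hS.isOpen_D.mem_nhds hp))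
      continuousAt_fst
  exact h2.clm_apply h1

theorem Regular.eventually_hasSolutionTo (hS : S.Regular ε₀) (hε₀ : 0 < ε₀) {σ : Side}
    {t ε : ℝ} {p : State n k} (hε : ε ∈ Ioo (-ε₀) ε₀)
    (h : HasSolutionTo (S.field ε σ) S.D t p) :
    ∀ᶠ z in 𝓝 ((t, p, ε) : ℝ × State n k × ℝ), z.2.2 ∈ Ioo (-ε₀) ε₀ ∧
      HasSolutionTo (S.field z.2.2 σ) S.D z.1 z.2.1 :=
  (hS.isRegularPerturbation hε₀ σ).eventually_hasSolutionTo hε h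

theorem Regular.contDiffAt_flowAt (hS : S.Regular ε₀) (hε₀ : 0 < ε₀) {σ : Side}
    {t ε : ℝ} {p : State n k} (hε : ε ∈ Ioo (-ε₀) ε₀)
    (h : HasSolutionTo (S.field ε σ) S.D t p) : ContDiffAt ℝ 1 (S.flowAt σ) (t, p, ε) :=
  (hS.isRegularPerturbation hε₀ σ).contDiffAt_localFlow hε h

theorem Regular.flowAt_mem (hS : S.Regular ε₀) (hε₀ : 0 < ε₀) {σ : Side}
    {t ε : ℝ} {p : State n k} (hε : ε ∈ Ioo (-ε₀) ε₀)
    (h : HasSolutionTo (S.field ε σ) S.D t p) : S.flowAt σ (t, p, ε) ∈ S.D :=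
  HasSolutionTo.localFlow_mem hS.isOpen_D (hS.contDiffOn_field hε₀ hε σ) h

theorem Regular.continuousAt_h_flowAt (hS : S.Regular ε₀) (hε₀ : 0 < ε₀) {σ : Side}
    {t ε : ℝ} {p : State n k} (hε : ε ∈ Ioo (-ε₀) ε₀)
    (h : HasSolutionTo (S.field ε σ) S.D t p) :
    ContinuousAt (fun z => S.h (S.flowAt σ z)) (t, p, ε) :=
  ContinuousAt.comp (g := S.h) (hS.contDiffOn_h.continuousOn.continuousAt
    (hS.isOpen_D.mem_nhds (hS.flowAt_mem hε₀ hε h)))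
    (hS.contDiffAt_flowAt hε₀ hε h).continuousAt

theorem Regular.hasDerivAt_h_flowAt (hS : S.Regular ε₀) (hε₀ : 0 < ε₀) {σ : Side}
    {t ε : ℝ} {p : State n k} (hε : ε ∈ Ioo (-ε₀) ε₀)
    (h : HasSolutionTo (S.field ε σ) S.D t p) :
    HasDerivAt (fun s => S.h (S.flowAt σ (s, p, ε)))
      (S.lie (S.field ε σ) (S.flowAt σ (t, p, ε))) t := by
  have h1 := ((hS.contDiffOn_h.differentiableOn two_ne_zero).differentiableAt
    (hS.isOpen_D.mem_nhds (hS.flowAt_mem hε₀ hε h))).hasFDerivAt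
  exact h1.comp_hasDerivAt t (h.hasDerivAt hS.isOpen_D (hS.contDiffOn_field hε₀ hε σ))

/-- The time direction in which an orbit starting on the switching manifold enters a zone. -/
def _root_.Side.sign : Side → ℝ
  | .plus => 1
  | .minus => -1

theorem _root_.Side.sign_mul_sign (σ : Side) : σ.sign * σ.sign = 1 := by
  cases σ <;> simp [Side.sign]

theorem _root_.Side.abs_sign (σ : Side) : |σ.sign| = 1 := by
  cases σ <;> simp [Side.sign]

/-- The unperturbed orbit of `p` in the zone `σ` starts and ends transversally on the switching
manifold after time `T` (counted backwards in the zone `minus`), and stays in the zone between. -/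
structure TransversalArc (S : PWSystem n k) (σ : Side) (p : State n k) (T : ℝ) : Prop where
  pos : 0 < T
  defined : HasSolutionTo (S.X₀ σ) S.D (σ.sign * T) p
  lie_start : 0 < S.lie (S.X₀ σ) p
  inside : ∀ t ∈ Ioo 0 T, 0 < σ.sign * S.h (S.flow₀ σ (σ.sign * t) p)
  h_end : S.h (S.flow₀ σ (σ.sign * T) p) = 0
  lie_end : S.lie (S.X₀ σ) (S.flow₀ σ (σ.sign * T) p) < 0

theorem sign_mul_mem_uIcc (σ : Side) {t T : ℝ} (ht : t ∈ Icc 0 T) :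
    σ.sign * t ∈ uIcc 0 (σ.sign * T) := by
  cases σ
  · simpa [Side.sign, uIcc_of_le (ht.1.trans ht.2)] using ht
  · simp only [Side.sign, neg_mul, one_mul]
    rw [uIcc_of_ge (by linarith [ht.1, ht.2])]
    exact ⟨by linarith [ht.2], by linarith [ht.1]⟩

/-- The first conclusion serves uniqueness: a nearby arc that returns to the manifold for the first
time does so at a time near `T`. The second serves existence: an arc that is on the manifold at a
time near `T` has not left its zone before. Both zones are treated at once: the function `t ↦ sign *
h(φ(sign * t))` has derivative `Xh`, as the sign appears twice, so `exists_first_return` applies. -/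
theorem TransversalArc.exists_nhds {σ : Side} {p : State n k} {T : ℝ}
    (A : S.TransversalArc σ p T) (hS : S.Regular ε₀) (hε₀ : 0 < ε₀) {η : ℝ} (hη : 0 < η) :
    ∃ r > 0, r < η ∧ r < T ∧ ∀ᶠ l : State n k × ℝ in 𝓝 (p, 0), l.2 ∈ Ioo (-ε₀) ε₀ ∧
      HasSolutionTo (S.field l.2 σ) S.D (σ.sign * (T + r)) l.1 ∧ (S.h l.1 = 0 →
        (∀ t₁ > 0, ∀ γ : ℝ → State n k, γ 0 = l.1 →
          IsSolutionOn (S.field l.2 σ) S.D γ (uIcc 0 (σ.sign * t₁)) →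
          (∀ t ∈ Ioo 0 t₁, 0 < σ.sign * S.h (γ (σ.sign * t))) → S.h (γ (σ.sign * t₁)) = 0 →
          |t₁ - T| < η) ∧
        ∀ t₁, |t₁ - T| ≤ r → S.h (S.flowAt σ (σ.sign * t₁, l)) = 0 →
          ∀ t ∈ Ioo 0 t₁, 0 < σ.sign * S.h (S.flowAt σ (σ.sign * t, l))) := by
  have hz : (0 : ℝ) ∈ Ioo (-ε₀) ε₀ := (hS.isRegularPerturbation hε₀ σ).zero_mem
  have hTne : 0 < T := A.pos
  have hdef : ∀ t ∈ Icc 0 T, HasSolutionTo (S.field 0 σ) S.D (σ.sign * t) p := fun t ht => by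
    rw [field_zero]
    exact A.defined.mono (sign_mul_mem_uIcc σ ht)
  have hcont : ∀ z : ℝ × State n k × ℝ, Tendsto
      (fun w : ℝ × State n k × ℝ => (σ.sign * w.1, w.2)) (𝓝 z) (𝓝 (σ.sign * z.1, z.2)) :=
    fun z => Continuous.tendsto' (by fun_prop) _ _ rfl
  have hev : ∀ t ∈ Icc 0 T, ∀ᶠ z in 𝓝 ((t, p, 0) : ℝ × State n k × ℝ), z.2.2 ∈ Ioo (-ε₀) ε₀ ∧
      HasSolutionTo (S.field z.2.2 σ) S.D (σ.sign * z.1) z.2.1 := fun t ht =>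
    (hcont (t, p, 0)).eventually (hS.eventually_hasSolutionTo hε₀ hz (hdef t ht))
  let f : ℝ × State n k × ℝ → ℝ := fun z => σ.sign * S.h (S.flowAt σ (σ.sign * z.1, z.2))
  let f' : ℝ × State n k × ℝ → ℝ := fun z =>
    S.lie (S.field z.2.2 σ) (S.flowAt σ (σ.sign * z.1, z.2))
  obtain ⟨a, ha, hA⟩ := exists_pos_eventually_forall (hev T ⟨hTne.le, le_rfl⟩)
  have hf : ∀ t ∈ Icc 0 T, ∀ᶠ z in 𝓝 ((t, p, 0) : ℝ × State n k × ℝ), ContinuousAt f z ∧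
      HasDerivAt (fun s => f (s, z.2)) (f' z) z.1 := fun t ht => by
    filter_upwards [hev t ht] with z hz
    constructor
    · refine continuousAt_const.mul ?_
      exact ContinuousAt.comp (g := fun z => S.h (S.flowAt σ z))
        (f := fun w : ℝ × State n k × ℝ => (σ.sign * w.1, w.2))
        (hS.continuousAt_h_flowAt hε₀ hz.1 hz.2) (hcont z)
    · have h1 := hS.hasDerivAt_h_flowAt hε₀ hz.1 hz.2
      have h2 : HasDerivAt (fun s : ℝ => σ.sign * s) σ.sign z.1 := by
        simpa using (hasDerivAt_id z.1).const_mul σ.sign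
      refine ((h1.comp z.1 h2).const_mul σ.sign).congr_deriv ?_
      change σ.sign * (f' z * σ.sign) = f' z
      rw [mul_comm (f' z), ← mul_assoc, σ.sign_mul_sign, one_mul]
  have hf' : ∀ t ∈ Icc 0 T, ContinuousAt f' (t, p, 0) := fun t ht => by
    have h1 := hS.contDiffAt_flowAt hε₀ hz (hdef t ht)
    have h2 : ContinuousAt (fun w : ℝ × State n k × ℝ =>
        (S.flowAt σ (σ.sign * w.1, w.2), w.2.2)) (t, p, 0) :=
      ContinuousAt.prodMk (ContinuousAt.comp (g := S.flowAt σ)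
        (f := fun w : ℝ × State n k × ℝ => (σ.sign * w.1, w.2)) h1.continuousAt
        (hcont (t, p, 0))) (by fun_prop)
    exact ContinuousAt.comp (g := fun l : State n k × ℝ => S.lie (S.field l.2 σ) l.1)
      (f := fun w : ℝ × State n k × ℝ => (S.flowAt σ (σ.sign * w.1, w.2), w.2.2)) (hS.continuousAt_lie hε₀ σ (hS.flowAt_mem hε₀ hz (hdef t ht)) hz) h2
  obtain ⟨r, hr0, hrη, hrT, hev2⟩ := exists_first_return (f := f) (f' := f') hTne hf hf'
    (by simpa [f', flowAt_start, field_zero] using A.lie_start)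
    (by simpa [f', flowAt_zero, field_zero] using A.lie_end)
    (by simpa [f, flowAt_zero] using Or.inr A.h_end)
    (fun t ht => by simpa [f, flowAt_zero] using A.inside t ht) (lt_min hη ha)
  refine ⟨r, hr0, hrη.trans_le (min_le_left _ _), hrT, ?_⟩
  filter_upwards [hev2, hA] with l hl1 hl2
  obtain ⟨hε, hsol⟩ := hl2 (T + r) (by
    rw [add_sub_cancel_left, abs_of_pos hr0]; exact hrη.trans_le (min_le_right _ _))
  refine ⟨hε, hsol, fun h0 => ?_⟩
  obtain ⟨k1, k2, k3⟩ := hl1 (by simp [f, flowAt, localFlow_zero, h0])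
  refine ⟨fun t₁ ht₁ γ hγ0 hγ hpos hend => ?_, fun t₁ ht₁ hend t ht => ?_⟩
  · have hγf : ∀ t ∈ Icc 0 t₁, f (t, l) = σ.sign * S.h (γ (σ.sign * t)) := fun t ht => by
      have := localFlow_eq hS.isOpen_D (hS.contDiffOn_field hε₀ hε σ) hγ0 hγ.1 hγ.2
        (sign_mul_mem_uIcc σ ht)
      simp only [f, flowAt]
      rw [this]
    -- At `T + r` the function `f` is negative, so the arc cannot still be in its zone or just
    -- ending; up to `T - r` it is positive, so the arc cannot have ended.
    have hlt : t₁ < T + r := by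
      by_contra! hge
      have h1 := hγf (T + r) ⟨by linarith, hge⟩
      rcases eq_or_lt_of_le hge with heq | hlt
      · rw [heq, hend, mul_zero] at h1
        rw [heq] at k3
        linarith
      · have := hpos (T + r) ⟨by linarith, hlt⟩
        linarith
    have hgt : T - r < t₁ := by
      by_contra! hle
      have h1 := hγf t₁ ⟨ht₁.le, le_rfl⟩
      have h2 := k1 t₁ ⟨ht₁, hle⟩
      rw [hend, mul_zero] at h1
      linarith
    have : r < η := hrη.trans_le (min_le_left _ _)
    rw [abs_lt]
    constructor <;> linarith
  · rw [abs_le] at ht₁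
    rcases le_total t (T - r) with h | h
    · exact k1 t ⟨ht.1, h⟩
    · have h1 := k2 (a := t) (b := t₁) ⟨h, by linarith [ht.2]⟩ ⟨by linarith, by linarith⟩ ht.2
      have h2 : f (t₁, l) = 0 := by simp [f, hend]
      simp only [h2] at h1
      exact h1

/-- Along the unperturbed orbit of `p` the function `h` changes sign with positive speed; its signs
at `±η` persist for nearby data. Hence a nearby orbit cannot remain in one zone for the time `η` in
the direction in which it approaches the manifold. -/
theorem Regular.exists_crossing_flow (hS : S.Regular ε₀) (hε₀ : 0 < ε₀) (σ : Side)
    {p : State n k} (hp : p ∈ S.D) (hh : S.h p = 0) (hlie : 0 < S.lie (S.X₀ σ) p)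
    {N : Set (State n k)} (hN : N ∈ 𝓝 p) :
    ∃ η > 0, ∀ᶠ l : State n k × ℝ in 𝓝 (p, 0), l.2 ∈ Ioo (-ε₀) ε₀ ∧
      (∀ t, |t| ≤ η → HasSolutionTo (S.field l.2 σ) S.D t l.1 ∧ S.flowAt σ (t, l) ∈ N) ∧
      S.h (S.flowAt σ (-η, l)) < 0 ∧ 0 < S.h (S.flowAt σ (η, l)) := by
  have hz : (0 : ℝ) ∈ Ioo (-ε₀) ε₀ := (hS.isRegularPerturbation hε₀ σ).zero_mem
  have h0 : HasSolutionTo (S.field 0 σ) S.D 0 p := hasSolutionTo_zero hp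
  have hN' : ∀ᶠ z in 𝓝 ((0, p, 0) : ℝ × State n k × ℝ), S.flowAt σ z ∈ N :=
    (hS.contDiffAt_flowAt hε₀ hz h0).continuousAt.eventually (by rwa [flowAt_start])
  obtain ⟨a, ha, hA⟩ := exists_pos_eventually_forall
    ((hS.eventually_hasSolutionTo hε₀ hz h0).and hN')
  simp only [sub_zero] at hA
  have hd := hS.hasDerivAt_h_flowAt hε₀ hz h0
  rw [flowAt_start, field_zero] at hd
  have hsgn := (hasDerivAt_iff_tendsto_slope.1 hd).eventually (lt_mem_nhds hlie)
  obtain ⟨b, hb, hB⟩ := Metric.mem_nhdsWithin_iff.1 hsgn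
  set η := min (a / 2) (b / 2) with hηdef
  have hη : 0 < η := by positivity
  have hηa : η < a := by
    have : η ≤ a / 2 := min_le_left _ _
    linarith
  have hηb : η < b := by
    have : η ≤ b / 2 := min_le_right _ _
    linarith
  have hsol := hA.self_of_nhds
  have hp0 : S.h (S.flowAt σ (0, p, 0)) = 0 := by rw [flowAt_start, hh]
  have e1 : 0 < S.h (S.flowAt σ (η, p, 0)) := by
    have : 0 < slope (fun s => S.h (S.flowAt σ (s, p, 0))) 0 η :=
      hB ⟨by simpa [abs_of_pos hη] using hηb, hη.ne'⟩
    rw [slope_def_field, hp0, sub_zero, sub_zero] at this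
    exact (div_pos_iff_of_pos_right hη).1 this
  have e2 : S.h (S.flowAt σ (-η, p, 0)) < 0 := by
    have : 0 < slope (fun s => S.h (S.flowAt σ (s, p, 0))) 0 (-η) :=
      hB ⟨by simpa [abs_of_pos hη] using hηb, by simpa using hη.ne'⟩
    rw [slope_def_field, hp0, sub_zero, sub_zero] at this
    by_contra! hge
    exact absurd this (not_lt.2 (div_nonpos_of_nonneg_of_nonpos hge (by linarith)))
  have hce : ∀ t, |t| < a → Tendsto (fun l : State n k × ℝ => S.h (S.flowAt σ (t, l)))
      (𝓝 (p, 0)) (𝓝 (S.h (S.flowAt σ (t, p, 0)))) := fun t ht =>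
    (hS.continuousAt_h_flowAt hε₀ hz (hsol t ht).1.2).tendsto.comp
      ((by fun_prop : Continuous fun l : State n k × ℝ => (t, l)).tendsto (p, 0))
  refine ⟨η, hη, ?_⟩
  filter_upwards [hA, (hce η (by rwa [abs_of_pos hη])).eventually (lt_mem_nhds e1),
    (hce (-η) (by rwa [abs_neg, abs_of_pos hη])).eventually (gt_mem_nhds e2)] with l l1 l2 l3
  exact ⟨(l1 0 (by simpa using ha)).1.1, fun t ht =>
    ⟨(l1 t (ht.trans_lt hηa)).1.2, (l1 t (ht.trans_lt hηa)).2⟩, l3, l2⟩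

/-- A crossing periodic solution with the crossing times made explicit. -/
def CrossingAt (S : PWSystem n k) (ε : ℝ) (φ : ℝ → State n k) (t₀ t₁ t₂ : ℝ) : Prop :=
  t₀ < t₁ ∧ t₁ < t₂ ∧ Function.Periodic φ (t₂ - t₀) ∧
    IsSolutionOn (S.field ε .plus) S.D φ (Icc t₀ t₁) ∧
    IsSolutionOn (S.field ε .minus) S.D φ (Icc t₁ t₂) ∧
    S.h (φ t₀) = 0 ∧ S.h (φ t₁) = 0 ∧
    (∀ t ∈ Ioo t₀ t₁, 0 < S.h (φ t)) ∧ (∀ t ∈ Ioo t₁ t₂, S.h (φ t) < 0) ∧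
    (∀ σ, 0 < S.lie (S.field ε σ) (φ t₀)) ∧ (∀ σ, S.lie (S.field ε σ) (φ t₁) < 0)

theorem _root_.IsSolutionOn.comp_add {X : State n k → State n k} {D : Set (State n k)}
    {γ : ℝ → State n k} {a b : ℝ} (h : IsSolutionOn X D γ (Icc a b)) (c : ℝ) :
    IsSolutionOn X D (fun t => γ (t + c)) (Icc (a - c) (b - c)) := by
  have hm : ∀ t ∈ Icc (a - c) (b - c), t + c ∈ Icc a b := fun t ht =>
    ⟨by linarith [ht.1], by linarith [ht.2]⟩
  refine ⟨fun t ht => ?_, fun t ht => h.2 _ (hm t ht)⟩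
  have := HasDerivWithinAt.scomp (g₁ := γ) (h := fun s => s + c) (s := Icc (a - c) (b - c)) t
    (h.1 (t + c) (hm t ht)) ((hasDerivAt_id t).add_const c).hasDerivWithinAt hm
  simpa [Function.comp_def] using this

theorem CrossingAt.comp_add {ε : ℝ} {φ : ℝ → State n k} {t₀ t₁ t₂ : ℝ}
    (h : S.CrossingAt ε φ t₀ t₁ t₂) (c : ℝ) :
    S.CrossingAt ε (fun t => φ (t + c)) (t₀ - c) (t₁ - c) (t₂ - c) := by
  obtain ⟨h1, h2, h3, h4, h5, h6, h7, h8, h9, h10, h11⟩ := h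
  refine ⟨by linarith, by linarith, fun t => ?_, h4.comp_add c, h5.comp_add c, by simpa using h6,
    by simpa using h7, fun t ht => h8 _ ⟨by linarith [ht.1], by linarith [ht.2]⟩,
    fun t ht => h9 _ ⟨by linarith [ht.1], by linarith [ht.2]⟩, by simpa using h10,
    by simpa using h11⟩
  refine Eq.trans ?_ (h3 (t + c))
  change φ _ = φ _
  congr 1
  ring

/-- Time `0` may lie inside an arc. On the upper arc the orbit is followed backwards, on the lower
one forwards; by `exists_crossing_flow` the upward crossing is met within a short time, without
leaving `N`. -/
theorem Regular.exists_crossing_near (hS : S.Regular ε₀) (hε₀ : 0 < ε₀)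
    {p : State n k} (hp : p ∈ S.D) (hh : S.h p = 0) (hlie : ∀ σ, 0 < S.lie (S.X₀ σ) p)
    {N : Set (State n k)} (hN : N ∈ 𝓝 p) :
    ∀ᶠ l : State n k × ℝ in 𝓝 (p, 0), ∀ ψ : ℝ → State n k, ψ 0 = l.1 →
      S.IsCrossingPeriodicSolution l.2 ψ → ∃ t₀ t₁ t₂, S.CrossingAt l.2 ψ t₀ t₁ t₂ ∧ ψ t₀ ∈ N ∧
        (ψ 0 ∈ S.switching → t₀ = 0) := by
  have hz : (0 : ℝ) ∈ Ioo (-ε₀) ε₀ := (hS.isRegularPerturbation hε₀ .plus).zero_mem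
  obtain ⟨η₁, hη₁, ev1⟩ := hS.exists_crossing_flow hε₀ .plus hp hh (hlie _) hN
  obtain ⟨η₂, hη₂, ev2⟩ := hS.exists_crossing_flow hε₀ .minus hp hh (hlie _) hN
  have ev3 : ∀ᶠ l : State n k × ℝ in 𝓝 (p, 0), 0 < S.lie (S.field l.2 .plus) l.1 :=
    (hS.continuousAt_lie hε₀ .plus hp hz).eventually
      (lt_mem_nhds (by simpa [field_zero] using hlie .plus))
  have ev4 : ∀ᶠ l : State n k × ℝ in 𝓝 (p, 0), l.1 ∈ N := continuousAt_fst.eventually hN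
  filter_upwards [ev1, ev2, ev3, ev4] with l l1 l2 l3 l4 ψ hψ0 hψ
  obtain ⟨s₀, s₁, s₂, hs⟩ := hψ
  -- The crossing times are shifted by a multiple of the period so that time `0` lies in `[t₀, t₂)`.
  obtain ⟨t₀, t₁, t₂, ht, h0, h2⟩ : ∃ t₀ t₁ t₂, S.CrossingAt l.2 ψ t₀ t₁ t₂ ∧ t₀ ≤ 0 ∧ 0 < t₂ := by
    have hT : 0 < s₂ - s₀ := by linarith [hs.1, hs.2.1]
    obtain ⟨j, hj, -⟩ := existsUnique_add_zsmul_mem_Ico hT 0 s₀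
    have hc := CrossingAt.comp_add hs (j • (s₂ - s₀))
    have hper : (fun t => ψ (t + j • (s₂ - s₀))) = ψ := funext fun t => hs.2.2.1.zsmul j t
    rw [hper] at hc
    refine ⟨_, _, _, hc, ?_, ?_⟩
    · linarith [hj.1]
    · linarith [hj.2]
  obtain ⟨c1, c2, c3, c4, c5, c6, c7, c8, c9, c10, c11⟩ := id ht
  refine ⟨t₀, t₁, t₂, ht, ?_⟩
  have hN0 : ψ t₂ = ψ t₀ := by
    have := c3 t₀
    rwa [add_sub_cancel] at this
  rcases eq_or_lt_of_le h0 with h0 | h0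
  · subst h0
    exact ⟨hψ0 ▸ l4, fun _ => rfl⟩
  rcases lt_trichotomy 0 t₁ with h1 | h1 | h1
  · -- the time `0` lies inside the upper arc
    have hpos : 0 < S.h (ψ 0) := c8 0 ⟨h0, h1⟩
    have hsub : uIcc 0 t₀ ⊆ Icc t₀ t₁ := by
      rw [uIcc_of_ge h0.le]
      exact Icc_subset_Icc_right h1.le
    have hfl : ∀ t ∈ Icc t₀ 0, S.flowAt .plus (t, l) = ψ t := fun t ht =>
      localFlow_eq hS.isOpen_D (hS.contDiffOn_field hε₀ l1.1 .plus) hψ0 (c4.1.mono hsub)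
        (fun s hs => c4.2 s (hsub hs)) (by rwa [uIcc_of_ge h0.le])
    have hge : -η₁ ≤ t₀ := by
      by_contra! hlt
      have e1 := c8 (-η₁) ⟨hlt, by linarith⟩
      rw [← hfl (-η₁) ⟨hlt.le, by linarith⟩] at e1
      linarith [l1.2.2.1]
    refine ⟨?_, fun hsw => absurd hsw.2 hpos.ne'⟩
    rw [← hfl t₀ ⟨le_rfl, h0.le⟩]
    exact (l1.2.1 t₀ (by rw [abs_le]; constructor <;> linarith)).2
  -- Time `0` cannot be the downward crossing, since near `p` the field crosses upwards.
  · subst h1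
    exact absurd (c11 .plus) (not_lt.2 (by rw [hψ0]; exact l3.le))
  · have hneg : S.h (ψ 0) < 0 := c9 0 ⟨h1, h2⟩
    have hsub : uIcc 0 t₂ ⊆ Icc t₁ t₂ := by
      rw [uIcc_of_le h2.le]
      exact Icc_subset_Icc_left h1.le
    have hfl : ∀ t ∈ Icc 0 t₂, S.flowAt .minus (t, l) = ψ t := fun t ht =>
      localFlow_eq hS.isOpen_D (hS.contDiffOn_field hε₀ l2.1 .minus) hψ0 (c5.1.mono hsub)
        (fun s hs => c5.2 s (hsub hs)) (by rwa [uIcc_of_le h2.le])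
    have hge : t₂ ≤ η₂ := by
      by_contra! hlt
      have e1 := c9 η₂ ⟨by linarith, hlt⟩
      rw [← hfl η₂ ⟨by linarith, hlt.le⟩] at e1
      linarith [l2.2.2.2]
    refine ⟨?_, fun hsw => absurd hsw.2 hneg.ne⟩
    rw [← hN0, ← hfl t₂ ⟨h2.le, le_rfl⟩]
    exact (l2.2.1 t₂ (by rw [abs_le]; constructor <;> linarith)).2

end PWSystem

/-! ### The family of unperturbed periodic orbits and its crossing times. -/

namespace PWSystem

variable {n k : ℕ} {S : PWSystem n k} {ε₀ : ℝ}

/-- The point of the switching manifold over `(u, y)`. -/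
def graphPoint (S : PWSystem n k) (w : EuclideanSpace ℝ (Fin n) × EuclideanSpace ℝ (Fin k)) :
    State n k := (w.1, w.2, S.g w)

theorem h_graphPoint (w : EuclideanSpace ℝ (Fin n) × EuclideanSpace ℝ (Fin k)) :
    S.h (S.graphPoint w) = 0 := sub_self _

theorem eq_graphPoint_of_h_eq_zero {p : State n k} (hp : S.h p = 0) :
    p = S.graphPoint (p.1, p.2.1) :=
  Prod.ext rfl (Prod.ext rfl (sub_eq_zero.1 hp))

theorem Regular.graphPoint_mem (hS : S.Regular ε₀)
    {w : EuclideanSpace ℝ (Fin n) × EuclideanSpace ℝ (Fin k)} (hw : w ∈ S.D₁ ×ˢ S.D₂) :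
    S.graphPoint w ∈ S.D := ⟨hw.1, hw.2, hS.mapsTo_g hw⟩

theorem Regular.contDiffAt_g (hS : S.Regular ε₀)
    {w : EuclideanSpace ℝ (Fin n) × EuclideanSpace ℝ (Fin k)} (hw : w ∈ S.D₁ ×ˢ S.D₂) :
    ContDiffAt ℝ 2 S.g w :=
  hS.contDiffOn_g.contDiffAt ((hS.isOpen_D₁.prod hS.isOpen_D₂).mem_nhds hw)

theorem Regular.contDiffAt_graphPoint (hS : S.Regular ε₀)
    {w : EuclideanSpace ℝ (Fin n) × EuclideanSpace ℝ (Fin k)} (hw : w ∈ S.D₁ ×ˢ S.D₂) :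
    ContDiffAt ℝ 2 S.graphPoint w :=
  contDiffAt_fst.prodMk (contDiffAt_snd.prodMk (hS.contDiffAt_g hw))

theorem Regular.liftY_apply (hS : S.Regular ε₀)
    {w : EuclideanSpace ℝ (Fin n) × EuclideanSpace ℝ (Fin k)} (hw : w ∈ S.D₁ ×ˢ S.D₂)
    (y : EuclideanSpace ℝ (Fin k)) :
    S.liftY (S.graphPoint w) y = (0, y, fderiv ℝ S.g w (0, y)) := by
  have h1 : HasFDerivAt (fun y => S.g (w.1, y)) (fderiv ℝ S.g w ∘L .inr ℝ _ _) w.2 :=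
    HasFDerivAt.comp (g := S.g) (f := fun y => (w.1, y)) w.2
      ((hS.contDiffAt_g hw).differentiableAt two_ne_zero).hasFDerivAt
      (hasFDerivAt_prodMk_right w.1 w.2)
  simp [liftY, graphPoint, h1.fderiv]

theorem Regular.hasFDerivAt_graphPoint_right (hS : S.Regular ε₀)
    {w : EuclideanSpace ℝ (Fin n) × EuclideanSpace ℝ (Fin k)} (hw : w ∈ S.D₁ ×ˢ S.D₂) :
    HasFDerivAt (fun y => S.graphPoint (w.1, y)) (S.liftY (S.graphPoint w)) w.2 := by
  have h1 : HasFDerivAt (fun y => S.g (w.1, y)) (fderiv ℝ (fun y => S.g (w.1, y)) w.2) w.2 :=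
    (((hS.contDiffAt_g hw).comp (f := fun y => (w.1, y)) w.2
      (by fun_prop)).differentiableAt two_ne_zero).hasFDerivAt
  exact (hasFDerivAt_const w.1 w.2).prodMk ((hasFDerivAt_id w.2).prodMk h1)

/-- The hypotheses on the unperturbed system and the family of its periodic orbits. -/
structure MelnikovSetting (S : PWSystem n k) (ε₀ : ℝ) (V : Set (EuclideanSpace ℝ (Fin n)))
    (v : EuclideanSpace ℝ (Fin n) → EuclideanSpace ℝ (Fin k))
    (τ : Side → EuclideanSpace ℝ (Fin n) → ℝ) : Prop where
  pos : 0 < ε₀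
  regular : S.Regular ε₀
  isOpen : IsOpen V
  contDiffOn_v : ContDiffOn ℝ 2 v (closure V)
  mem : ∀ u ∈ closure V, u ∈ S.D₁ ∧ v u ∈ S.D₂
  family : S.CrossingFamily V v τ

namespace MelnikovSetting

variable {V : Set (EuclideanSpace ℝ (Fin n))}
  {v : EuclideanSpace ℝ (Fin n) → EuclideanSpace ℝ (Fin k)}
  {τ : Side → EuclideanSpace ℝ (Fin n) → ℝ} {u : EuclideanSpace ℝ (Fin n)}

theorem mem_prod (H : MelnikovSetting S ε₀ V v τ) (hu : u ∈ V) : (u, v u) ∈ S.D₁ ×ˢ S.D₂ :=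
  H.mem u (subset_closure hu)

theorem basePoint_mem (H : MelnikovSetting S ε₀ V v τ) (hu : u ∈ V) : S.basePoint v u ∈ S.D :=
  H.regular.graphPoint_mem (H.mem_prod hu)

theorem contDiffAt_v (H : MelnikovSetting S ε₀ V v τ) (hu : u ∈ V) : ContDiffAt ℝ 2 v u :=
  H.contDiffOn_v.contDiffAt (mem_of_superset (H.isOpen.mem_nhds hu) subset_closure)

theorem contDiffAt_basePoint (H : MelnikovSetting S ε₀ V v τ) (hu : u ∈ V) :
    ContDiffAt ℝ 2 (S.basePoint v) u :=
  (H.regular.contDiffAt_graphPoint (H.mem_prod hu)).comp (f := fun u => (u, v u)) u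
    (contDiffAt_id.prodMk (H.contDiffAt_v hu))

theorem hasSolutionTo (H : MelnikovSetting S ε₀ V v τ) (hu : u ∈ V) (σ : Side) :
    HasSolutionTo (S.X₀ σ) S.D (τ σ u) (S.basePoint v u) := H.family.defined u hu σ

theorem flow₀_eq (H : MelnikovSetting S ε₀ V v τ) (hu : u ∈ V) (σ : Side) :
    S.flow₀ σ (τ σ u) (S.basePoint v u) = S.flow₀ .plus (τ .plus u) (S.basePoint v u) := by
  cases σ
  · rfl
  · exact H.family.closes u hu

theorem contDiffOn_X₀ (H : MelnikovSetting S ε₀ V v τ) (σ : Side) :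
    ContDiffOn ℝ 1 (S.X₀ σ) S.D :=
  (H.regular.contDiffOn_X₀ σ).of_le (by norm_num)

theorem end_mem (H : MelnikovSetting S ε₀ V v τ) (hu : u ∈ V) :
    S.flow₀ .plus (τ .plus u) (S.basePoint v u) ∈ S.D :=
  (H.hasSolutionTo hu .plus).localFlow_mem H.regular.isOpen_D (H.contDiffOn_X₀ .plus)

/-- The end point is a limit of points with `h < 0` along the lower arc and of points with `h > 0`
along the upper one. -/
theorem h_end (H : MelnikovSetting S ε₀ V v τ) (hu : u ∈ V) :
    S.h (S.flow₀ .plus (τ .plus u) (S.basePoint v u)) = 0 := by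
  have hc : ∀ σ, ContinuousAt (fun t => S.h (S.flow₀ σ t (S.basePoint v u))) (τ σ u) := fun σ =>
    ContinuousAt.comp (g := S.h) (f := fun t => S.flow₀ σ t (S.basePoint v u))
      (H.regular.contDiffOn_h.continuousOn.continuousAt
        (H.regular.isOpen_D.mem_nhds (H.flow₀_eq hu σ ▸ H.end_mem hu)))
      ((H.hasSolutionTo hu σ).hasDerivAt H.regular.isOpen_D (H.contDiffOn_X₀ σ)).continuousAt
  apply le_antisymm
  · rw [← H.flow₀_eq hu .minus]
    have hlt := H.family.tau_neg u hu
    refine le_of_tendsto ((hc .minus).tendsto.mono_left (nhdsWithin_le_nhds (s := Ioi (τ .minus u)))) ?_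
    filter_upwards [Ioo_mem_nhdsGT hlt] with t ht using (H.family.below u hu t ht).le
  · have hlt := H.family.tau_pos u hu
    refine ge_of_tendsto ((hc .plus).tendsto.mono_left (nhdsWithin_le_nhds (s := Iio (τ .plus u)))) ?_
    filter_upwards [Ioo_mem_nhdsLT hlt] with t ht using (H.family.above u hu t ht).le

theorem lie_end (H : MelnikovSetting S ε₀ V v τ) (hu : u ∈ V) (σ : Side) :
    S.lie (S.X₀ σ) (S.flow₀ .plus (τ .plus u) (S.basePoint v u)) < 0 := by
  rw [← H.family.closes u hu]
  exact H.family.transversal_end u hu σ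

theorem lie_start (H : MelnikovSetting S ε₀ V v τ) (hu : u ∈ V) (σ : Side) :
    0 < S.lie (S.X₀ σ) (S.basePoint v u) := by
  have := H.family.transversal_start u hu σ
  rwa [show S.flow₀ .plus 0 (S.basePoint v u) = S.basePoint v u from localFlow_zero _] at this

theorem transversalArc (H : MelnikovSetting S ε₀ V v τ) (hu : u ∈ V) (σ : Side) :
    S.TransversalArc σ (S.basePoint v u) (σ.sign * τ σ u) := by
  have e : σ.sign * (σ.sign * τ σ u) = τ σ u := by rw [← mul_assoc, σ.sign_mul_sign, one_mul]
  refine ⟨?_, e.symm ▸ H.hasSolutionTo hu σ, H.lie_start hu σ, fun t ht => ?_, ?_, ?_⟩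
  · cases σ
    · simpa [Side.sign] using H.family.tau_pos u hu
    · simpa [Side.sign] using H.family.tau_neg u hu
  · cases σ
    · simp only [Side.sign, one_mul] at ht ⊢
      exact H.family.above u hu t ht
    · simp only [Side.sign, neg_mul, one_mul] at ht ⊢
      have := H.family.below u hu (-t) ⟨by linarith [ht.2], by linarith [ht.1]⟩
      linarith
  · rw [e, H.flow₀_eq hu, H.h_end hu]
  · rw [e, H.flow₀_eq hu]
    exact H.lie_end hu σ

/-- The function `τ` is given without regularity, but it is a first return time, and these are
stable: `TransversalArc.exists_nhds` is used at `ε = 0` with the orbits of neighbouring `u`. -/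
theorem continuousAt_tau (H : MelnikovSetting S ε₀ V v τ) (hu : u ∈ V) (σ : Side) :
    ContinuousAt (τ σ) u := by
  rw [Metric.continuousAt_iff']
  intro η hη
  obtain ⟨r, -, -, -, hr⟩ := (H.transversalArc hu σ).exists_nhds H.regular H.pos hη
  have hc : Tendsto (fun u => (S.basePoint v u, (0 : ℝ))) (𝓝 u) (𝓝 (S.basePoint v u, 0)) :=
    (H.contDiffAt_basePoint hu).continuousAt.prodMk continuousAt_const
  filter_upwards [hc.eventually hr, H.isOpen.mem_nhds hu] with w hw hwV
  have A := H.transversalArc hwV σ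
  have hsol := A.defined.isIntegralCurveOn H.regular.isOpen_D (H.contDiffOn_X₀ σ)
  have := (hw.2.2 (h_graphPoint _)).1 (σ.sign * τ σ w) A.pos
    (fun t => S.flow₀ σ t (S.basePoint v w)) (localFlow_zero _)
    (by simp only [field_zero]; exact hsol) A.inside A.h_end
  rw [← mul_sub, abs_mul, σ.abs_sign, one_mul] at this
  exact this

theorem hasFDerivAt_flow₀ (H : MelnikovSetting S ε₀ V v τ) {σ : Side} {t : ℝ} {p : State n k}
    (h : HasSolutionTo (S.X₀ σ) S.D t p) :
    HasFDerivAt (fun z : ℝ × State n k => S.flow₀ σ z.1 z.2)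
      ((ContinuousLinearMap.fst ℝ ℝ (State n k)).smulRight (S.X₀ σ (S.flow₀ σ t p)) +
        S.dflow₀ σ t p ∘L .snd ℝ ℝ (State n k)) (t, p) := by
  have h1 := ((h.contDiffAt H.regular.isOpen_D
    (H.contDiffOn_X₀ σ)).differentiableAt one_ne_zero).hasFDerivAt
  refine h1.congr_fderiv ?_
  have e1 := h.fderiv_eq_comp_inr H.regular.isOpen_D (H.contDiffOn_X₀ σ)
  have e2 : fderiv ℝ (fun z : ℝ × State n k => localFlow (S.X₀ σ) S.D z.1 z.2) (t, p) (1, 0) =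
      S.X₀ σ (S.flow₀ σ t p) := by
    have h2 := HasFDerivAt.comp_hasDerivAt (f := fun s : ℝ => (s, p)) t h1
      ((hasDerivAt_id t).prodMk (hasDerivAt_const t p))
    exact h2.unique (h.hasDerivAt H.regular.isOpen_D (H.contDiffOn_X₀ σ))
  refine ContinuousLinearMap.ext fun z => ?_
  have e3 : z = z.1 • ((1 : ℝ), (0 : State n k)) + (0, z.2) := by ext <;> simp
  conv_lhs => rw [e3]
  rw [map_add, map_smul, e2]
  have e4 : S.dflow₀ σ t p = _ := e1
  simp [e4]

/-- The equation `h(φ₀(t, p_u)) = 0` has a nonzero derivative in `t` by transversality. The implicit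
function theorem gives a C¹ solution, and continuity of `τ` identifies it with `τ`. -/
theorem contDiffAt_tau (H : MelnikovSetting S ε₀ V v τ) (hu : u ∈ V) (σ : Side) :
    ContDiffAt ℝ 1 (τ σ) u := by
  have hsol := H.hasSolutionTo hu σ
  have hq : S.flow₀ σ (τ σ u) (S.basePoint v u) ∈ S.D := H.flow₀_eq hu σ ▸ H.end_mem hu
  have hh : ContDiffAt ℝ 1 S.h (S.flow₀ σ (τ σ u) (S.basePoint v u)) :=
    (H.regular.contDiffOn_h.contDiffAt (H.regular.isOpen_D.mem_nhds hq)).of_le (by norm_num)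
  let F : EuclideanSpace ℝ (Fin n) × ℝ → ℝ := fun w =>
    S.h (S.flow₀ σ w.2 (S.basePoint v w.1))
  have hflow : ContDiffAt ℝ 1 (fun w : EuclideanSpace ℝ (Fin n) × ℝ =>
      S.flow₀ σ w.2 (S.basePoint v w.1)) (u, τ σ u) :=
    ContDiffAt.comp (g := fun z : ℝ × State n k => S.flow₀ σ z.1 z.2)
      (f := fun w : EuclideanSpace ℝ (Fin n) × ℝ => (w.2, S.basePoint v w.1)) (u, τ σ u)
      (hsol.contDiffAt H.regular.isOpen_D (H.contDiffOn_X₀ σ))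
      (contDiffAt_snd.prodMk (ContDiffAt.comp (g := S.basePoint v) (f := Prod.fst) (u, τ σ u)
        ((H.contDiffAt_basePoint hu).of_le (by norm_num)) contDiffAt_fst))
  have hF : ContDiffAt ℝ 1 F (u, τ σ u) :=
    ContDiffAt.comp (g := S.h) (f := fun w : EuclideanSpace ℝ (Fin n) × ℝ =>
      S.flow₀ σ w.2 (S.basePoint v w.1)) (u, τ σ u) hh hflow
  have hinv : (fderiv ℝ F (u, τ σ u) ∘L .inr ℝ (EuclideanSpace ℝ (Fin n)) ℝ).IsInvertible := by
    have h1 : HasFDerivAt (fun t => F (u, t))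
        (fderiv ℝ F (u, τ σ u) ∘L .inr ℝ (EuclideanSpace ℝ (Fin n)) ℝ) (τ σ u) :=
      HasFDerivAt.comp (g := F) (f := fun t => (u, t)) (τ σ u)
        (hF.differentiableAt one_ne_zero).hasFDerivAt (hasFDerivAt_prodMk_right u (τ σ u))
    have h2 : HasDerivAt (fun t => F (u, t))
        (S.lie (S.X₀ σ) (S.flow₀ σ (τ σ u) (S.basePoint v u))) (τ σ u) :=
      HasFDerivAt.comp_hasDerivAt (l := S.h) (f := fun t => S.flow₀ σ t (S.basePoint v u)) (τ σ u)
        (hh.differentiableAt one_ne_zero).hasFDerivAt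
        (hsol.hasDerivAt H.regular.isOpen_D (H.contDiffOn_X₀ σ))
    have hne : S.lie (S.X₀ σ) (S.flow₀ σ (τ σ u) (S.basePoint v u)) ≠ 0 := by
      rw [H.flow₀_eq hu]
      exact (H.lie_end hu σ).ne
    rw [h1.unique h2.hasFDerivAt]
    refine ⟨ContinuousLinearEquiv.unitsEquivAut ℝ (Units.mk0 _ hne), ?_⟩
    ext
    simp
  have hzero : F (u, τ σ u) = 0 := by
    simp only [F]
    rw [H.flow₀_eq hu, H.h_end hu]
  have hiff := hF.eventually_apply_eq_iff_implicitFunction one_ne_zero hinv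
  refine (hF.contDiffAt_implicitFunction one_ne_zero hinv).congr_of_eventuallyEq ?_
  have hc : Tendsto (fun w => (w, τ σ w)) (𝓝 u) (𝓝 (u, τ σ u)) :=
    continuousAt_id.prodMk (H.continuousAt_tau hu σ)
  filter_upwards [hc.eventually hiff, H.isOpen.mem_nhds hu] with w hw hwV
  refine (hw.1 ?_).symm
  rw [hzero]
  simp only [F]
  rw [H.flow₀_eq hwV, H.h_end hwV]

end MelnikovSetting

end PWSystem

/-! ### Lyapunov–Schmidt reduction. -/

theorem ContinuousLinearMap.isInvertible_of_injective {E : Type*} [NormedAddCommGroup E]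
    [NormedSpace ℝ E] [FiniteDimensional ℝ E] (L : E →L[ℝ] E) (hL : ∀ x, L x = 0 → x = 0) :
    L.IsInvertible := by
  have hi : Function.Injective (L : E →ₗ[ℝ] E) := (injective_iff_map_eq_zero _).2 hL
  refine ⟨(LinearEquiv.ofInjectiveEndo (L : E →ₗ[ℝ] E) hi).toContinuousLinearEquiv, ?_⟩
  ext x
  rfl

theorem ContinuousLinearMap.isInvertible_of_det_ne_zero {E : Type*} [NormedAddCommGroup E]
    [NormedSpace ℝ E] [FiniteDimensional ℝ E] {L : E →L[ℝ] E} (hL : L.det ≠ 0) :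
    L.IsInvertible :=
  ⟨L.toContinuousLinearEquivOfDetNeZero hL, L.coe_toContinuousLinearEquivOfDetNeZero hL⟩

/-- Lyapunov–Schmidt reduction in blown up coordinates: a simple zero `u₀` of the reduced function
`M` persists as a locally unique solution of `Θ = 0`, `Q = 0`, where `Ψ`, `P` are obtained from
`Θ`, `Q` by the substitution `z ↦ b u + ε z` and division by `ε`. -/
theorem exists_branch_of_simple_zero {U Z : Type*} [NormedAddCommGroup U] [NormedSpace ℝ U]
    [CompleteSpace U] [NormedAddCommGroup Z] [NormedSpace ℝ Z] [CompleteSpace Z]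
    {Ψ Θ : (U × ℝ) × Z → Z} {P Q : (U × ℝ) × Z → U} {M : U → U} {b : U → Z} {u₀ : U} {z₀ : Z}
    (hΨ : ContDiffAt ℝ 1 Ψ ((u₀, 0), z₀)) (hΨ0 : Ψ ((u₀, 0), z₀) = 0)
    (hΨi : (fderiv ℝ Ψ ((u₀, 0), z₀) ∘L .inr ℝ (U × ℝ) Z).IsInvertible)
    (hP : ContDiffAt ℝ 1 P ((u₀, 0), z₀))
    (hM : ∀ᶠ u in 𝓝 u₀, ∀ z, Ψ ((u, 0), z) = 0 → P ((u, 0), z) = M u)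
    (hM0 : M u₀ = 0) (hMi : (fderiv ℝ M u₀).IsInvertible)
    (hb : ContinuousAt b u₀)
    (hΘ : ContDiffAt ℝ 1 Θ ((u₀, 0), b u₀)) (hΘ0 : Θ ((u₀, 0), b u₀) = 0)
    (hΘi : (fderiv ℝ Θ ((u₀, 0), b u₀) ∘L .inr ℝ (U × ℝ) Z).IsInvertible)
    (hΨΘ : ∀ᶠ w in 𝓝 ((u₀, (0 : ℝ)), z₀), Ψ w = 0 →
      Θ (w.1, b w.1.1 + w.1.2 • w.2) = 0 ∧ Q (w.1, b w.1.1 + w.1.2 • w.2) = w.1.2 • P w) :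
    ∃ c : ℝ → U × Z, ContinuousAt c 0 ∧ c 0 = (u₀, b u₀) ∧
      (∀ᶠ ε in 𝓝 0, Θ (((c ε).1, ε), (c ε).2) = 0 ∧ Q (((c ε).1, ε), (c ε).2) = 0) ∧
      ∀ᶠ w in 𝓝 ((u₀, (0 : ℝ)), b u₀), w.1.2 ≠ 0 → Θ w = 0 → Q w = 0 →
        c w.1.2 = (w.1.1, w.2) := by
  -- `κ` solves `Ψ = 0` for the blown-up variable. Inserted into `P` it gives `G`, the bifurcation
  -- function already divided by `ε`, of class C¹ at `ε = 0`.
  set κ := hΨ.implicitFunction one_ne_zero hΨi with hκ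
  have κC : ContDiffAt ℝ 1 κ (u₀, 0) := hΨ.contDiffAt_implicitFunction one_ne_zero hΨi
  have κ0 : κ (u₀, 0) = z₀ := hΨ.implicitFunction_apply_self one_ne_zero hΨi
  have κeq : ∀ᶠ x in 𝓝 (u₀, (0 : ℝ)), Ψ (x, κ x) = 0 := by
    filter_upwards [hΨ.eventually_apply_implicitFunction one_ne_zero hΨi] with x hx
    rw [← hΨ0, ← hx]
  have κt : Tendsto (fun x => (x, κ x)) (𝓝 (u₀, (0 : ℝ))) (𝓝 ((u₀, 0), z₀)) := by
    have := continuousAt_id.prodMk κC.continuousAt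
    rwa [ContinuousAt, κ0] at this
  let G : ℝ × U → U := fun x => P ((x.2, x.1), κ (x.2, x.1))
  have GC : ContDiffAt ℝ 1 G (0, u₀) := by
    have h1 : ContDiffAt ℝ 1 (fun x : U × ℝ => P (x, κ x)) (u₀, 0) := by
      refine ContDiffAt.comp (g := P) (f := fun x : U × ℝ => (x, κ x)) (u₀, 0) ?_
        (contDiffAt_id.prodMk κC)
      rwa [κ0]
    exact ContDiffAt.comp (g := fun x : U × ℝ => P (x, κ x)) (f := fun x : ℝ × U => (x.2, x.1))
      (0, u₀) h1 (by fun_prop)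
  have hslice : Tendsto (fun u : U => (u, (0 : ℝ))) (𝓝 u₀) (𝓝 (u₀, 0)) :=
    (by fun_prop : Continuous fun u : U => (u, (0 : ℝ))).tendsto u₀
  have GM : (fun u => G (0, u)) =ᶠ[𝓝 u₀] M := by
    filter_upwards [hM, hslice.eventually κeq] with u h1 h2 using h1 _ h2
  -- No differentiability of `M` is assumed apart from this: near `u₀` it coincides with the C¹
  -- function `G (0, ·)`.
  have GMd : fderiv ℝ G (0, u₀) ∘L .inr ℝ ℝ U = fderiv ℝ M u₀ := by
    have h1 : HasFDerivAt (fun u => G (0, u)) (fderiv ℝ G (0, u₀) ∘L .inr ℝ ℝ U) u₀ :=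
      HasFDerivAt.comp (g := G) (f := fun u => ((0 : ℝ), u)) u₀
        (GC.differentiableAt one_ne_zero).hasFDerivAt (hasFDerivAt_prodMk_right 0 u₀)
    rw [← GM.fderiv_eq, h1.fderiv]
  have G0 : G (0, u₀) = 0 := GM.self_of_nhds.trans hM0
  have Gi : (fderiv ℝ G (0, u₀) ∘L .inr ℝ ℝ U).IsInvertible := GMd ▸ hMi
  set μ := GC.implicitFunction one_ne_zero Gi with hμ
  have μC : ContinuousAt μ 0 := (GC.contDiffAt_implicitFunction one_ne_zero Gi).continuousAt
  have μ0 : μ 0 = u₀ := GC.implicitFunction_apply_self one_ne_zero Gi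
  have μt : Tendsto (fun ε => (μ ε, ε)) (𝓝 0) (𝓝 (u₀, 0)) := by
    have := μC.prodMk (continuousAt_id (x := (0 : ℝ)))
    rwa [ContinuousAt, μ0] at this
  have resc : ∀ᶠ x in 𝓝 (u₀, (0 : ℝ)), Θ (x, b x.1 + x.2 • κ x) = 0 ∧
      Q (x, b x.1 + x.2 • κ x) = x.2 • P (x, κ x) := by
    filter_upwards [κt.eventually hΨΘ, κeq] with x h1 h2 using h1 h2
  have bt : ContinuousAt (fun x : U × ℝ => b x.1 + x.2 • κ x) (u₀, 0) :=
    (ContinuousAt.comp (g := b) (f := Prod.fst) hb continuousAt_fst).add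
      (continuousAt_snd.smul κC.continuousAt)
  have bt' : Tendsto (fun x : U × ℝ => (x, b x.1 + x.2 • κ x)) (𝓝 (u₀, 0))
      (𝓝 ((u₀, 0), b u₀)) := by
    have := continuousAt_id.prodMk bt
    simpa [ContinuousAt] using this
  refine ⟨fun ε => (μ ε, b (μ ε) + ε • κ (μ ε, ε)), ?_, ?_, ?_, ?_⟩
  · refine μC.prodMk ?_
    refine ContinuousAt.comp (g := fun x : U × ℝ => b x.1 + x.2 • κ x) (f := fun ε => (μ ε, ε))
      ?_ (μC.prodMk continuousAt_id)
    rwa [μ0]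
  · simp [μ0]
  · filter_upwards [μt.eventually resc, GC.eventually_apply_implicitFunction one_ne_zero Gi]
      with ε h1 h2
    refine ⟨h1.1, h1.2.trans ?_⟩
    have : P ((μ ε, ε), κ (μ ε, ε)) = 0 := h2.trans G0
    simp [this]
  · have pt : Tendsto (fun w : (U × ℝ) × Z => w.1) (𝓝 ((u₀, 0), b u₀)) (𝓝 (u₀, 0)) :=
      continuous_fst.tendsto _
    have st : Tendsto (fun w : (U × ℝ) × Z => (w.1.2, w.1.1)) (𝓝 ((u₀, 0), b u₀)) (𝓝 (0, u₀)) :=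
      (by fun_prop : Continuous fun w : (U × ℝ) × Z => (w.1.2, w.1.1)).tendsto _
    -- Uniqueness for `Θ = 0` holds in a neighbourhood independent of `ε`. Both the given `w.2` and
    -- `b u + ε κ` are solutions over the same `(u, ε)`, hence equal.
    have hiff := hΘ.eventually_apply_eq_iff_implicitFunction one_ne_zero hΘi
    filter_upwards [hiff, pt.eventually (bt'.eventually hiff), pt.eventually resc,
      st.eventually (GC.eventually_apply_eq_iff_implicitFunction one_ne_zero Gi)]
      with w h1 h2 h3 h4 hε hw hQ
    rw [hΘ0] at h1 h2
    have e1 : w.2 = b w.1.1 + w.1.2 • κ w.1 := (h1.1 hw).symm.trans (h2.1 h3.1)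
    have e2 : P (w.1, κ w.1) = 0 := by
      have := h3.2
      rw [← e1] at this
      -- Only here is `ε ≠ 0` needed; for `ε = 0` the equation `Q = 0` carries no information about
      -- `P`.
      exact (smul_eq_zero.1 (this.symm.trans hQ)).resolve_left hε
    have e3 : μ w.1.2 = w.1.1 := h4.1 (e2.trans G0.symm)
    simp only [e3]
    rw [e1]

/-- Near `(q, ξ, 0)` the segment from `q` to `q + ε ξ` stays in an open set containing `q`. -/
theorem eventually_segment_mem {E : Type*} [NormedAddCommGroup E] [NormedSpace ℝ E] {D : Set E}
    (hD : IsOpen D) {q : E} (hq : q ∈ D) (ξ : E) :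
    ∀ᶠ z in 𝓝 ((q, ξ, 0) : E × E × ℝ), ∀ r ∈ Icc (0 : ℝ) 1,
      z.1 + r • (z.2.2 • z.2.1) ∈ D := by
  obtain ⟨r, hr, hball⟩ := Metric.isOpen_iff.1 hD q hq
  have h1 : ∀ᶠ z in 𝓝 ((q, ξ, 0) : E × E × ℝ), z.1 ∈ Metric.ball q r :=
    continuousAt_fst.eventually (Metric.ball_mem_nhds q hr)
  have h2 : ∀ᶠ z in 𝓝 ((q, ξ, 0) : E × E × ℝ), z.1 + z.2.2 • z.2.1 ∈ Metric.ball q r := by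
    have : Continuous fun z : E × E × ℝ => z.1 + z.2.2 • z.2.1 := by fun_prop
    refine (this.tendsto' (q, ξ, 0) q (by simp)).eventually (Metric.ball_mem_nhds q hr)
  filter_upwards [h1, h2] with z hz1 hz2 s hs
  exact hball ((convex_ball q r).add_smul_mem hz1 hz2 hs)

/-! ### The closing equations and their blow-up. -/

namespace PWSystem

variable {n k : ℕ} {S : PWSystem n k} {ε₀ : ℝ}

/-- The coordinate of `(y, t₊, t₋)` that holds the crossing time of the zone `σ`. -/
def _root_.Side.timeProj (k : ℕ) : Side → (EuclideanSpace ℝ (Fin k) × ℝ × ℝ →L[ℝ] ℝ)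
  | .plus => (ContinuousLinearMap.fst ℝ ℝ ℝ).comp (ContinuousLinearMap.snd ℝ _ _)
  | .minus => (ContinuousLinearMap.snd ℝ ℝ ℝ).comp (ContinuousLinearMap.snd ℝ _ _)

/-- For `w = ((u, ε), (y, t₊, t₋))`, the point reached from `graphPoint (u, y)` after the time
`t₊` or `t₋` in the corresponding zone. -/
noncomputable def arrival (S : PWSystem n k) (σ : Side)
    (w : (EuclideanSpace ℝ (Fin n) × ℝ) × (EuclideanSpace ℝ (Fin k) × ℝ × ℝ)) : State n k :=
  S.flowAt σ (σ.timeProj k w.2, S.graphPoint (w.1.1, w.2.1), w.1.2)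

/-- Up to the first coordinate, the condition that both arcs end at one point of the switching
manifold. -/
noncomputable def closing (S : PWSystem n k)
    (w : (EuclideanSpace ℝ (Fin n) × ℝ) × (EuclideanSpace ℝ (Fin k) × ℝ × ℝ)) :
    EuclideanSpace ℝ (Fin k) × ℝ × ℝ :=
  ((S.arrival .plus w - S.arrival .minus w).2.1, S.h (S.arrival .plus w),
    S.h (S.arrival .minus w))

section

variable (S) (ε₀) (v : EuclideanSpace ℝ (Fin n) → EuclideanSpace ℝ (Fin k))
  (τ : Side → EuclideanSpace ℝ (Fin n) → ℝ)

/-- The second crossing point of the unperturbed orbit through `basePoint v u`. -/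
noncomputable def endPoint (u : EuclideanSpace ℝ (Fin n)) : State n k :=
  S.flow₀ .plus (τ .plus u) (S.basePoint v u)

/-- The vector `ξ` with `graphPoint (u, v u + ε y) = basePoint v u + ε ξ`. -/
noncomputable def initialDirection
    (x : EuclideanSpace ℝ (Fin n) × EuclideanSpace ℝ (Fin k) × ℝ) : State n k :=
  (0, x.2.1, quotientAlong S.g ((x.1, v x.1), (0, x.2.1), x.2.2))

/-- For `w = ((u, ε), (y, s₊, s₋))`, the vector `ζ` for which `endPoint u + ε ζ` is the arrival
point with initial point over `(u, v u + ε y)` and crossing times `τ u + ε s`. -/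
noncomputable def deviation (σ : Side)
    (w : (EuclideanSpace ℝ (Fin n) × ℝ) × (EuclideanSpace ℝ (Fin k) × ℝ × ℝ)) : State n k :=
  rescaledFlow (S.X₀ σ) (S.X₁ σ) (S.R σ) S.D ε₀ (τ σ w.1.1, σ.timeProj k w.2,
    S.basePoint v w.1.1, S.initialDirection v (w.1.1, w.2.1, w.1.2), w.1.2)

/-- The closing condition in the blown up coordinates. -/
noncomputable def blownClosing
    (w : (EuclideanSpace ℝ (Fin n) × ℝ) × (EuclideanSpace ℝ (Fin k) × ℝ × ℝ)) :
    EuclideanSpace ℝ (Fin k) × ℝ × ℝ :=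
  ((S.deviation ε₀ v τ .plus w - S.deviation ε₀ v τ .minus w).2.1,
    quotientAlong S.h (S.endPoint v τ w.1.1, S.deviation ε₀ v τ .plus w, w.1.2),
    quotientAlong S.h (S.endPoint v τ w.1.1, S.deviation ε₀ v τ .minus w, w.1.2))

/-- The derivative of the unperturbed arrival point with respect to `(y, t₊, t₋)`. -/
noncomputable def arrivalDeriv (u : EuclideanSpace ℝ (Fin n)) (σ : Side) :
    EuclideanSpace ℝ (Fin k) × ℝ × ℝ →L[ℝ] State n k :=
  (S.matY σ (τ σ u) (S.basePoint v u)).comp (ContinuousLinearMap.fst ℝ _ _) +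
    (σ.timeProj k).smulRight (S.X₀ σ (S.endPoint v τ u))

/-- The derivative of the unperturbed closing condition with respect to `(y, t₊, t₋)`. -/
noncomputable def closingDeriv (u : EuclideanSpace ℝ (Fin n)) :
    EuclideanSpace ℝ (Fin k) × ℝ × ℝ →L[ℝ] EuclideanSpace ℝ (Fin k) × ℝ × ℝ :=
  (((ContinuousLinearMap.fst ℝ _ _).comp (ContinuousLinearMap.snd ℝ _ _)).comp
    (S.arrivalDeriv v τ u .plus - S.arrivalDeriv v τ u .minus)).prod
    (((fderiv ℝ S.h (S.endPoint v τ u)).comp (S.arrivalDeriv v τ u .plus)).prod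
      ((fderiv ℝ S.h (S.endPoint v τ u)).comp (S.arrivalDeriv v τ u .minus)))

end

/-- The time shift `a` is determined by tangency to the manifold, and eliminating it projects along
`X₀` onto the kernel of `∇h`. This is the origin of the factor `Id - X₀ ∇h / X₀h` in `α` and `β`. -/
theorem proj_add_smul {σ : Side} {q w : State n k} {a : ℝ} (hne : S.lie (S.X₀ σ) q ≠ 0)
    (h0 : fderiv ℝ S.h q (w + a • S.X₀ σ q) = 0) : w + a • S.X₀ σ q = S.proj σ q w := by
  rw [map_add, map_smul, smul_eq_mul] at h0
  have h1 : (S.lie (S.X₀ σ) q)⁻¹ * fderiv ℝ S.h q w = -a := by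
    rw [inv_mul_eq_iff_eq_mul₀ hne, lie]
    linarith
  simp [proj, smul_smul, h1]

namespace MelnikovSetting

variable {V : Set (EuclideanSpace ℝ (Fin n))}
  {v : EuclideanSpace ℝ (Fin n) → EuclideanSpace ℝ (Fin k)}
  {τ : Side → EuclideanSpace ℝ (Fin n) → ℝ} {u : EuclideanSpace ℝ (Fin n)}

/-- Source and target have the same finite dimension, so a kernel vector is studied. The two
`h`-equations turn the arrivals into `β^± y`; then `Π₂ β y = 0` forces `y = 0`, and transversality
forces both times to vanish. -/
theorem closingDeriv_isInvertible (H : MelnikovSetting S ε₀ V v τ) (hu : u ∈ V)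
    (hdet : (S.beta₂ v τ u).det ≠ 0) : (S.closingDeriv v τ u).IsInvertible := by
  refine ContinuousLinearMap.isInvertible_of_injective _ fun z hz => ?_
  have hz1 : (S.arrivalDeriv v τ u .plus z - S.arrivalDeriv v τ u .minus z).2.1 = 0 :=
    congrArg Prod.fst hz
  have hz2 : ∀ σ, fderiv ℝ S.h (S.endPoint v τ u) (S.arrivalDeriv v τ u σ z) = 0 := by
    rintro (_ | _)
    · exact congrArg (fun x => x.2.1) hz
    · exact congrArg (fun x => x.2.2) hz
  have hA : ∀ σ, S.arrivalDeriv v τ u σ z = S.betaSide v τ u σ z.1 := fun σ => by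
    have h1 := proj_add_smul (w := S.matY σ (τ σ u) (S.basePoint v u) z.1)
      (a := σ.timeProj k z) (H.lie_end hu σ).ne (hz2 σ)
    simp only [betaSide, H.flow₀_eq hu σ]
    exact h1
  have hy : z.1 = 0 := by
    have h0 : S.beta₂ v τ u z.1 = 0 := by
      rw [hA, hA] at hz1
      exact hz1
    obtain ⟨e, he⟩ := ContinuousLinearMap.isInvertible_of_det_ne_zero hdet
    rw [← he] at h0
    simpa using h0
  have ht : ∀ σ : Side, σ.timeProj k z = 0 := fun σ => by
    have := hz2 σ
    simp only [arrivalDeriv, add_apply, ContinuousLinearMap.comp_apply,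
      ContinuousLinearMap.coe_fst', hy, map_zero, zero_add, ContinuousLinearMap.smulRight_apply,
      map_smul, smul_eq_mul] at this
    exact (mul_eq_zero.1 this).resolve_right (H.lie_end hu σ).ne
  exact Prod.ext hy (Prod.ext (ht .plus) (ht .minus))

theorem contDiffAt_endPoint (H : MelnikovSetting S ε₀ V v τ) (hu : u ∈ V) :
    ContDiffAt ℝ 1 (S.endPoint v τ) u :=
  ContDiffAt.comp (g := fun z : ℝ × State n k => S.flow₀ .plus z.1 z.2)
    (f := fun u => (τ .plus u, S.basePoint v u)) u
    ((H.hasSolutionTo hu .plus).contDiffAt H.regular.isOpen_D (H.contDiffOn_X₀ .plus))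
    ((H.contDiffAt_tau hu .plus).prodMk ((H.contDiffAt_basePoint hu).of_le (by norm_num)))

theorem contDiffAt_initialDirection (H : MelnikovSetting S ε₀ V v τ) (hu : u ∈ V)
    (y : EuclideanSpace ℝ (Fin k)) : ContDiffAt ℝ 1 (S.initialDirection v) (u, y, 0) := by
  have h1 : ContDiffAt ℝ 1 (fun x : EuclideanSpace ℝ (Fin n) × EuclideanSpace ℝ (Fin k) × ℝ =>
      v x.1) (u, y, 0) :=
    ContDiffAt.comp (g := v) (f := Prod.fst) (u, y, 0) ((H.contDiffAt_v hu).of_le (by norm_num))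
      contDiffAt_fst
  have h2 : ContDiffAt ℝ 1 (quotientAlong S.g) ((u, v u), (0, y), 0) :=
    contDiffAt_quotientAlong (H.regular.isOpen_D₁.prod H.regular.isOpen_D₂)
      H.regular.contDiffOn_g fun r _ => by simpa using H.mem_prod hu
  refine contDiffAt_const.prodMk (ContDiffAt.prodMk (by fun_prop) ?_)
  exact ContDiffAt.comp (g := quotientAlong S.g)
    (f := fun x : EuclideanSpace ℝ (Fin n) × EuclideanSpace ℝ (Fin k) × ℝ =>
      (((x.1, v x.1), (0, x.2.1), x.2.2) : (_ × _) × (_ × _) × ℝ)) (u, y, 0) h2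
    ((contDiffAt_fst.prodMk h1).prodMk (by fun_prop))

theorem initialDirection_zero (H : MelnikovSetting S ε₀ V v τ) (hu : u ∈ V)
    (y : EuclideanSpace ℝ (Fin k)) :
    S.initialDirection v (u, y, 0) = S.liftY (S.basePoint v u) y := by
  rw [initialDirection, quotientAlong_zero]
  exact (H.regular.liftY_apply (H.mem_prod hu) y).symm

theorem eventually_graphPoint_eq (H : MelnikovSetting S ε₀ V v τ) (hu : u ∈ V)
    (y : EuclideanSpace ℝ (Fin k)) :
    ∀ᶠ x in 𝓝 ((u, y, 0) : EuclideanSpace ℝ (Fin n) × EuclideanSpace ℝ (Fin k) × ℝ),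
      S.graphPoint (x.1, v x.1 + x.2.2 • x.2.1) =
        S.basePoint v x.1 + x.2.2 • S.initialDirection v x := by
  have hD := H.regular.isOpen_D₁.prod H.regular.isOpen_D₂
  have hc : ContinuousAt (fun x : EuclideanSpace ℝ (Fin n) × EuclideanSpace ℝ (Fin k) × ℝ =>
      (((x.1, v x.1), (0, x.2.1), x.2.2) : (_ × _) × (EuclideanSpace ℝ (Fin n) × _) × ℝ))
      (u, y, 0) :=
    (continuousAt_fst.prodMk (ContinuousAt.comp (g := v) (f := Prod.fst)
      (H.contDiffAt_v hu).continuousAt continuousAt_fst)).prodMk (by fun_prop)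
  filter_upwards [hc.eventually (eventually_segment_mem hD (H.mem_prod hu) (0, y))] with x hx
  have := apply_add_smul_eq (z := ((x.1, v x.1), (0, x.2.1), x.2.2)) hD
    (H.regular.contDiffOn_g.of_le (by norm_num)) hx
  simp only [Prod.smul_mk, smul_zero, Prod.mk_add_mk, add_zero] at this
  simp [graphPoint, basePoint, initialDirection, this]

theorem contDiffAt_deviation (H : MelnikovSetting S ε₀ V v τ) (hu : u ∈ V) (σ : Side)
    (z : EuclideanSpace ℝ (Fin k) × ℝ × ℝ) :
    ContDiffAt ℝ 1 (S.deviation ε₀ v τ σ) ((u, 0), z) := by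
  have h1 := (H.regular.isRegularPerturbation H.pos σ).contDiffAt_rescaledFlow
    (H.hasSolutionTo hu σ) (σ.timeProj k z) (S.initialDirection v (u, z.1, 0))
  have hu1 : ContDiffAt ℝ 1 (fun w : (EuclideanSpace ℝ (Fin n) × ℝ) ×
      (EuclideanSpace ℝ (Fin k) × ℝ × ℝ) => w.1.1) ((u, 0), z) := by fun_prop
  refine ContDiffAt.comp (f := fun w : (EuclideanSpace ℝ (Fin n) × ℝ) ×
      (EuclideanSpace ℝ (Fin k) × ℝ × ℝ) => (τ σ w.1.1, σ.timeProj k w.2, S.basePoint v w.1.1,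
      S.initialDirection v (w.1.1, w.2.1, w.1.2), w.1.2)) ((u, 0), z) h1 ?_
  refine ContDiffAt.prodMk ?_ (ContDiffAt.prodMk (by fun_prop) (ContDiffAt.prodMk ?_
    (ContDiffAt.prodMk ?_ (by fun_prop))))
  · exact ContDiffAt.comp (g := τ σ) ((u, (0 : ℝ)), z) (H.contDiffAt_tau hu σ) hu1
  · exact ContDiffAt.comp (g := S.basePoint v) ((u, (0 : ℝ)), z)
      ((H.contDiffAt_basePoint hu).of_le (by norm_num)) hu1
  · exact ContDiffAt.comp (g := S.initialDirection v) (f := fun w : (EuclideanSpace ℝ (Fin n) × ℝ) ×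
      (EuclideanSpace ℝ (Fin k) × ℝ × ℝ) => (w.1.1, w.2.1, w.1.2)) ((u, (0 : ℝ)), z)
      (H.contDiffAt_initialDirection hu z.1) (by fun_prop)

/-- At `ε = 0` the deviation is affine: its linear part is the derivative of the arrival point, its
constant part is `ω`. Hence the blown-up and the original equations have the same derivative. -/
theorem deviation_zero (H : MelnikovSetting S ε₀ V v τ) (hu : u ∈ V) (σ : Side)
    (z : EuclideanSpace ℝ (Fin k) × ℝ × ℝ) :
    S.deviation ε₀ v τ σ ((u, 0), z) =
      S.arrivalDeriv v τ u σ z + S.omega σ (τ σ u) (S.basePoint v u) := by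
  have h1 := (H.regular.isRegularPerturbation H.pos σ).rescaledFlow_zero
    (H.hasSolutionTo hu σ) (σ.timeProj k z) (S.initialDirection v (u, z.1, 0))
  have h2 : localFlow (S.X₀ σ) S.D (τ σ u) (S.basePoint v u) = S.endPoint v τ u := H.flow₀_eq hu σ
  rw [deviation, h1, h2, H.initialDirection_zero hu, add_right_comm]
  rfl

/-- The base point `endPoint` is common to both zones, so the difference of the two arrivals is `ε`
times the difference of the deviations. -/
theorem eventually_arrival_eq (H : MelnikovSetting S ε₀ V v τ) (hu : u ∈ V) (σ : Side)
    (z : EuclideanSpace ℝ (Fin k) × ℝ × ℝ) :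
    ∀ᶠ w in 𝓝 ((u, (0 : ℝ)), z), S.arrival σ (w.1,
        (v w.1.1, τ .plus w.1.1, τ .minus w.1.1) + w.1.2 • w.2) =
      S.endPoint v τ w.1.1 + w.1.2 • S.deviation ε₀ v τ σ w := by
  have h1 := (H.regular.isRegularPerturbation H.pos σ).eventually_localFlow_eq_add_rescaledFlow
    (H.hasSolutionTo hu σ) (σ.timeProj k z) (S.initialDirection v (u, z.1, 0))
  have hu1 : ContinuousAt (fun w : (EuclideanSpace ℝ (Fin n) × ℝ) ×
      (EuclideanSpace ℝ (Fin k) × ℝ × ℝ) => w.1.1) ((u, 0), z) := by fun_prop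
  have hx : ContinuousAt (fun w : (EuclideanSpace ℝ (Fin n) × ℝ) ×
      (EuclideanSpace ℝ (Fin k) × ℝ × ℝ) => (w.1.1, w.2.1, w.1.2)) ((u, 0), z) := by fun_prop
  have hc : ContinuousAt (fun w : (EuclideanSpace ℝ (Fin n) × ℝ) ×
      (EuclideanSpace ℝ (Fin k) × ℝ × ℝ) => (τ σ w.1.1, σ.timeProj k w.2, S.basePoint v w.1.1,
      S.initialDirection v (w.1.1, w.2.1, w.1.2), w.1.2)) ((u, 0), z) :=
    (ContinuousAt.comp (g := τ σ) (H.continuousAt_tau hu σ) hu1).prodMk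
      (ContinuousAt.prodMk (by fun_prop) ((ContinuousAt.comp (g := S.basePoint v)
        (H.contDiffAt_basePoint hu).continuousAt hu1).prodMk
          ((ContinuousAt.comp (g := S.initialDirection v) (f := fun w :
              (EuclideanSpace ℝ (Fin n) × ℝ) × (EuclideanSpace ℝ (Fin k) × ℝ × ℝ) =>
              (w.1.1, w.2.1, w.1.2))
            (H.contDiffAt_initialDirection hu z.1).continuousAt hx).prodMk (by fun_prop))))
  filter_upwards [hc.eventually h1, hx.eventually (H.eventually_graphPoint_eq hu z.1),
    hu1.eventually (H.isOpen.mem_nhds hu)] with w w1 w2 w3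
  have e1 : σ.timeProj k ((v w.1.1, τ .plus w.1.1, τ .minus w.1.1) + w.1.2 • w.2) =
      τ σ w.1.1 + w.1.2 * σ.timeProj k w.2 := by
    cases σ <;> simp [Side.timeProj]
  have e2 : S.graphPoint (w.1.1, ((v w.1.1, τ .plus w.1.1, τ .minus w.1.1) + w.1.2 • w.2).1) =
      S.basePoint v w.1.1 + w.1.2 • S.initialDirection v (w.1.1, w.2.1, w.1.2) := w2
  rw [arrival, e1, e2]
  have e3 : localFlow (S.X₀ σ) S.D (τ σ w.1.1) (S.basePoint v w.1.1) = S.endPoint v τ w.1.1 :=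
    H.flow₀_eq w3 σ
  simp only [e3] at w1
  exact w1

theorem contDiffAt_blownClosing (H : MelnikovSetting S ε₀ V v τ) (hu : u ∈ V)
    (z : EuclideanSpace ℝ (Fin k) × ℝ × ℝ) :
    ContDiffAt ℝ 1 (S.blownClosing ε₀ v τ) ((u, 0), z) := by
  have hd := fun σ => H.contDiffAt_deviation hu σ z
  have hq : ContDiffAt ℝ 1 (fun w : (EuclideanSpace ℝ (Fin n) × ℝ) ×
      (EuclideanSpace ℝ (Fin k) × ℝ × ℝ) => S.endPoint v τ w.1.1) ((u, 0), z) :=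
    ContDiffAt.comp (g := S.endPoint v τ) (f := fun w : (EuclideanSpace ℝ (Fin n) × ℝ) ×
      (EuclideanSpace ℝ (Fin k) × ℝ × ℝ) => w.1.1) ((u, (0 : ℝ)), z) (H.contDiffAt_endPoint hu)
      (by fun_prop)
  have hh : ∀ σ, ContDiffAt ℝ 1 (fun w : (EuclideanSpace ℝ (Fin n) × ℝ) ×
      (EuclideanSpace ℝ (Fin k) × ℝ × ℝ) => quotientAlong S.h
        (S.endPoint v τ w.1.1, S.deviation ε₀ v τ σ w, w.1.2)) ((u, 0), z) := fun σ =>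
    ContDiffAt.comp (g := quotientAlong S.h) (f := fun w : (EuclideanSpace ℝ (Fin n) × ℝ) ×
      (EuclideanSpace ℝ (Fin k) × ℝ × ℝ) => (S.endPoint v τ w.1.1, S.deviation ε₀ v τ σ w, w.1.2))
      ((u, (0 : ℝ)), z) (contDiffAt_quotientAlong H.regular.isOpen_D H.regular.contDiffOn_h
        fun r _ => by simpa [endPoint] using H.end_mem hu) (hq.prodMk ((hd σ).prodMk (by fun_prop)))
  exact (contDiffAt_snd.comp _ ((hd .plus).sub (hd .minus))).fst.prodMk
    ((hh .plus).prodMk (hh .minus))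

theorem blownClosing_zero (H : MelnikovSetting S ε₀ V v τ) (hu : u ∈ V)
    (z : EuclideanSpace ℝ (Fin k) × ℝ × ℝ) :
    S.blownClosing ε₀ v τ ((u, 0), z) = S.closingDeriv v τ u z +
      S.blownClosing ε₀ v τ ((u, 0), 0) := by
  simp only [blownClosing, quotientAlong_zero, H.deviation_zero hu, map_zero, zero_add]
  ext1
  · simp [closingDeriv]
    abel
  · simp [closingDeriv]

/-- The `h`-components turn each deviation into `β^± y + α^±`. The middle component gives `y = -(Π₂
β)⁻¹ Π₂ α`, and the first coordinate of `α + β y` is then the Melnikov function. -/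
theorem eq_melnikov (H : MelnikovSetting S ε₀ V v τ) (hu : u ∈ V)
    (hdet : (S.beta₂ v τ u).det ≠ 0) {z : EuclideanSpace ℝ (Fin k) × ℝ × ℝ}
    (hz : S.blownClosing ε₀ v τ ((u, 0), z) = 0) :
    (S.deviation ε₀ v τ .plus ((u, 0), z) - S.deviation ε₀ v τ .minus ((u, 0), z)).1 =
      S.melnikov v τ u := by
  simp only [blownClosing, quotientAlong_zero] at hz
  have hz2 : ∀ σ, fderiv ℝ S.h (S.endPoint v τ u) (S.deviation ε₀ v τ σ ((u, 0), z)) = 0 := by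
    rintro (_ | _)
    · exact congrArg (fun x => x.2.1) hz
    · exact congrArg (fun x => x.2.2) hz
  have hA : ∀ σ, S.deviation ε₀ v τ σ ((u, 0), z) =
      S.betaSide v τ u σ z.1 + S.alphaSide v τ u σ := fun σ => by
    have h1 := hz2 σ
    rw [H.deviation_zero hu] at h1 ⊢
    have e : S.arrivalDeriv v τ u σ z + S.omega σ (τ σ u) (S.basePoint v u) =
        (S.matY σ (τ σ u) (S.basePoint v u) z.1 + S.omega σ (τ σ u) (S.basePoint v u)) +
          σ.timeProj k z • S.X₀ σ (S.endPoint v τ u) := by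
      rw [add_right_comm]
      rfl
    rw [e] at h1 ⊢
    have h2 := proj_add_smul (S := S) (q := S.endPoint v τ u) (H.lie_end hu σ).ne h1
    rw [h2, map_add]
    simp only [betaSide, alphaSide, H.flow₀_eq hu σ]
    rfl
  have hd : S.deviation ε₀ v τ .plus ((u, 0), z) - S.deviation ε₀ v τ .minus ((u, 0), z) =
      S.alpha v τ u + S.beta v τ u z.1 := by
    rw [hA, hA, alpha, beta, sub_apply]
    abel
  have hz1 : (S.alpha v τ u).2.1 + S.beta₂ v τ u z.1 = 0 := by
    have := congrArg Prod.fst hz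
    simp only [hd] at this
    exact this
  have hy : (S.beta₂ v τ u).inverse (S.alpha v τ u).2.1 = -z.1 := by
    rw [eq_neg_of_add_eq_zero_left hz1]
    obtain ⟨e, he⟩ := ContinuousLinearMap.isInvertible_of_det_ne_zero hdet
    rw [← he, ContinuousLinearMap.inverse_equiv]
    simp
  rw [hd, melnikov, hy, map_neg, sub_neg_eq_add]

theorem contDiffAt_arrival (H : MelnikovSetting S ε₀ V v τ) (hu : u ∈ V) (σ : Side) :
    ContDiffAt ℝ 1 (S.arrival σ) ((u, 0), v u, τ .plus u, τ .minus u) := by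
  have e1 : σ.timeProj k (v u, τ .plus u, τ .minus u) = τ σ u := by
    cases σ <;> rfl
  have h1 := H.regular.contDiffAt_flowAt H.pos (σ := σ) (t := τ σ u) (p := S.basePoint v u)
    (ε := 0) ⟨neg_neg_of_pos H.pos, H.pos⟩ (by rw [field_zero]; exact H.hasSolutionTo hu σ)
  rw [← e1] at h1
  refine ContDiffAt.comp (g := S.flowAt σ) (f := fun w : (EuclideanSpace ℝ (Fin n) × ℝ) ×
      (EuclideanSpace ℝ (Fin k) × ℝ × ℝ) => (σ.timeProj k w.2, S.graphPoint (w.1.1, w.2.1),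
      w.1.2)) ((u, (0 : ℝ)), v u, τ .plus u, τ .minus u) h1 ?_
  refine ContDiffAt.prodMk (by fun_prop) (ContDiffAt.prodMk ?_ (by fun_prop))
  exact ContDiffAt.comp (g := S.graphPoint) (f := fun w : (EuclideanSpace ℝ (Fin n) × ℝ) ×
      (EuclideanSpace ℝ (Fin k) × ℝ × ℝ) => (w.1.1, w.2.1))
      ((u, (0 : ℝ)), v u, τ .plus u, τ .minus u)
      ((H.regular.contDiffAt_graphPoint (H.mem_prod hu)).of_le (by norm_num)) (by fun_prop)

theorem arrival_zero (H : MelnikovSetting S ε₀ V v τ) (hu : u ∈ V) (σ : Side) :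
    S.arrival σ ((u, 0), v u, τ .plus u, τ .minus u) = S.endPoint v τ u := by
  rw [arrival, flowAt_zero]
  cases σ
  · exact H.flow₀_eq hu .plus
  · exact H.flow₀_eq hu .minus

theorem hasFDerivAt_h_end (H : MelnikovSetting S ε₀ V v τ) (hu : u ∈ V) :
    HasFDerivAt S.h (fderiv ℝ S.h (S.endPoint v τ u)) (S.endPoint v τ u) :=
  ((H.regular.contDiffOn_h.differentiableOn two_ne_zero).differentiableAt
    (H.regular.isOpen_D.mem_nhds (H.end_mem hu))).hasFDerivAt

theorem hasFDerivAt_arrival (H : MelnikovSetting S ε₀ V v τ) (hu : u ∈ V) (σ : Side) :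
    HasFDerivAt (fun z => S.arrival σ ((u, 0), z)) (S.arrivalDeriv v τ u σ)
      (v u, τ .plus u, τ .minus u) := by
  have e1 : σ.timeProj k (v u, τ .plus u, τ .minus u) = τ σ u := by
    cases σ <;> rfl
  have h1 := H.hasFDerivAt_flow₀ (H.hasSolutionTo hu σ)
  rw [H.flow₀_eq hu σ, ← e1] at h1
  have h2 : HasFDerivAt (fun z : EuclideanSpace ℝ (Fin k) × ℝ × ℝ => S.graphPoint (u, z.1))
      ((S.liftY (S.basePoint v u)).comp (ContinuousLinearMap.fst ℝ _ _))
      (v u, τ .plus u, τ .minus u) :=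
    HasFDerivAt.comp (g := fun y => S.graphPoint (u, y)) (f := Prod.fst)
      (v u, τ .plus u, τ .minus u) (H.regular.hasFDerivAt_graphPoint_right (H.mem_prod hu))
      hasFDerivAt_fst
  have h3 := HasFDerivAt.comp (g := fun z : ℝ × State n k => S.flow₀ σ z.1 z.2)
    (f := fun z : EuclideanSpace ℝ (Fin k) × ℝ × ℝ => (σ.timeProj k z, S.graphPoint (u, z.1)))
    (v u, τ .plus u, τ .minus u) h1 ((σ.timeProj k).hasFDerivAt.prodMk h2)
  have e2 : (fun z => S.arrival σ ((u, 0), z)) = fun z : EuclideanSpace ℝ (Fin k) × ℝ × ℝ =>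
      S.flow₀ σ (σ.timeProj k z) (S.graphPoint (u, z.1)) := by
    funext z
    exact flowAt_zero σ _ _
  rw [e2]
  refine h3.congr_fderiv ?_
  rw [e1]
  refine ContinuousLinearMap.ext fun z => ?_
  simp only [arrivalDeriv, matY, endPoint, add_apply,
    ContinuousLinearMap.comp_apply, ContinuousLinearMap.smulRight_apply,
    ContinuousLinearMap.prod_apply, ContinuousLinearMap.coe_fst', ContinuousLinearMap.coe_snd']
  rw [add_comm]

theorem contDiffAt_closing (H : MelnikovSetting S ε₀ V v τ) (hu : u ∈ V) :
    ContDiffAt ℝ 1 S.closing ((u, 0), v u, τ .plus u, τ .minus u) := by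
  have hh : ∀ σ, ContDiffAt ℝ 1 (fun w => S.h (S.arrival σ w))
      ((u, 0), v u, τ .plus u, τ .minus u) := fun σ => by
    refine ContDiffAt.comp (g := S.h) (f := S.arrival σ) ((u, (0 : ℝ)), v u, τ .plus u, τ .minus u)
      ?_ (H.contDiffAt_arrival hu σ)
    rw [H.arrival_zero hu]
    exact (H.regular.contDiffOn_h.contDiffAt
      (H.regular.isOpen_D.mem_nhds (H.end_mem hu))).of_le (by norm_num)
  exact (contDiffAt_snd.comp _ ((H.contDiffAt_arrival hu .plus).sub
    (H.contDiffAt_arrival hu .minus))).fst.prodMk ((hh .plus).prodMk (hh .minus))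

theorem hasFDerivAt_closing (H : MelnikovSetting S ε₀ V v τ) (hu : u ∈ V) :
    HasFDerivAt (fun z => S.closing ((u, 0), z)) (S.closingDeriv v τ u)
      (v u, τ .plus u, τ .minus u) := by
  have hA := H.hasFDerivAt_arrival hu
  have hh : ∀ σ, HasFDerivAt (fun z => S.h (S.arrival σ ((u, 0), z)))
      ((fderiv ℝ S.h (S.endPoint v τ u)).comp (S.arrivalDeriv v τ u σ))
      (v u, τ .plus u, τ .minus u) := fun σ => by
    refine HasFDerivAt.comp (g := S.h) (f := fun z => S.arrival σ ((u, 0), z))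
      (v u, τ .plus u, τ .minus u) ?_ (hA σ)
    rw [H.arrival_zero hu]
    exact H.hasFDerivAt_h_end hu
  exact (((hA .plus).sub (hA .minus)).snd.fst).prodMk ((hh .plus).prodMk (hh .minus))

theorem closing_zero (H : MelnikovSetting S ε₀ V v τ) (hu : u ∈ V) :
    S.closing ((u, 0), v u, τ .plus u, τ .minus u) = 0 := by
  have : S.h (S.endPoint v τ u) = 0 := H.h_end hu
  simp [closing, H.arrival_zero hu, this]

theorem exists_branch (H : MelnikovSetting S ε₀ V v τ) (hu : u ∈ V)
    (hdet : ∀ u ∈ V, (S.beta₂ v τ u).det ≠ 0) (hzero : S.melnikov v τ u = 0)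
    (hsimple : (fderiv ℝ (S.melnikov v τ) u).det ≠ 0) :
    ∃ c : ℝ → EuclideanSpace ℝ (Fin n) × (EuclideanSpace ℝ (Fin k) × ℝ × ℝ),
      ContinuousAt c 0 ∧ c 0 = (u, v u, τ .plus u, τ .minus u) ∧
      (∀ᶠ ε in 𝓝 0, S.arrival .plus (((c ε).1, ε), (c ε).2) =
          S.arrival .minus (((c ε).1, ε), (c ε).2) ∧
        S.h (S.arrival .plus (((c ε).1, ε), (c ε).2)) = 0) ∧
      ∀ᶠ w in 𝓝 ((u, (0 : ℝ)), v u, τ .plus u, τ .minus u), w.1.2 ≠ 0 →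
        S.arrival .plus w = S.arrival .minus w → S.h (S.arrival .plus w) = 0 →
        c w.1.2 = (w.1.1, w.2) := by
  have hL := H.closingDeriv_isInvertible hu (hdet u hu)
  -- At `ε = 0` the blown-up equations are affine with invertible linear part, so their solution is
  -- explicit.
  obtain ⟨z₀, hz₀⟩ : ∃ z₀, S.blownClosing ε₀ v τ ((u, 0), z₀) = 0 := by
    obtain ⟨e, he⟩ := hL
    refine ⟨e.symm (-S.blownClosing ε₀ v τ ((u, 0), 0)), ?_⟩
    rw [H.blownClosing_zero hu, ← he]
    simp
  have hΨ := H.contDiffAt_blownClosing hu z₀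
  have hΨi : fderiv ℝ (S.blownClosing ε₀ v τ) ((u, 0), z₀) ∘L
      .inr ℝ (EuclideanSpace ℝ (Fin n) × ℝ) (EuclideanSpace ℝ (Fin k) × ℝ × ℝ) =
        S.closingDeriv v τ u := by
    have h1 := HasFDerivAt.comp (g := S.blownClosing ε₀ v τ) (f := fun z => ((u, (0 : ℝ)), z)) z₀
      (hΨ.differentiableAt one_ne_zero).hasFDerivAt (hasFDerivAt_prodMk_right (u, (0 : ℝ)) z₀)
    refine h1.unique (((S.closingDeriv v τ u).hasFDerivAt.add_const
      (S.blownClosing ε₀ v τ ((u, 0), 0))).congr_of_eventuallyEq ?_)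
    exact Eventually.of_forall fun z => H.blownClosing_zero hu z
  have hΘ := H.contDiffAt_closing hu
  have hΘi : fderiv ℝ S.closing ((u, 0), v u, τ .plus u, τ .minus u) ∘L
      .inr ℝ (EuclideanSpace ℝ (Fin n) × ℝ) (EuclideanSpace ℝ (Fin k) × ℝ × ℝ) =
        S.closingDeriv v τ u := by
    have h1 := HasFDerivAt.comp (g := S.closing) (f := fun z => ((u, (0 : ℝ)), z))
      (v u, τ .plus u, τ .minus u) (hΘ.differentiableAt one_ne_zero).hasFDerivAt
      (hasFDerivAt_prodMk_right (u, (0 : ℝ)) (v u, τ .plus u, τ .minus u))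
    exact h1.unique (H.hasFDerivAt_closing hu)
  have hdev := fun σ => H.contDiffAt_deviation hu σ z₀
  obtain ⟨c, hc, hc0, hc1, hc2⟩ := exists_branch_of_simple_zero (Ψ := S.blownClosing ε₀ v τ)
    (Θ := S.closing) (M := S.melnikov v τ)
    (P := fun w => (S.deviation ε₀ v τ .plus w - S.deviation ε₀ v τ .minus w).1)
    (Q := fun w => (S.arrival .plus w - S.arrival .minus w).1)
    (b := fun u => (v u, τ .plus u, τ .minus u)) hΨ hz₀ (hΨi ▸ hL)
    ((hdev .plus).sub (hdev .minus)).fst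
    (by
      filter_upwards [H.isOpen.mem_nhds hu] with x hx z hz using H.eq_melnikov hx (hdet x hx) hz)
    hzero (ContinuousLinearMap.isInvertible_of_det_ne_zero hsimple)
    ((H.contDiffAt_v hu).continuousAt.prodMk
      ((H.continuousAt_tau hu .plus).prodMk (H.continuousAt_tau hu .minus)))
    hΘ (H.closing_zero hu) (hΘi ▸ hL) (by
      have hseg : ∀ σ, ∀ᶠ w in 𝓝 ((u, (0 : ℝ)), z₀), ∀ r ∈ Icc (0 : ℝ) 1,
          S.endPoint v τ w.1.1 + r • (w.1.2 • S.deviation ε₀ v τ σ w) ∈ S.D := fun σ => by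
        have ht : ContinuousAt (fun w : (EuclideanSpace ℝ (Fin n) × ℝ) ×
            (EuclideanSpace ℝ (Fin k) × ℝ × ℝ) =>
            (S.endPoint v τ w.1.1, S.deviation ε₀ v τ σ w, w.1.2)) ((u, 0), z₀) :=
          (ContinuousAt.comp (g := S.endPoint v τ)
            (f := fun w : (EuclideanSpace ℝ (Fin n) × ℝ) ×
              (EuclideanSpace ℝ (Fin k) × ℝ × ℝ) => w.1.1)
            (H.contDiffAt_endPoint hu).continuousAt (by fun_prop)).prodMk
            ((hdev σ).continuousAt.prodMk (by fun_prop))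
        exact ht.eventually (eventually_segment_mem H.regular.isOpen_D (H.end_mem hu) _)
      have hV : ∀ᶠ w in 𝓝 ((u, (0 : ℝ)), z₀), w.1.1 ∈ V :=
        (by fun_prop : Continuous fun w : (EuclideanSpace ℝ (Fin n) × ℝ) ×
          (EuclideanSpace ℝ (Fin k) × ℝ × ℝ) => w.1.1).continuousAt.eventually
          (H.isOpen.mem_nhds hu)
      -- Since `h` vanishes at `endPoint`, each component of `closing` is `ε` times the
      -- corresponding component of `blownClosing`.
      filter_upwards [H.eventually_arrival_eq hu .plus z₀, H.eventually_arrival_eq hu .minus z₀,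
        hseg .plus, hseg .minus, hV] with w a1 a2 s1 s2 hwV hw
      have hq : S.h (S.endPoint v τ w.1.1) = 0 := H.h_end hwV
      have hC := H.regular.contDiffOn_h.of_le (show (1 : WithTop ℕ∞) ≤ 2 by norm_num)
      have k1 := apply_add_smul_eq H.regular.isOpen_D hC
        (z := (S.endPoint v τ w.1.1, S.deviation ε₀ v τ .plus w, w.1.2)) s1
      have k2 := apply_add_smul_eq H.regular.isOpen_D hC
        (z := (S.endPoint v τ w.1.1, S.deviation ε₀ v τ .minus w, w.1.2)) s2
      have e1 : (S.deviation ε₀ v τ .plus w - S.deviation ε₀ v τ .minus w).2.1 = 0 :=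
        congrArg Prod.fst hw
      have e2 : quotientAlong S.h (S.endPoint v τ w.1.1, S.deviation ε₀ v τ .plus w, w.1.2) = 0 :=
        congrArg (fun x => x.2.1) hw
      have e3 : quotientAlong S.h (S.endPoint v τ w.1.1, S.deviation ε₀ v τ .minus w, w.1.2) = 0 :=
        congrArg (fun x => x.2.2) hw
      simp only [e2, e3, hq, smul_zero, add_zero] at k1 k2
      have e4 : ∀ a b q : State n k, (q + w.1.2 • a) - (q + w.1.2 • b) = w.1.2 • (a - b) :=
        fun a b q => by rw [add_sub_add_left_eq_sub, smul_sub]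
      simp only [closing, a1, a2, k1, k2, e4, Prod.smul_snd, Prod.smul_fst, e1, smul_zero,
        Prod.mk_zero_zero, and_self])
  refine ⟨c, hc, hc0, ?_, ?_⟩
  · filter_upwards [hc1] with ε hε
    have h1 := congrArg Prod.fst hε.1
    have h2 : S.h (S.arrival .plus (((c ε).1, ε), (c ε).2)) = 0 :=
      congrArg (fun x => x.2.1) hε.1
    have h3 : S.h (S.arrival .minus (((c ε).1, ε), (c ε).2)) = 0 :=
      congrArg (fun x => x.2.2) hε.1
    refine ⟨?_, h2⟩
    -- Both arrivals lie on the graph of `g`, so their last coordinates agree as soon as the others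
    -- do.
    rw [eq_graphPoint_of_h_eq_zero h2, eq_graphPoint_of_h_eq_zero h3]
    congr 1
    exact Prod.ext (sub_eq_zero.1 hε.2) (sub_eq_zero.1 h1)
  · filter_upwards [hc2] with w hw hε h1 h2
    refine hw hε ?_ ?_
    · simp [closing, ← h1, h2]
    · simp [h1]

end MelnikovSetting

end PWSystem

/-! ### From solutions of the closing equations to periodic solutions. -/

theorem IsSolutionOn.congr {n k : ℕ} {X : State n k → State n k} {D : Set (State n k)}
    {γ η : ℝ → State n k} {I : Set ℝ} (h : IsSolutionOn X D γ I) (hη : EqOn η γ I) :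
    IsSolutionOn X D η I := by
  refine ⟨fun t ht => ?_, fun t ht => hη ht ▸ h.2 t ht⟩
  rw [hη ht]
  exact (h.1 t ht).congr hη (hη ht)

theorem Function.Periodic.map_mul_fract {α : Type*} {f : ℝ → α} {T : ℝ}
    (hf : Function.Periodic f T) (hT : T ≠ 0) (t : ℝ) : f (T * Int.fract (t / T)) = f t := by
  have e : T * Int.fract (t / T) = t - ⌊t / T⌋ * T := by
    rw [Int.fract, mul_sub, mul_div_cancel₀ t hT]
    ring
  rw [e, hf.sub_int_mul_eq]

namespace PWSystem

variable {n k : ℕ} {S : PWSystem n k} {ε₀ : ℝ}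

open Classical in
/-- The periodic function of period `a - b` that follows the upper flow from `p` on `[0, a]` and
the lower flow on `[a, a - b]`, returning to `p`. -/
noncomputable def closedOrbit (S : PWSystem n k) (ε : ℝ) (p : State n k) (a b t : ℝ) : State n k :=
  if (a - b) * Int.fract (t / (a - b)) ≤ a then
    S.flowAt .plus ((a - b) * Int.fract (t / (a - b)), p, ε)
  else S.flowAt .minus ((a - b) * Int.fract (t / (a - b)) - (a - b), p, ε)

theorem closedOrbit_periodic {ε a b : ℝ} {p : State n k} (hab : a - b ≠ 0) :
    Function.Periodic (S.closedOrbit ε p a b) (a - b) := fun t => by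
  have e : Int.fract ((t + (a - b)) / (a - b)) = Int.fract (t / (a - b)) := by
    rw [add_div, div_self hab, Int.fract_add_one]
  simp only [closedOrbit, e]

theorem mul_fract_div_of_mem_Ico {T t : ℝ} (ht : t ∈ Ico 0 T) : T * Int.fract (t / T) = t := by
  have hT : 0 < T := ht.1.trans_lt ht.2
  rw [Int.fract_eq_self.2 ⟨div_nonneg ht.1 hT.le, (div_lt_one hT).2 ht.2⟩,
    mul_div_cancel₀ t hT.ne']

theorem closedOrbit_of_mem_Icc {ε a b : ℝ} {p : State n k} (hb : b < 0) {t : ℝ}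
    (ht : t ∈ Icc 0 a) : S.closedOrbit ε p a b t = S.flowAt .plus (t, p, ε) := by
  have e := mul_fract_div_of_mem_Ico (T := a - b) (t := t) ⟨ht.1, by linarith [ht.2]⟩
  simp only [closedOrbit, e, ht.2, if_true]

/-- At both end points the definition takes the upper branch: at `a` by the inequality, at `a - b`
because the fractional part is `0`. The two formulas agree there by `hab` and by periodicity. -/
theorem closedOrbit_of_mem_Icc' {ε a b : ℝ} {p : State n k} (ha : 0 < a) (hb : b < 0)
    (hab : S.flowAt .plus (a, p, ε) = S.flowAt .minus (b, p, ε)) {t : ℝ}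
    (ht : t ∈ Icc a (a - b)) : S.closedOrbit ε p a b t = S.flowAt .minus (t - (a - b), p, ε) := by
  rcases eq_or_lt_of_le ht.1 with rfl | h1
  · rw [closedOrbit_of_mem_Icc hb ⟨ha.le, le_rfl⟩, hab]
    simp
  rcases eq_or_lt_of_le ht.2 with rfl | h2
  · have := closedOrbit_periodic (S := S) (ε := ε) (p := p) (a := a) (b := b) (by linarith) 0
    rw [zero_add] at this
    rw [this, closedOrbit_of_mem_Icc hb ⟨le_rfl, ha.le⟩, sub_self, flowAt_start, flowAt_start]
  · have e := mul_fract_div_of_mem_Ico (T := a - b) (t := t) ⟨by linarith, h2⟩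
    simp only [closedOrbit, e, h1.not_ge, if_false]

theorem crossingAt_closedOrbit (hS : S.Regular ε₀) (hε₀ : 0 < ε₀) {ε a b : ℝ} {p : State n k}
    (hε : ε ∈ Ioo (-ε₀) ε₀) (ha : 0 < a) (hb : b < 0) (hp : S.h p = 0)
    (hsa : HasSolutionTo (S.field ε .plus) S.D a p)
    (hsb : HasSolutionTo (S.field ε .minus) S.D b p)
    (hab : S.flowAt .plus (a, p, ε) = S.flowAt .minus (b, p, ε))
    (hend : S.h (S.flowAt .plus (a, p, ε)) = 0)
    (habove : ∀ t ∈ Ioo 0 a, 0 < S.h (S.flowAt .plus (t, p, ε)))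
    (hbelow : ∀ t ∈ Ioo b 0, S.h (S.flowAt .minus (t, p, ε)) < 0)
    (hstart : ∀ σ, 0 < S.lie (S.field ε σ) p)
    (hlie : ∀ σ, S.lie (S.field ε σ) (S.flowAt .plus (a, p, ε)) < 0) :
    S.CrossingAt ε (S.closedOrbit ε p a b) 0 a (a - b) := by
  have e1 : EqOn (S.closedOrbit ε p a b) (fun t => S.flowAt .plus (t, p, ε)) (Icc 0 a) :=
    fun t ht => closedOrbit_of_mem_Icc hb ht
  have e2 : EqOn (S.closedOrbit ε p a b) (fun t => S.flowAt .minus (t + -(a - b), p, ε))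
      (Icc a (a - b)) := fun t ht => closedOrbit_of_mem_Icc' ha hb hab ht
  have s1 : IsSolutionOn (S.field ε .plus) S.D (fun t => S.flowAt .plus (t, p, ε)) (Icc 0 a) := by
    have := hsa.isIntegralCurveOn hS.isOpen_D (hS.contDiffOn_field hε₀ hε .plus)
    rwa [uIcc_of_le ha.le] at this
  have s2 : IsSolutionOn (S.field ε .minus) S.D (fun t => S.flowAt .minus (t, p, ε))
      (Icc b 0) := by
    have := hsb.isIntegralCurveOn hS.isOpen_D (hS.contDiffOn_field hε₀ hε .minus)
    rwa [uIcc_of_ge hb.le] at this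
  have s3 := s2.comp_add (-(a - b))
  rw [show b - -(a - b) = a by ring, show 0 - -(a - b) = a - b by ring] at s3
  have z0 : S.closedOrbit ε p a b 0 = p := by
    exact (e1 ⟨le_rfl, ha.le⟩).trans (flowAt_start _ _ _)
  have za : S.closedOrbit ε p a b a = S.flowAt .plus (a, p, ε) := e1 ⟨ha.le, le_rfl⟩
  refine ⟨ha, by linarith, ?_, s1.congr e1, s3.congr e2, by rwa [z0], by rwa [za],
    fun t ht => ?_, fun t ht => ?_, by rwa [z0], by rwa [za]⟩
  · rw [sub_zero]
    exact closedOrbit_periodic (by linarith)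
  · rw [e1 (Ioo_subset_Icc_self ht)]
    exact habove t ht
  · rw [e2 (Ioo_subset_Icc_self ht)]
    exact hbelow _ ⟨by linarith [ht.1], by linarith [ht.2]⟩

namespace CrossingAt

variable {ε T a : ℝ} {χ : ℝ → State n k}

theorem apply_period (h : S.CrossingAt ε χ 0 a T) : χ T = χ 0 := by
  have := h.2.2.1 0
  rwa [zero_add, sub_zero] at this

theorem isSolutionOn_plus (h : S.CrossingAt ε χ 0 a T) :
    IsSolutionOn (S.field ε .plus) S.D χ (uIcc 0 a) := by
  rw [uIcc_of_le h.1.le]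
  exact h.2.2.2.1

theorem isSolutionOn_minus (h : S.CrossingAt ε χ 0 a T) :
    IsSolutionOn (S.field ε .minus) S.D (fun t => χ (t + T)) (uIcc 0 (a - T)) := by
  rw [uIcc_of_ge (by linarith [h.2.1])]
  simpa using h.2.2.2.2.1.comp_add T

theorem flowAt_plus (h : S.CrossingAt ε χ 0 a T) (hS : S.Regular ε₀) (hε₀ : 0 < ε₀)
    (hε : ε ∈ Ioo (-ε₀) ε₀) {t : ℝ} (ht : t ∈ Icc 0 a) :
    S.flowAt .plus (t, χ 0, ε) = χ t :=
  localFlow_eq hS.isOpen_D (hS.contDiffOn_field hε₀ hε .plus) rfl h.isSolutionOn_plus.1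
    h.isSolutionOn_plus.2 (by rwa [uIcc_of_le h.1.le])

theorem flowAt_minus (h : S.CrossingAt ε χ 0 a T) (hS : S.Regular ε₀) (hε₀ : 0 < ε₀)
    (hε : ε ∈ Ioo (-ε₀) ε₀) {t : ℝ} (ht : t ∈ Icc a T) :
    S.flowAt .minus (t - T, χ 0, ε) = χ t := by
  have := localFlow_eq hS.isOpen_D (hS.contDiffOn_field hε₀ hε .minus)
    (γ := fun t => χ (t + T)) (p := χ 0) (s := t - T) (by simpa using h.apply_period)
    h.isSolutionOn_minus.1 h.isSolutionOn_minus.2 (by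
      rw [uIcc_of_ge (by linarith [h.2.1])]
      exact ⟨by linarith [ht.1], by linarith [ht.2]⟩)
  rwa [sub_add_cancel] at this

/-- Uniqueness of solutions fixes both arcs, the lower one followed backwards from `χ 0` for the
time `a - T`; periodicity fixes the rest. -/
theorem eq_closedOrbit (h : S.CrossingAt ε χ 0 a T) (hS : S.Regular ε₀) (hε₀ : 0 < ε₀)
    (hε : ε ∈ Ioo (-ε₀) ε₀) : χ = S.closedOrbit ε (χ 0) a (a - T) := by
  have hT : 0 < T := h.1.trans h.2.1
  have hper : Function.Periodic χ T := by simpa using h.2.2.1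
  funext t
  rw [← hper.map_mul_fract hT.ne' t]
  have h0 : 0 ≤ T * Int.fract (t / T) := mul_nonneg hT.le (Int.fract_nonneg _)
  have h1 : T * Int.fract (t / T) ≤ T := by
    have := (Int.fract_lt_one (t / T)).le
    nlinarith
  simp only [closedOrbit, sub_sub_cancel]
  split_ifs with hle
  · exact (h.flowAt_plus hS hε₀ hε ⟨h0, hle⟩).symm
  · exact (h.flowAt_minus hS hε₀ hε ⟨(not_le.1 hle).le, h1⟩).symm

end CrossingAt

theorem arrival_of_h_eq_zero {p : State n k} (hp : S.h p = 0) (σ : Side) (ε : ℝ) (z : ℝ × ℝ) :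
    S.arrival σ ((p.1, ε), p.2.1, z) = S.flowAt σ (σ.timeProj k (p.2.1, z), p, ε) :=
  congrArg (fun x => S.flowAt σ (σ.timeProj k (p.2.1, z), x, ε))
    (eq_graphPoint_of_h_eq_zero hp).symm

namespace MelnikovSetting

variable {V : Set (EuclideanSpace ℝ (Fin n))}
  {v : EuclideanSpace ℝ (Fin n) → EuclideanSpace ℝ (Fin k)}
  {τ : Side → EuclideanSpace ℝ (Fin n) → ℝ} {u : EuclideanSpace ℝ (Fin n)}

theorem exists_unique_crossing (H : MelnikovSetting S ε₀ V v τ) (hu : u ∈ V)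
    (hdet : ∀ u ∈ V, (S.beta₂ v τ u).det ≠ 0) (hzero : S.melnikov v τ u = 0)
    (hsimple : (fderiv ℝ (S.melnikov v τ) u).det ≠ 0) :
    ∃ ε₁ > 0, ε₁ ≤ ε₀ ∧ ∃ δ > 0, ∃ φ : ℝ → ℝ → State n k,
      (∀ ε : ℝ, 0 < |ε| → |ε| < ε₁ →
        S.IsCrossingPeriodicSolution ε (φ ε) ∧ φ ε 0 ∈ S.switching ∧
        dist (φ ε 0) (S.basePoint v u) < δ ∧
        ∀ ψ : ℝ → State n k, S.IsCrossingPeriodicSolution ε ψ →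
          dist (ψ 0) (S.basePoint v u) < δ →
            (∃ s : ℝ, ∀ t : ℝ, ψ t = φ ε (t + s)) ∧ (ψ 0 ∈ S.switching → ψ = φ ε)) ∧
      Tendsto (fun ε => φ ε 0) (𝓝[≠] 0) (𝓝 (S.basePoint v u)) := by
  have hS := H.regular
  have hε₀ := H.pos
  have hz : (0 : ℝ) ∈ Ioo (-ε₀) ε₀ := ⟨neg_neg_of_pos hε₀, hε₀⟩
  obtain ⟨c, hc, hc0, hcs, hcu⟩ := H.exists_branch hu hdet hzero hsimple
  -- local uniqueness in terms of the initial point and the crossing times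
  have hcu' : ∀ᶠ x in 𝓝 ((S.basePoint v u, (0 : ℝ)), (τ .plus u, τ .minus u)), x.1.2 ≠ 0 →
      S.arrival .plus ((x.1.1.1, x.1.2), x.1.1.2.1, x.2) =
        S.arrival .minus ((x.1.1.1, x.1.2), x.1.1.2.1, x.2) →
      S.h (S.arrival .plus ((x.1.1.1, x.1.2), x.1.1.2.1, x.2)) = 0 →
      c x.1.2 = (x.1.1.1, x.1.1.2.1, x.2) :=
    ((by fun_prop : Continuous fun x : (State n k × ℝ) × (ℝ × ℝ) =>
      ((x.1.1.1, x.1.2), x.1.1.2.1, x.2)).tendsto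
        ((S.basePoint v u, (0 : ℝ)), (τ .plus u, τ .minus u))).eventually hcu
  -- Start data and crossing times are separated: the radius `η` for the times becomes the tolerance
  -- demanded of `TransversalArc.exists_nhds`.
  rw [nhds_prod_eq, eventually_prod_iff] at hcu'
  obtain ⟨A, hA, B, hB, hAB⟩ := hcu'
  obtain ⟨η, hη, hηB⟩ := Metric.eventually_nhds_iff.1 hB
  obtain ⟨r₁, hr₁, -, -, arc₁⟩ := (H.transversalArc hu .plus).exists_nhds hS hε₀ hη
  obtain ⟨r₂, hr₂, -, -, arc₂⟩ := (H.transversalArc hu .minus).exists_nhds hS hε₀ hη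
  simp only [Side.sign, one_mul, neg_mul, sub_neg_eq_add, neg_add_rev, neg_neg] at arc₁ arc₂
  have hh0 : S.h (S.basePoint v u) = 0 := h_graphPoint _
  have hlie0 : ∀ σ, ∀ᶠ l : State n k × ℝ in 𝓝 (S.basePoint v u, 0),
      0 < S.lie (S.field l.2 σ) l.1 := fun σ =>
    (hS.continuousAt_lie hε₀ σ (H.basePoint_mem hu) hz).eventually
      (lt_mem_nhds (by simpa [field_zero] using H.lie_start hu σ))
  -- the neighbourhood in which crossing orbits are determined by the equations
  have hgood := (arc₁.and arc₂).and hA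
  rw [nhds_prod_eq, eventually_prod_iff] at hgood
  obtain ⟨N, hN, J, hJ, hNJ⟩ := hgood
  -- `δ` is fixed here, before `ε` is made small: a crossing periodic solution starting within `δ`,
  -- with `|ε| < δ`, has an upward crossing in `N`.
  have hnear := (hS.exists_crossing_near hε₀ (H.basePoint_mem hu) hh0 (H.lie_start hu) hN)
  obtain ⟨δ, hδ, hδn⟩ := Metric.eventually_nhds_iff.1 hnear
  -- the initial points of the periodic orbits
  let p : ℝ → State n k := fun ε => S.graphPoint ((c ε).1, (c ε).2.1)
  have hpc : ContinuousAt p 0 := by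
    refine ContinuousAt.comp (g := S.graphPoint) (f := fun ε => ((c ε).1, (c ε).2.1)) ?_
      (hc.fst.prodMk hc.snd.fst)
    rw [hc0]
    exact (hS.contDiffAt_graphPoint (H.mem_prod hu)).continuousAt
  have hp0 : p 0 = S.basePoint v u := by simp only [p, hc0]; rfl
  have hpt : Tendsto p (𝓝 0) (𝓝 (S.basePoint v u)) := hp0 ▸ hpc
  have hlt : Tendsto (fun ε => (p ε, ε)) (𝓝 0) (𝓝 (S.basePoint v u, 0)) :=
    hpt.prodMk_nhds tendsto_id
  have ht₁ : Tendsto (fun ε => (c ε).2.2.1) (𝓝 0) (𝓝 (τ .plus u)) := by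
    have := hc.snd.snd.fst
    rwa [ContinuousAt, hc0] at this
  have ht₂ : Tendsto (fun ε => (c ε).2.2.2) (𝓝 0) (𝓝 (τ .minus u)) := by
    have := hc.snd.snd.snd
    rwa [ContinuousAt, hc0] at this
  have hq : Tendsto (fun ε => (S.flowAt .plus ((c ε).2.2.1, p ε, ε), ε)) (𝓝 0)
      (𝓝 (S.endPoint v τ u, 0)) := by
    have h1 := (hS.contDiffAt_flowAt hε₀ (σ := .plus) (t := τ .plus u) (p := S.basePoint v u)
      hz (by rw [field_zero]; exact H.hasSolutionTo hu .plus)).continuousAt.tendsto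
    rw [flowAt_zero] at h1
    exact (h1.comp (ht₁.prodMk_nhds hlt)).prodMk_nhds tendsto_id
  have hlieq : ∀ σ, ∀ᶠ ε in 𝓝 (0 : ℝ),
      S.lie (S.field ε σ) (S.flowAt .plus ((c ε).2.2.1, p ε, ε)) < 0 := fun σ =>
    hq.eventually ((hS.continuousAt_lie hε₀ σ (H.end_mem hu) hz).eventually
      (gt_mem_nhds (by simpa [field_zero] using H.lie_end hu σ)))
  have hall : ∀ᶠ ε in 𝓝 (0 : ℝ), |ε| < δ ∧ J ε ∧ dist (p ε) (S.basePoint v u) < δ ∧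
      S.CrossingAt ε (S.closedOrbit ε (p ε) (c ε).2.2.1 (c ε).2.2.2) 0 (c ε).2.2.1
        ((c ε).2.2.1 - (c ε).2.2.2) := by
    have hδ' : ∀ᶠ ε in 𝓝 (0 : ℝ), |ε| < δ := by
      filter_upwards [Metric.ball_mem_nhds (0 : ℝ) hδ] with ε hε
      simpa [Real.dist_eq] using hε
    have hr : ∀ᶠ ε in 𝓝 (0 : ℝ), |(c ε).2.2.1 - τ .plus u| ≤ r₁ ∧
        |(c ε).2.2.2 - τ .minus u| ≤ r₂ :=
      (ht₁.eventually (Metric.closedBall_mem_nhds _ hr₁)).and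
        (ht₂.eventually (Metric.closedBall_mem_nhds _ hr₂))
    filter_upwards [hδ', hJ, hpt.eventually (Metric.ball_mem_nhds _ hδ), hcs, hr,
      ht₁.eventually (lt_mem_nhds (H.family.tau_pos u hu)),
      ht₂.eventually (gt_mem_nhds (H.family.tau_neg u hu)), hlt.eventually arc₁,
      hlt.eventually arc₂, hlt.eventually (hlie0 .plus), hlt.eventually (hlie0 .minus),
      hlieq .plus, hlieq .minus]
      with ε e1 e2 e3 e4 e5 e6 e7 e8 e9 e10 e11 e12 e13
    refine ⟨e1, e2, e3, ?_⟩
    have hph : S.h (p ε) = 0 := h_graphPoint _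
    have hab : S.flowAt .plus ((c ε).2.2.1, p ε, ε) = S.flowAt .minus ((c ε).2.2.2, p ε, ε) :=
      e4.1
    have hend : S.h (S.flowAt .plus ((c ε).2.2.1, p ε, ε)) = 0 := e4.2
    obtain ⟨a1, a2⟩ := abs_le.1 e5.1
    obtain ⟨b1, b2⟩ := abs_le.1 e5.2
    refine crossingAt_closedOrbit hS hε₀ e8.1 e6 e7 hph
      (e8.2.1.mono (by rw [uIcc_of_le (by linarith)]; exact ⟨e6.le, by linarith⟩))
      (e9.2.1.mono (by rw [uIcc_of_ge (by linarith)]; exact ⟨by linarith, e7.le⟩))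
      hab hend ((e8.2.2 hph).2 _ e5.1 hend) (fun t ht => ?_) (by rintro (_ | _) <;> assumption)
      (by rintro (_ | _) <;> assumption)
    -- Times in the lower zone are counted backwards, hence the sign changes.
    have := (e9.2.2 hph).2 (-(c ε).2.2.2) (by rw [abs_le]; constructor <;> linarith)
      (by rw [neg_neg, ← hab, hend]) (-t) ⟨by linarith [ht.2], by linarith [ht.1]⟩
    rw [neg_neg] at this
    linarith
  obtain ⟨ε₂, hε₂, hall⟩ := Metric.eventually_nhds_iff.1 hall
  have hstart : ∀ ε, |ε| < ε₂ →
      S.closedOrbit ε (p ε) (c ε).2.2.1 (c ε).2.2.2 0 = p ε := fun ε hε => by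
    have hcr := (hall (by simpa [Real.dist_eq] using hε : dist ε 0 < ε₂)).2.2.2
    have hb : (c ε).2.2.2 < 0 := by linarith [hcr.2.1]
    rw [closedOrbit_of_mem_Icc hb ⟨le_rfl, hcr.1.le⟩, flowAt_start]
  refine ⟨min ε₂ ε₀, lt_min hε₂ hε₀, min_le_right _ _, δ, hδ,
    fun ε => S.closedOrbit ε (p ε) (c ε).2.2.1 (c ε).2.2.2, fun ε hεpos hε => ?_, ?_⟩
  · have hε2 : |ε| < ε₂ := hε.trans_le (min_le_left _ _)
    have hεm : ε ∈ Ioo (-ε₀) ε₀ := abs_lt.1 (hε.trans_le (min_le_right _ _))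
    obtain ⟨k1, k2, k3, k4⟩ := hall (by simpa [Real.dist_eq] using hε2 : dist ε 0 < ε₂)
    refine ⟨⟨_, _, _, k4⟩, ⟨k4.2.2.2.1.2 0 ⟨le_rfl, k4.1.le⟩, k4.2.2.2.2.2.1⟩,
      (congrArg (dist · _) (hstart ε hε2)).trans_lt k3, fun ψ hψ hψd => ?_⟩
    obtain ⟨t₀, t₁, t₂, hcr, hNψ, hsw⟩ := hδn (y := (ψ 0, ε))
      (max_lt hψd (by simpa [Real.dist_eq] using k1)) ψ rfl hψ
    -- The upward crossing near the base point is moved to time `0`.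
    have hχ := hcr.comp_add t₀
    rw [sub_self] at hχ
    set χ : ℝ → State n k := fun t => ψ (t + t₀) with hχdef
    set a := t₁ - t₀
    set T := t₂ - t₀
    have hχ0 : N (χ 0) := by simpa [hχdef] using hNψ
    have hχh : S.h (χ 0) = 0 := hχ.2.2.2.2.2.1
    obtain ⟨⟨g1, g2⟩, g3⟩ := hNJ hχ0 k2
    have m1 : |a - τ .plus u| < η := by
      refine (g1.2.2 hχh).1 a hχ.1 χ rfl hχ.isSolutionOn_plus ?_ ?_
      · exact hχ.2.2.2.2.2.2.2.1
      · exact hχ.2.2.2.2.2.2.1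
    have m2 : |T - a + τ .minus u| < η := by
      refine (g2.2.2 hχh).1 (T - a) (by linarith [hχ.2.1]) (fun t => χ (t + T))
        (by simpa using hχ.apply_period) ?_ (fun t ht => ?_) ?_
      · rw [neg_sub]
        exact hχ.isSolutionOn_minus
      · have := hχ.2.2.2.2.2.2.2.2.1 (-t + T) ⟨by linarith [ht.2], by linarith [ht.1]⟩
        linarith
      · have := hχ.2.2.2.2.2.2.1
        simpa using this
    have hfa : S.arrival .plus (((χ 0).1, ε), (χ 0).2.1, (a, a - T)) = χ a := by
      rw [arrival_of_h_eq_zero hχh]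
      exact hχ.flowAt_plus hS hε₀ hεm ⟨hχ.1.le, le_rfl⟩
    have hfb : S.arrival .minus (((χ 0).1, ε), (χ 0).2.1, (a, a - T)) = χ a := by
      rw [arrival_of_h_eq_zero hχh]
      exact hχ.flowAt_minus hS hε₀ hεm ⟨le_rfl, hχ.2.1.le⟩
    -- The start `χ 0` is in `N` and the times are within `η` of `τ`, so local uniqueness puts these
    -- data on the branch `c`.
    have hcε : c ε = ((χ 0).1, (χ 0).2.1, (a, a - T)) := by
      refine hAB g3 (y := (a, a - T)) (hηB ?_) (abs_pos.1 hεpos) (hfa.trans hfb.symm) ?_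
      · rw [Prod.dist_eq, Real.dist_eq, Real.dist_eq]
        refine max_lt m1 ?_
        rwa [← abs_neg, show -(a - T - τ .minus u) = T - a + τ .minus u by ring]
      · change S.h (S.arrival .plus (((χ 0).1, ε), (χ 0).2.1, (a, a - T))) = 0
        rw [hfa]
        exact hχ.2.2.2.2.2.2.1
    have hpε : p ε = χ 0 := by
      simp only [p, hcε]
      exact (eq_graphPoint_of_h_eq_zero hχh).symm
    have hχφ : χ = S.closedOrbit ε (p ε) (c ε).2.2.1 (c ε).2.2.2 := by
      rw [hpε, hcε]
      exact hχ.eq_closedOrbit hS hε₀ hεm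
    refine ⟨⟨-t₀, fun t => ?_⟩, fun h => ?_⟩
    · change ψ t = S.closedOrbit ε (p ε) (c ε).2.2.1 (c ε).2.2.2 (t + -t₀)
      rw [← hχφ]
      simp [hχdef]
    · change ψ = S.closedOrbit ε (p ε) (c ε).2.2.1 (c ε).2.2.2
      rw [← hχφ, hχdef, hsw h]
      simp
  · refine (hpt.mono_left nhdsWithin_le_nhds).congr' ?_
    refine eventually_nhdsWithin_of_eventually_nhds ?_
    filter_upwards [Metric.ball_mem_nhds (0 : ℝ) hε₂] with ε hε
    exact (hstart ε (by simpa [Real.dist_eq] using hε)).symm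

end MelnikovSetting

end PWSystem

theorem theorem1 {n k : ℕ} (hk : 0 < k) (hm : 1 < n + k)
    (S : PWSystem n k) (ε₀ : ℝ) (hε₀ : 0 < ε₀) (hS : S.Regular ε₀)
    (V : Set (EuclideanSpace ℝ (Fin n))) (hV : IsOpen V) (hVb : Bornology.IsBounded V)
    (v : EuclideanSpace ℝ (Fin n) → EuclideanSpace ℝ (Fin k))
    (hv : ContDiffOn ℝ 2 v (closure V))
    (hU : ∀ u ∈ closure V, u ∈ S.D₁ ∧ v u ∈ S.D₂)
    (τ : Side → EuclideanSpace ℝ (Fin n) → ℝ)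
    (H1 : S.CrossingFamily V v τ)
    (hdet : ∀ u ∈ V, (S.beta₂ v τ u).det ≠ 0)
    (us : EuclideanSpace ℝ (Fin n)) (hus : us ∈ V)
    (hzero : S.melnikov v τ us = 0)
    (hsimple : (fderiv ℝ (S.melnikov v τ) us).det ≠ 0) :
    ∃ ε₁ > 0, ε₁ ≤ ε₀ ∧ ∃ δ > 0, ∃ φ : ℝ → ℝ → State n k,
      (∀ ε : ℝ, 0 < |ε| → |ε| < ε₁ →
        S.IsCrossingPeriodicSolution ε (φ ε) ∧
        φ ε 0 ∈ S.switching ∧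
        dist (φ ε 0) (S.basePoint v us) < δ ∧
        ∀ ψ : ℝ → State n k, S.IsCrossingPeriodicSolution ε ψ →
          dist (ψ 0) (S.basePoint v us) < δ →
            (∃ s : ℝ, ∀ t : ℝ, ψ t = φ ε (t + s)) ∧
            (ψ 0 ∈ S.switching → ψ = φ ε)) ∧
      Tendsto (fun ε => φ ε 0) (𝓝[≠] 0) (𝓝 (S.basePoint v us)) := by
  exact PWSystem.MelnikovSetting.exists_unique_crossing
    ⟨hε₀, hS, hV, hv, hU, H1⟩ hus hdet hzero hsimple
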